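/- **Theorem (Shale).** Let $V$ be a complex Hilbert space with inner product $\langle\cdot|\cdot\rangle$ (antilinear in the first variable), let $J=i\cdot$ and $\Omega=\operatorname{Im}\langle\cdot|\cdot\rangle$, and let $\mathrm{Sp}(V)$ be the group of all real-linear automorphisms $g$ of $V$ with $\Omega(gx,gy)=\Omega(x,y)$ for all $x,y\in V$. For $g\in \mathrm{Sp}(V)$ put $C_g=\tfrac12(g-JgJ)$, $A_g=\tfrac12(g+JgJ)$ and $Z_g=C_g^{-1}A_g$ ($C_g$ is always invertible). Let $SV$ be the symmetric algebra of $V$ with inner product determined by orthogonality of the homogeneous summands and $\langle x_1\cdots x_n|y_1\cdots y_n\rangle=\sum_{p}\prod_j\langle x_j|y_{p(j)}\rangle$, $SV'$ the space of all antilinear functionals on $SV$, and $S[V]$ (Fock space) the Hilbert space completion of $SV$, so that $SV\subset S[V]\subset SV'$ by $\Phi\mapsto\langle\cdot|\Phi\rangle$. For $v\in V$ let $c(v)$ be multiplication by $v$ on $SV$, $a(v)$ the derivation of $SV$ with $a(v)w=\langle v|w\rangle$ for $w\in V$, and $\pi(v)=\tfrac1{\sqrt2}(c(v)+a(v))$;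 on $SV'$ put $[\pi(v)\Phi](\psi)=\Phi(\pi(v)\psi)$, and in $S[V]$ let $\pi(v)$ be the restriction to the natural domain $\{\Phi\in S[V]:\pi(v)\Phi\in S[V]\}$. A *unitary metaplectic operator* for $g$ is a unitary operator $T$ on $S[V]$ with $T\pi(v)\varphi=\pi(gv)T\varphi$ in $SV'$ for all $v\in V$, $\varphi\in SV$. Let $V_{\mathbf C}=\mathbf C\otimes_{\mathbf R} V$ with $\langle x|y\rangle=\Omega_{\mathbf C}(\bar x,J_{\mathbf C}y)$ and $v_\pm=\tfrac1{\sqrt2}(v\mp iJv)$; extend $v\mapsto v_+$ and $v\mapsto v_-$ to a linear, respectively antilinear, algebra homomorphism $\varphi\mapsto\varphi_\pm$ from $SV$ to $SV_{\mathbf C}$. Let $Z:V_{\mathbf C}\to V_{\mathbf C}$ be the symmetric antilinear map with $Z(v_+)=(C_g^{-1}v)_-+(Z_{g^{-1}}v)_+$ and $Z(v_-)=(C_{g^{-1}}^{-1}v)_++(Z_gv)_-$, let $\zeta$ be the antilinear functional on $SV_{\mathbf C}$ concentrated in degree two with $\zeta(xy)=\langle y|Zx\rangle$, and let $u_g=e^Z=\sum_n\zeta^n/n!$,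 where antilinear functionals on $SV_{\mathbf C}$ are multiplied by means of the coproduct of $SV_{\mathbf C}$ for which the elements of $V_{\mathbf C}$ are primitive. Let $U_g:SV\to SV'$ be the linear map $[U_g\varphi](\psi)=u_g(\psi_+\varphi_-)$. Then $g$ admits a unitary metaplectic operator if and only if $Z_g$ is a Hilbert–Schmidt operator. The same holds when a unitary metaplectic operator is required to satisfy $T\pi(v)T^{-1}=\pi(gv)$ for all $v\in V$ as an equality of operators in $S[V]$ with their natural domains. Moreover, if $Z_g$ is Hilbert–Schmidt, then $U_g$ maps $SV$ into $S[V]$ and extends to a bounded operator $\overline{U_g}$ on $S[V]$, and, $\mathrm{Det}$ being the Fredholm determinant, $\mathrm{Det}^{1/4}(I-Z_g^2)\,\overline{U_g}$ is a unitary metaplectic operator for $g$, in both senses. -/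

import Mathlib

open scoped TensorProduct ComplexConjugate InnerProductSpace

noncomputable section

namespace BosonicFock

/-! ### Symmetric algebra, full antidual, Gaussians -/

section Algebraic

variable {W : Type*} [AddCommGroup W] [Module ℂ W]

/-- The symmetric algebra `SW`. -/
abbrev SymAlgC (W : Type*) [AddCommGroup W] [Module ℂ W] : Type _ := SymmetricAlgebra ℂ W

/-- The full antidual `SW'`: all antilinear functionals on `SW`. -/
abbrev AntiDual (W : Type*) [AddCommGroup W] [Module ℂ W] : Type _ := SymAlgC W →ₗ⋆[ℂ] ℂ

/-- The generator of `SW` given by a vector. -/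
abbrev gen (w : W) : SymAlgC W := SymmetricAlgebra.ι ℂ W w

/-- The algebra generated by commuting elements is commutative. -/
abbrev adjoinCommRing {A : Type*} [Ring A] [Algebra ℂ A] (f : W →ₗ[ℂ] A)
    (hf : ∀ x y, f x * f y = f y * f x) : CommRing (Algebra.adjoin ℂ (Set.range f)) :=
  { (inferInstance : Ring (Algebra.adjoin ℂ (Set.range f))) with
    mul_comm := (Algebra.isMulCommutative_adjoin ℂ
      (by rintro _ ⟨x, rfl⟩ _ ⟨y, rfl⟩; exact hf x y)).is_comm.comm }

/-- Extension of a linear map with commuting values to an algebra homomorphism on `SW`. -/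
def liftComm {A : Type*} [Ring A] [Algebra ℂ A] (f : W →ₗ[ℂ] A)
    (hf : ∀ x y, f x * f y = f y * f x) : SymAlgC W →ₐ[ℂ] A :=
  letI := adjoinCommRing f hf
  (Algebra.adjoin ℂ (Set.range f)).val.comp
    (SymmetricAlgebra.lift (f.codRestrict (Subalgebra.toSubmodule (Algebra.adjoin ℂ (Set.range f)))
      fun x => Algebra.subset_adjoin ⟨x, rfl⟩))

theorem liftComm_gen {A : Type*} [Ring A] [Algebra ℂ A] (f : W →ₗ[ℂ] A)
    (hf : ∀ x y, f x * f y = f y * f x) (w : W) : liftComm f hf (gen w) = f w := by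
  let := adjoinCommRing f hf
  have := SymmetricAlgebra.lift_ι_apply (A := Algebra.adjoin ℂ (Set.range f))
    (f.codRestrict (Subalgebra.toSubmodule (Algebra.adjoin ℂ (Set.range f)))
      fun x => Algebra.subset_adjoin ⟨x, rfl⟩) w
  exact congrArg Subtype.val this

theorem adjoin_gen : Algebra.adjoin ℂ (Set.range (gen : W → SymAlgC W)) = ⊤ := by
  refine eq_top_iff.2 fun θ _ => ?_
  induction θ using SymmetricAlgebra.induction with
  | algebraMap r => exact Subalgebra.algebraMap_mem _ r
  | ι x => exact Algebra.subset_adjoin ⟨x, rfl⟩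
  | mul a b ha hb => exact mul_mem (ha trivial) (hb trivial)
  | add a b ha hb => exact add_mem (ha trivial) (hb trivial)

/-- Induction on `SW` by multiplication with generators. -/
theorem sym_induction {P : SymAlgC W → Prop} (one : P 1) (gen_mul : ∀ w θ, P θ → P (gen w * θ))
    (add : ∀ θ η, P θ → P η → P (θ + η)) (smul : ∀ (r : ℂ) θ, P θ → P (r • θ)) (θ : SymAlgC W) :
    P θ := by
  suffices h : ∀ η, P η → P (θ * η) by simpa using h 1 one
  induction θ using SymmetricAlgebra.induction with
  | algebraMap r => intro η hη; rw [← Algebra.smul_def]; exact smul r η hη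
  | ι x => exact fun η hη => gen_mul x η hη
  | mul a b ha hb => intro η hη; rw [mul_assoc]; exact ha _ (hb _ hη)
  | add a b ha hb => intro η hη; rw [add_mul]; exact add _ _ (ha _ hη) (hb _ hη)

/-- Auxiliary algebra homomorphism `SW → SW[ε]` extending `w ↦ w + f(w) ε`. -/
def contractAux (f : W →ₗ[ℂ] ℂ) : SymAlgC W →ₐ[ℂ] DualNumber (SymAlgC W) :=
  SymmetricAlgebra.lift
    ((TrivSqZeroExt.inlAlgHom ℂ (SymAlgC W) (SymAlgC W)).toLinearMap ∘ₗ SymmetricAlgebra.ι ℂ W +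
      ((TrivSqZeroExt.inrHom (SymAlgC W) (SymAlgC W)).restrictScalars ℂ) ∘ₗ
        (Algebra.linearMap ℂ (SymAlgC W)) ∘ₗ f)

theorem contractAux_fst (f : W →ₗ[ℂ] ℂ) (θ : SymAlgC W) : (contractAux f θ).fst = θ := by
  induction θ using SymmetricAlgebra.induction with
  | algebraMap r => simp [TrivSqZeroExt.algebraMap_eq_inl']
  | ι x => simp [contractAux]
  | mul a b ha hb => simp [ha, hb]
  | add a b ha hb => simp [ha, hb]

/-- The unique derivation of `SW` that sends each generator `w` to the scalar `f w`. -/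
def contract (f : W →ₗ[ℂ] ℂ) : Derivation ℂ (SymAlgC W) (SymAlgC W) :=
  Derivation.mk' (((TrivSqZeroExt.sndHom (SymAlgC W) (SymAlgC W)).restrictScalars ℂ) ∘ₗ
    (contractAux f).toLinearMap) (by
      intro a b
      simp [contractAux_fst, mul_comm])

theorem contract_gen (f : W →ₗ[ℂ] ℂ) (w : W) :
    contract f (gen w) = algebraMap ℂ (SymAlgC W) (f w) := by
  simp [contract, contractAux, gen, Algebra.algebraMap_eq_smul_one]

theorem derivation_ext {D D' : Derivation ℂ (SymAlgC W) (SymAlgC W)}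
    (h : ∀ w, D (gen w) = D' (gen w)) : D = D' :=
  Derivation.ext_of_adjoin_eq_top _ adjoin_gen (by rintro _ ⟨w, rfl⟩; exact h w)

theorem contract_comm (f f' : W →ₗ[ℂ] ℂ) (θ : SymAlgC W) :
    contract f (contract f' θ) = contract f' (contract f θ) := by
  have : ⁅contract f, contract f'⁆ = 0 := derivation_ext fun w => by
    simp [Derivation.commutator_apply, contract_gen]
  have h := congrArg (fun D => D θ) this
  simpa [Derivation.commutator_apply, sub_eq_zero] using h

/-- The functional `θ ↦ conj ε(θ)`, `ε` being the projection onto degree zero: the unit of the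
algebra `SW'`. -/
def vac : AntiDual W :=
  (starLinearEquiv ℂ (A := ℂ)).toLinearMap.comp
    (SymmetricAlgebra.algebraMapInv (R := ℂ) (M := W)).toLinearMap

/-- The commutative product of `SW'`, dual to the coproduct of `SW` for which generators are
primitive: `[ΦΨ](θ) = [Φ ⊗ Ψ](Δ θ)`. -/
def antiMul (Φ Ψ : AntiDual W) : AntiDual W :=
  (TensorProduct.lift (LinearMap.mk₂'ₛₗ (starRingEnd ℂ) (starRingEnd ℂ)
    (fun a b => Φ a * Ψ b) (by intros; simp [add_mul]) (by intros; simp [mul_assoc])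
    (by intros; simp [mul_add]) (by intros; simp [mul_left_comm]))).comp
    (Coalgebra.comul (R := ℂ) (A := SymAlgC W))

/-- Powers in the algebra `SW'`. -/
def antiPow (Φ : AntiDual W) : ℕ → AntiDual W
  | 0 => vac
  | n + 1 => antiMul Φ (antiPow Φ n)

/-- Auxiliary operator on `ℂ × W × ℂ` used to construct quadratics. -/
def quadAux (B : W →ₗ[ℂ] W →ₗ[ℂ] ℂ) : W →ₗ[ℂ] Module.End ℂ (ℂ × W × ℂ) :=
  LinearMap.mk₂ ℂ (fun w p => (0, p.1 • w, B w p.2.1))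
    (by intros; ext <;> simp) (by
      intro c w p
      refine Prod.ext (by simp) (Prod.ext ?_ (by simp))
      exact smul_comm p.1 c w)
    (by intros; ext <;> simp [add_smul]) (by intros; ext <;> simp [mul_smul])

theorem quadAux_comm (B : W →ₗ[ℂ] W →ₗ[ℂ] ℂ) (hB : ∀ x y, B x y = B y x) (x y : W) :
    quadAux B x * quadAux B y = quadAux B y * quadAux B x := by
  ext <;> simp [quadAux, hB x y]

/-- Symmetric maps `Z : W → W'`. -/
def IsSymmForm (Z : W →ₗ⋆[ℂ] W →ₗ⋆[ℂ] ℂ) : Prop := ∀ x y, Z x y = Z y x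

/-- The complex-bilinear form `(x, y) ↦ conj (Z x y)`. -/
def conjForm (Z : W →ₗ⋆[ℂ] W →ₗ⋆[ℂ] ℂ) : W →ₗ[ℂ] W →ₗ[ℂ] ℂ :=
  LinearMap.mk₂ ℂ (fun x y => conj (Z x y)) (by intros; simp) (by intros; simp)
    (by intros; simp) (by intros; simp)

/-- The quadratic `ζ ∈ S²W'` corresponding to the symmetric `Z : W → W'`: it vanishes outside
degree two and `ζ(xy) = Z x (y)`. -/
def quadratic (Z : W →ₗ⋆[ℂ] W →ₗ⋆[ℂ] ℂ) (hZ : IsSymmForm Z) : AntiDual W :=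
  (starLinearEquiv ℂ (A := ℂ)).toLinearMap.comp
    ((LinearMap.snd ℂ W ℂ ∘ₗ LinearMap.snd ℂ ℂ (W × ℂ)) ∘ₗ
      (LinearMap.applyₗ ((1, 0, 0) : ℂ × W × ℂ)) ∘ₗ
      (liftComm (quadAux (conjForm Z))
        (quadAux_comm _ fun x y => congrArg conj (hZ x y))).toLinearMap)

theorem quadratic_one (Z : W →ₗ⋆[ℂ] W →ₗ⋆[ℂ] ℂ) (hZ : IsSymmForm Z) : quadratic Z hZ 1 = 0 := by
  simp [quadratic]

theorem quadratic_gen (Z : W →ₗ⋆[ℂ] W →ₗ⋆[ℂ] ℂ) (hZ : IsSymmForm Z) (x : W) :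
    quadratic Z hZ (gen x) = 0 := by
  simp [quadratic, liftComm_gen, quadAux]

theorem quadratic_gen_mul_gen (Z : W →ₗ⋆[ℂ] W →ₗ⋆[ℂ] ℂ) (hZ : IsSymmForm Z) (x y : W) :
    quadratic Z hZ (gen x * gen y) = Z x y := by
  simp [quadratic, liftComm_gen, quadAux, conjForm]

theorem quadratic_of_three (Z : W →ₗ⋆[ℂ] W →ₗ⋆[ℂ] ℂ) (hZ : IsSymmForm Z) (x y z : W) (θ : SymAlgC W) :
    quadratic Z hZ (gen x * (gen y * (gen z * θ))) = 0 := by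
  simp [quadratic, liftComm_gen, quadAux, conjForm]

/-- Annihilator-type operator on `SW'`: `Φ ↦ Φ(a ·)`. -/
def antiShift (a : SymAlgC W) (Φ : AntiDual W) : AntiDual W := Φ.comp (LinearMap.mulLeft ℂ a)

/-- `Φ` vanishes in all degrees below `k`. -/
def LowVanish : ℕ → AntiDual W → Prop
  | 0, _ => True
  | k + 1, Φ => Φ 1 = 0 ∧ ∀ w, LowVanish k (antiShift (gen w) Φ)

theorem LowVanish.add {k : ℕ} {Φ Ψ : AntiDual W} (h : LowVanish k Φ) (h' : LowVanish k Ψ) :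
    LowVanish k (Φ + Ψ) := by
  induction k generalizing Φ Ψ with
  | zero => trivial
  | succ k ih => exact ⟨by simp [h.1, h'.1], fun w => ih (h.2 w) (h'.2 w)⟩

theorem LowVanish.smul {k : ℕ} {Φ : AntiDual W} (r : ℂ) (h : LowVanish k Φ) :
    LowVanish k (r • Φ) := by
  induction k generalizing Φ with
  | zero => trivial
  | succ k ih => exact ⟨by simp [h.1], fun w => ih (h.2 w)⟩

theorem LowVanish.mono {k : ℕ} {Φ : AntiDual W} (h : LowVanish (k + 1) Φ) : LowVanish k Φ := by
  induction k generalizing Φ with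
  | zero => trivial
  | succ k ih => exact ⟨h.1, fun w => ih (h.2 w)⟩

theorem LowVanish.of_le {k m : ℕ} {Φ : AntiDual W} (hkm : m ≤ k) (h : LowVanish k Φ) :
    LowVanish m Φ := by
  induction hkm with
  | refl => exact h
  | step _ ih => exact ih h.mono

theorem antiMul_one (Φ Ψ : AntiDual W) : antiMul Φ Ψ 1 = Φ 1 * Ψ 1 := by
  simp [antiMul, Algebra.TensorProduct.one_def]

theorem antiShift_antiMul (w : W) (Φ Ψ : AntiDual W) :
    antiShift (gen w) (antiMul Φ Ψ) =
      antiMul (antiShift (gen w) Φ) Ψ + antiMul Φ (antiShift (gen w) Ψ) := by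
  ext θ
  simp only [antiShift, antiMul, LinearMap.comp_apply, LinearMap.add_apply,
    LinearMap.mulLeft_apply, Bialgebra.comul_mul, gen, SymmetricAlgebra.comul_ι]
  generalize (Coalgebra.comul (R := ℂ) θ) = t
  induction t using TensorProduct.induction_on with
  | zero => simp
  | tmul a b => simp [add_mul]
  | add s t hs ht => rw [mul_add, map_add, hs, ht]; simp only [map_add]; ring

theorem LowVanish.antiMul {j k : ℕ} {Φ Ψ : AntiDual W} (h : LowVanish j Φ) (h' : LowVanish k Ψ) :
    LowVanish (j + k) (antiMul Φ Ψ) := by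
  obtain ⟨n, hn⟩ : ∃ n, n = j + k := ⟨_, rfl⟩
  rw [← hn]
  induction n generalizing j k Φ Ψ with
  | zero => trivial
  | succ n ih =>
    refine ⟨?_, fun w => ?_⟩
    · rw [antiMul_one]
      rcases j with _ | j
      · rcases k with _ | k
        · omega
        · rw [h'.1, mul_zero]
      · rw [h.1, zero_mul]
    · rw [antiShift_antiMul]
      refine LowVanish.add ?_ ?_
      · rcases j with _ | j
        · rcases k with _ | k
          · omega
          · exact ih (j := 0) (k := k) trivial h'.mono (by omega)
        · exact ih (h.2 w) h' (by omega)
      · rcases k with _ | k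
        · rcases j with _ | j
          · omega
          · exact ih (j := j) (k := 0) h.mono trivial (by omega)
        · exact ih h (h'.2 w) (by omega)

theorem lowVanish_quadratic (Z : W →ₗ⋆[ℂ] W →ₗ⋆[ℂ] ℂ) (hZ : IsSymmForm Z) :
    LowVanish 1 (quadratic Z hZ) :=
  ⟨quadratic_one Z hZ, fun _ => trivial⟩

theorem lowVanish_antiPow {Φ : AntiDual W} (h : LowVanish 1 Φ) (n : ℕ) :
    LowVanish n (antiPow Φ n) := by
  induction n with
  | zero => trivial
  | succ n ih => have := h.antiMul ih; rwa [add_comm] at this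

theorem exists_lowVanish_apply (θ : SymAlgC W) :
    ∃ k, ∀ Φ : AntiDual W, LowVanish k Φ → Φ θ = 0 := by
  suffices h : ∃ k, ∀ m (Φ : AntiDual W), LowVanish (k + m) Φ → LowVanish m (antiShift θ Φ) by
    obtain ⟨k, hk⟩ := h
    exact ⟨k + 1, fun Φ hΦ => by simpa [antiShift] using (hk 1 Φ hΦ).1⟩
  induction θ using SymmetricAlgebra.induction with
  | algebraMap r =>
    refine ⟨0, fun m Φ hΦ => ?_⟩
    have : antiShift (algebraMap ℂ (SymAlgC W) r) Φ = (conj r) • Φ := by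
      ext θ; simp [antiShift, ← Algebra.smul_def]
    rw [this]
    exact (hΦ.of_le (by omega)).smul _
  | ι x => exact ⟨1, fun m Φ hΦ => by rw [add_comm] at hΦ; exact hΦ.2 x⟩
  | mul a b ha hb =>
    obtain ⟨k, hk⟩ := ha
    obtain ⟨l, hl⟩ := hb
    refine ⟨k + l, fun m Φ hΦ => ?_⟩
    have : antiShift (a * b) Φ = antiShift b (antiShift a Φ) := by
      ext θ; simp [antiShift]
    rw [this]
    exact hl m _ (hk (l + m) _ (by rwa [← add_assoc]))
  | add a b ha hb =>
    obtain ⟨k, hk⟩ := ha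
    obtain ⟨l, hl⟩ := hb
    refine ⟨max k l, fun m Φ hΦ => ?_⟩
    have : antiShift (a + b) Φ = antiShift a Φ + antiShift b Φ := by
      ext θ; simp [antiShift, add_mul]
    rw [this]
    exact (hk m Φ (hΦ.of_le (by omega))).add (hl m Φ (hΦ.of_le (by omega)))

theorem summable_antiPow {Φ : AntiDual W} (h : LowVanish 1 Φ) (θ : SymAlgC W) :
    Summable fun n : ℕ => ((n.factorial : ℂ)⁻¹) * antiPow Φ n θ := by
  obtain ⟨k, hk⟩ := exists_lowVanish_apply θ
  refine summable_of_ne_finset_zero (s := Finset.range k) fun n hn => ?_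
  rw [hk _ ((lowVanish_antiPow h n).of_le (by simpa using hn)), mul_zero]

/-- The Gaussian `e^Z = exp ζ = ∑ ζⁿ / n!`, the series converging pointwise on `SW`. -/
def gaussian (Z : W →ₗ⋆[ℂ] W →ₗ⋆[ℂ] ℂ) (hZ : IsSymmForm Z) : AntiDual W where
  toFun θ := ∑' n : ℕ, ((n.factorial : ℂ)⁻¹) * antiPow (quadratic Z hZ) n θ
  map_add' θ η := by
    rw [← (summable_antiPow (lowVanish_quadratic Z hZ) θ).tsum_add
      (summable_antiPow (lowVanish_quadratic Z hZ) η)]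
    simp [mul_add]
  map_smul' r θ := by
    rw [smul_eq_mul, ← tsum_mul_left]
    simp [mul_left_comm]

end Algebraic

/-! ### Fock space -/

section Fock

variable {V : Type*} [NormedAddCommGroup V] [InnerProductSpace ℂ V]

/-- The creator `c(v)` on `SV`: multiplication by `v`. -/
def creator (v : V) : Module.End ℂ (SymAlgC V) := LinearMap.mulLeft ℂ (gen v)

/-- The annihilator `a(v)` on `SV`: the derivation with `a(v) w = ⟨v, w⟩`. -/
def annihilator (v : V) : Module.End ℂ (SymAlgC V) :=
  (contract (innerSL ℂ v).toLinearMap : SymAlgC V →ₗ[ℂ] SymAlgC V)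

theorem annihilator_one (v : V) : annihilator v 1 = 0 := Derivation.map_one_eq_zero _

theorem annihilator_gen_mul (v w : V) (θ : SymAlgC V) :
    annihilator v (gen w * θ) = ⟪v, w⟫_ℂ • θ + gen w * annihilator v θ := by
  have h : contract (innerSL ℂ v).toLinearMap (gen w) = algebraMap ℂ (SymAlgC V) ⟪v, w⟫_ℂ :=
    contract_gen _ w
  simp only [annihilator, Derivation.coeFn_coe, Derivation.leibniz, h, smul_eq_mul]
  rw [Algebra.smul_def]
  ring

theorem annihilator_comm (v w : V) (θ : SymAlgC V) :
    annihilator v (annihilator w θ) = annihilator w (annihilator v θ) :=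
  contract_comm _ _ θ

theorem annihilator_add (v w : V) : annihilator (v + w) = annihilator v + annihilator w := by
  have : contract (innerSL ℂ (v + w)).toLinearMap =
      contract (innerSL ℂ v).toLinearMap + contract (innerSL ℂ w).toLinearMap :=
    derivation_ext fun x => by simp [contract_gen]
  ext1 θ
  exact congrArg (fun D => D θ) this

theorem annihilator_smul (r : ℂ) (v : V) : annihilator (r • v) = conj r • annihilator v := by
  have : contract (innerSL ℂ (r • v)).toLinearMap =
      conj r • contract (innerSL ℂ v).toLinearMap :=
    derivation_ext fun x => by simp [contract_gen, Algebra.smul_def]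
  ext1 θ
  exact congrArg (fun D => D θ) this

/-- The creators on `SV'`, given by `[c(v) Φ](ψ) = Φ(a(v) ψ)`. -/
def dualCreator : V →ₗ[ℂ] Module.End ℂ (AntiDual V) :=
  LinearMap.mk₂ ℂ (fun v Φ => Φ.comp (annihilator v))
    (by intros; ext; simp [annihilator_add]) (by intros; ext; simp [annihilator_smul])
    (by intros; rfl) (by intros; rfl)

theorem dualCreator_comm (v w : V) :
    dualCreator v * dualCreator w = dualCreator w * (dualCreator v : Module.End ℂ (AntiDual V)) := by
  ext Φ ψ
  simp [dualCreator, annihilator_comm v w ψ]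

/-- The canonical inner product in the form of the embedding `SV → SV'`, `φ ↦ ⟨· | φ⟩`: the
functional `⟨· | v₁ ⋯ vₙ⟩` arises from `⟨· | 1⟩` by applying the creators `c(v₁), …, c(vₙ)`. -/
def symToDual : SymAlgC V →ₗ[ℂ] AntiDual V :=
  (LinearMap.applyₗ (vac : AntiDual V)) ∘ₗ (liftComm dualCreator dualCreator_comm).toLinearMap

theorem symToDual_one : symToDual (1 : SymAlgC V) = vac := by
  simp [symToDual]

theorem symToDual_gen_mul (v : V) (φ ψ : SymAlgC V) :
    symToDual (gen v * φ) ψ = symToDual φ (annihilator v ψ) := by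
  simp only [symToDual, LinearMap.comp_apply, AlgHom.toLinearMap_apply, map_mul, liftComm_gen]
  rfl

theorem vac_one : (vac : AntiDual V) 1 = 1 := by simp [vac]

theorem vac_gen_mul (v : V) (θ : SymAlgC V) : vac (gen v * θ) = 0 := by
  simp [vac, SymmetricAlgebra.algebraMapInv_ι]

theorem symToDual_apply_gen_mul (v : V) (φ ψ : SymAlgC V) :
    symToDual φ (gen v * ψ) = symToDual (annihilator v φ) ψ := by
  induction φ using sym_induction generalizing ψ with
  | one => rw [symToDual_one, vac_gen_mul, annihilator_one]; simp
  | gen_mul w φ ih =>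
    rw [symToDual_gen_mul, annihilator_gen_mul, annihilator_gen_mul]
    simp only [map_add, map_smul, LinearMap.add_apply, LinearMap.smul_apply, ih,
      symToDual_gen_mul, map_smulₛₗ, inner_conj_symm]
  | add φ η h h' => simp [h, h']
  | smul r φ h => simp [h]

theorem symToDual_symm (φ ψ : SymAlgC V) : conj (symToDual ψ φ) = symToDual φ ψ := by
  induction φ using sym_induction generalizing ψ with
  | one =>
    rw [symToDual_one]
    induction ψ using sym_induction with
    | one => simp [symToDual_one, vac_one]
    | gen_mul w ψ ih => rw [symToDual_gen_mul, annihilator_one, vac_gen_mul]; simp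
    | add φ η h h' => simp [h, h']
    | smul r φ h => simp [h]
  | gen_mul w φ ih => rw [symToDual_apply_gen_mul, symToDual_gen_mul, ih]
  | add φ η h h' => simp [h, h']
  | smul r φ h => simp [h]

/-- Monomials in vectors `e i`. -/
def monom {ι : Type*} (e : ι → V) : MvPolynomial ι ℂ →ₐ[ℂ] SymAlgC V :=
  MvPolynomial.aeval fun i => gen (e i)

theorem annihilator_monom {ι : Type*} [DecidableEq ι] {e : ι → V} (he : Orthonormal ℂ e) (i : ι)
    (P : MvPolynomial ι ℂ) :
    annihilator (e i) (monom e P) = monom e (MvPolynomial.pderiv i P) := by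
  induction P using MvPolynomial.induction_on with
  | C a => simp [monom, annihilator]
  | add p q hp hq => simp [hp, hq]
  | mul_X p j hp =>
    rw [mul_comm, map_mul, show monom e (MvPolynomial.X j) = gen (e j) by simp [monom],
      annihilator_gen_mul, hp, Derivation.leibniz, orthonormal_iff_ite.1 he i j,
      MvPolynomial.pderiv_X]
    rw [map_add, smul_eq_mul, smul_eq_mul, map_mul, map_mul,
      show monom e (MvPolynomial.X j) = gen (e j) by simp [monom], add_comm]
    by_cases h : i = j
    · subst h; simp
    · simp [h, Ne.symm h]

theorem monom_monomial_add {ι : Type*} (e : ι → V) (i : ι) (α : ι →₀ ℕ) :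
    monom e (MvPolynomial.monomial (α + Finsupp.single i 1) 1) =
      gen (e i) * monom e (MvPolynomial.monomial α 1) := by
  rw [show gen (e i) = monom e (MvPolynomial.X i) by simp [monom], ← map_mul, mul_comm,
    MvPolynomial.X, MvPolynomial.monomial_mul, mul_one]

theorem sub_single_add {ι : Type*} [DecidableEq ι] {α : ι →₀ ℕ} {i : ι} (h : α i ≠ 0) :
    α - Finsupp.single i 1 + Finsupp.single i 1 = α := by
  refine tsub_add_cancel_of_le ?_
  rw [Finsupp.single_le_iff]
  omega

theorem symToDual_monomial {ι : Type*} [DecidableEq ι] {e : ι → V} (he : Orthonormal ℂ e)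
    (α : ι →₀ ℕ) : ∃ c : ℝ, 0 < c ∧ ∀ β : ι →₀ ℕ,
    symToDual (monom e (MvPolynomial.monomial α 1)) (monom e (MvPolynomial.monomial β 1)) =
      if α = β then (c : ℂ) else 0 := by
  obtain ⟨n, hn⟩ : ∃ n, n = α.degree := ⟨_, rfl⟩
  induction n generalizing α with
  | zero =>
    have hα : α = 0 := (Finsupp.degree_eq_zero_iff α).1 hn.symm
    subst hα
    refine ⟨1, one_pos, fun β => ?_⟩
    have h1 : monom e (MvPolynomial.monomial 0 1) = 1 := map_one _
    rw [h1, symToDual_one]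
    by_cases hβ : 0 = β
    · subst hβ
      rw [h1, vac_one]; simp
    · obtain ⟨i, hi⟩ : ∃ i, β i ≠ 0 := by
        by_contra! h
        exact hβ (Finsupp.ext fun i => (h i).symm)
      rw [if_neg hβ, ← sub_single_add hi, monom_monomial_add, vac_gen_mul]
  | succ n ih =>
    obtain ⟨i, hi⟩ : ∃ i, α i ≠ 0 := by
      by_contra! h
      have : α = 0 := Finsupp.ext h
      simp [this] at hn
    obtain ⟨c, hc, h⟩ := ih (α - Finsupp.single i 1) (by
      have := congrArg Finsupp.degree (sub_single_add hi)
      rw [map_add, Finsupp.degree_single] at this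
      omega)
    refine ⟨α i * c, mul_pos (by exact_mod_cast Nat.pos_of_ne_zero hi) hc, fun β => ?_⟩
    have h2 : (MvPolynomial.monomial (β - Finsupp.single i 1) ((1 : ℂ) * (β i : ℂ))) =
        (β i : ℂ) • MvPolynomial.monomial (β - Finsupp.single i 1) 1 := by
      simp [MvPolynomial.smul_monomial]
    conv_lhs => rw [← sub_single_add hi]
    rw [monom_monomial_add, symToDual_gen_mul, annihilator_monom he, MvPolynomial.pderiv_monomial,
      h2, map_smul, map_smulₛₗ, h]
    by_cases hαβ : α = β
    · subst hαβ; simp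
    · rw [if_neg hαβ]
      by_cases hβ : β i = 0
      · simp [hβ]
      · rw [if_neg, smul_zero]
        intro h'
        exact hαβ (by rw [← sub_single_add hi, h', sub_single_add hβ])

theorem symToDual_monom_self {ι : Type*} {e : ι → V} (he : Orthonormal ℂ e)
    (P : MvPolynomial ι ℂ) : ∃ r : ℝ, 0 ≤ r ∧ symToDual (monom e P) (monom e P) = r ∧
      (r = 0 → P = 0) := by
  classical
  choose c hc h using symToDual_monomial he
  refine ⟨∑ α ∈ P.support, c α * ‖P.coeff α‖ ^ 2, Finset.sum_nonneg fun α _ =>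
    mul_nonneg (hc α).le (by positivity), ?_, fun h0 => ?_⟩
  · have hP : monom e P =
        ∑ α ∈ P.support, P.coeff α • monom e (MvPolynomial.monomial α 1) := by
      conv_lhs => rw [P.as_sum]
      rw [map_sum]
      refine Finset.sum_congr rfl fun α _ => ?_
      rw [← map_smul, MvPolynomial.smul_monomial, smul_eq_mul, mul_one]
    rw [hP]
    simp only [map_sum, LinearMap.sum_apply, map_smul, LinearMap.smul_apply, map_smulₛₗ, h]
    push_cast
    refine Finset.sum_congr rfl fun β hβ => ?_
    rw [Finset.sum_eq_single β]
    · rw [if_pos rfl, ← Complex.mul_conj' (P.coeff β)]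
      simp only [smul_eq_mul]
      ring
    · intro α _ hα
      simp [hα]
    · intro hα
      exact absurd hβ hα
  · ext α
    by_contra hα
    have hmem : α ∈ P.support := MvPolynomial.mem_support_iff.2 hα
    have := (Finset.sum_eq_zero_iff_of_nonneg (fun α _ =>
      mul_nonneg (hc α).le (by positivity))).1 h0 α hmem
    have h3 : P.coeff α = 0 := by simpa [(hc α).ne'] using this
    exact hα (by simpa using h3)

theorem exists_monom (θ : SymAlgC V) : ∃ (n : ℕ) (e : Fin n → V) (_ : Orthonormal ℂ e)
    (P : MvPolynomial (Fin n) ℂ), monom e P = θ := by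
  have key : ∃ s : Finset V, θ ∈ Algebra.adjoin ℂ (gen '' (s : Set V)) := by
    classical
    induction θ using SymmetricAlgebra.induction with
    | algebraMap r => exact ⟨∅, Subalgebra.algebraMap_mem _ r⟩
    | ι x => exact ⟨{x}, Algebra.subset_adjoin ⟨x, by simp, rfl⟩⟩
    | mul a b ha hb =>
      obtain ⟨s, hs⟩ := ha
      obtain ⟨t, ht⟩ := hb
      exact ⟨s ∪ t, mul_mem (Algebra.adjoin_mono (Set.image_mono (by simp)) hs)
        (Algebra.adjoin_mono (Set.image_mono (by simp)) ht)⟩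
    | add a b ha hb =>
      obtain ⟨s, hs⟩ := ha
      obtain ⟨t, ht⟩ := hb
      exact ⟨s ∪ t, add_mem (Algebra.adjoin_mono (Set.image_mono (by simp)) hs)
        (Algebra.adjoin_mono (Set.image_mono (by simp)) ht)⟩
  obtain ⟨s, hs⟩ := key
  let E := Submodule.span ℂ (s : Set V)
  let b := stdOrthonormalBasis ℂ E
  refine ⟨_, fun i => (b i : V), b.orthonormal.comp_linearIsometry E.subtypeₗᵢ, ?_⟩
  change θ ∈ (monom fun i => (b i : V)).range
  refine (Algebra.adjoin_le ?_ : Algebra.adjoin ℂ (gen '' (s : Set V)) ≤ _) hs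
  rintro _ ⟨x, hx, rfl⟩
  have hsum : x = ∑ i, b.repr ⟨x, Submodule.subset_span hx⟩ i • (b i : V) := by
    have := congrArg Subtype.val (b.sum_repr ⟨x, Submodule.subset_span hx⟩)
    simpa using this.symm
  rw [hsum]
  change gen _ ∈ (monom fun i => (b i : V)).range
  simp only [gen, map_sum, map_smul]
  refine sum_mem fun i _ => Subalgebra.smul_mem _ ?_ _
  exact (AlgHom.mem_range _).2 ⟨MvPolynomial.X i, by simp [monom]⟩

/-- The canonical inner product of `SV`, antilinear in the first argument. -/
abbrev symCore (V : Type*) [NormedAddCommGroup V] [InnerProductSpace ℂ V] :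
    InnerProductSpace.Core ℂ (SymAlgC V) where
  inner ψ φ := symToDual φ ψ
  conj_inner_symm φ ψ := symToDual_symm ψ φ
  re_inner_nonneg θ := by
    obtain ⟨n, e, he, P, rfl⟩ := exists_monom θ
    obtain ⟨r, hr, h, -⟩ := symToDual_monom_self he P
    rw [h]
    simpa using hr
  add_left φ ψ θ := map_add _ _ _
  smul_left φ ψ r := by simp
  definite θ h0 := by
    obtain ⟨n, e, he, P, rfl⟩ := exists_monom θ
    obtain ⟨r, hr, h, h'⟩ := symToDual_monom_self he P
    rw [h] at h0
    rw [h' (by exact_mod_cast h0), map_zero]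

instance symNormed : NormedAddCommGroup (SymAlgC V) := (symCore V).toNormedAddCommGroup

instance symInner : InnerProductSpace ℂ (SymAlgC V) := InnerProductSpace.ofCore (symCore V).toCore

variable (V) in
/-- Bosonic Fock space `S[V]`: the Hilbert space completion of `SV`. -/
abbrev Fock : Type _ := UniformSpace.Completion (SymAlgC V)

/-- The inclusion `SV → S[V]`. -/
def toFock : SymAlgC V →ₗᵢ[ℂ] Fock V := UniformSpace.Completion.toComplₗᵢ

/-- The inclusion `S[V] → SV'`, `Φ ↦ ⟨· | Φ⟩`, by which Fock space is regarded as the space of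
bounded antifunctionals on `SV`. -/
def fockToDual : Fock V →ₗ[ℂ] AntiDual V :=
  LinearMap.mk₂'ₛₗ (RingHom.id ℂ) (starRingEnd ℂ) (fun Φ ψ => ⟪toFock ψ, Φ⟫_ℂ)
    (by intros; simp [inner_add_right]) (by intros; simp [inner_smul_right])
    (by intros; simp [inner_add_left]) (by intros; simp [inner_smul_left])

theorem fockToDual_toFock (φ : SymAlgC V) : fockToDual (toFock φ) = symToDual φ := by
  ext ψ
  exact toFock.inner_map_map ψ φ

/-- The Fock representation `π(v) = (c(v) + a(v)) / √2` on `SV`. -/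
def field (v : V) : Module.End ℂ (SymAlgC V) :=
  ((Real.sqrt 2 : ℂ)⁻¹) • (creator v + annihilator v)

/-- The Fock representation on `SV'`: `[π(v) Φ](ψ) = Φ(π(v) ψ)`. -/
def dualField (v : V) (Φ : AntiDual V) : AntiDual V := Φ.comp (field v)

/-- `Φ` belongs to the natural domain `{Φ ∈ S[V] : π(v) Φ ∈ S[V]}` and `π(v) Φ = Ψ`; that is,
`(Φ, Ψ)` belongs to the graph of the selfadjoint operator `π(v)` in Fock space. -/
def IsFieldValue (v : V) (Φ Ψ : Fock V) : Prop := fockToDual Ψ = dualField v (fockToDual Φ)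

end Fock

/-! ### The symplectic group -/

section Symplectic

variable {V : Type*} [NormedAddCommGroup V] [InnerProductSpace ℂ V]

variable (V) in
/-- The real symplectic form `Ω = Im ⟨· | ·⟩`. -/
def omega : LinearMap.BilinForm ℝ V :=
  LinearMap.mk₂ ℝ (fun x y => (⟪x, y⟫_ℂ).im) (by intros; simp)
    (by intro c x y; rw [← Complex.coe_smul, inner_smul_left]; simp)
    (by intros; simp)
    (by intro c x y; rw [← Complex.coe_smul, inner_smul_right]; simp)

variable (V) in
/-- The complex structure `J = i ·`, as a real-linear map. -/
def cplxJ : V →ₗ[ℝ] V := (Complex.I • (LinearMap.id : V →ₗ[ℂ] V)).restrictScalars ℝ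

variable (V) in
/-- The symplectic group: all real-linear automorphisms preserving `Ω`. -/
def SpGroup : Subgroup (V ≃ₗ[ℝ] V) where
  carrier := {g | ∀ x y, omega V (g x) (g y) = omega V x y}
  mul_mem' := fun {g h} hg hh x y => (hg (h x) (h y)).trans (hh x y)
  one_mem' _ _ := rfl
  inv_mem' := fun {g} hg x y => by
    have := hg (g⁻¹ x) (g⁻¹ y)
    have e : ∀ z, g (g⁻¹ z) = z := g.apply_symm_apply
    rw [e, e] at this
    exact this.symm

theorem smul_eq_re_im {E : Type*} [AddCommGroup E] [Module ℂ E] [Module ℝ E]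
    [IsScalarTower ℝ ℂ E] (r : ℂ) (w : E) : r • w = r.re • w + r.im • (Complex.I • w) := by
  rw [← smul_assoc, ← algebraMap_smul ℂ r.re w, ← add_smul]
  congr 1
  rw [Complex.real_smul]
  exact (Complex.re_add_im r).symm

/-- A real-linear map that commutes with `i` is complex-linear. -/
def toLin {E F : Type*} [AddCommGroup E] [Module ℂ E] [Module ℝ E] [IsScalarTower ℝ ℂ E]
    [AddCommGroup F] [Module ℂ F] [Module ℝ F] [IsScalarTower ℝ ℂ F] (f : E →ₗ[ℝ] F)
    (hf : ∀ v, f (Complex.I • v) = Complex.I • f v) : E →ₗ[ℂ] F where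
  toFun := f
  map_add' := map_add f
  map_smul' r v := by
    rw [smul_eq_re_im r v, map_add, map_smul, map_smul, hf, RingHom.id_apply, smul_eq_re_im r]

/-- A real-linear map that anticommutes with `i` is antilinear. -/
def toAntilin {E F : Type*} [AddCommGroup E] [Module ℂ E] [Module ℝ E] [IsScalarTower ℝ ℂ E]
    [AddCommGroup F] [Module ℂ F] [Module ℝ F] [IsScalarTower ℝ ℂ F] (f : E →ₗ[ℝ] F)
    (hf : ∀ v, f (Complex.I • v) = -(Complex.I • f v)) : E →ₗ⋆[ℂ] F where
  toFun := f
  map_add' := map_add f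
  map_smul' r v := by
    rw [smul_eq_re_im r v, map_add, map_smul, map_smul, hf, smul_eq_re_im (conj r)]
    simp

/-- `(g - JgJ) / 2`, the complex-linear part of a real-linear map. -/
def linPart (g : V →ₗ[ℝ] V) : V →ₗ[ℂ] V :=
  toLin ((2 : ℝ)⁻¹ • (g - cplxJ V ∘ₗ g ∘ₗ cplxJ V)) fun v => by
    simp [cplxJ, smul_smul, smul_sub, smul_comm Complex.I (2 : ℝ)⁻¹]
    abel

/-- `(g + JgJ) / 2`, the antilinear part of a real-linear map. -/
def antiPart (g : V →ₗ[ℝ] V) : V →ₗ⋆[ℂ] V :=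
  toAntilin ((2 : ℝ)⁻¹ • (g + cplxJ V ∘ₗ g ∘ₗ cplxJ V)) fun v => by
    simp [cplxJ, smul_smul, smul_comm Complex.I (2 : ℝ)⁻¹]

/-- `C_g` for `g ∈ Sp(V)`. -/
def Cg (g : SpGroup V) : V →ₗ[ℂ] V := linPart (g : V ≃ₗ[ℝ] V).toLinearMap

/-- `A_g` for `g ∈ Sp(V)`. -/
def Ag (g : SpGroup V) : V →ₗ⋆[ℂ] V := antiPart (g : V ≃ₗ[ℝ] V).toLinearMap

theorem Cg_add_Ag (g : SpGroup V) (v : V) : Cg g v + Ag g v = (g : V ≃ₗ[ℝ] V) v := by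
  change (2 : ℝ)⁻¹ • ((g : V ≃ₗ[ℝ] V) v - Complex.I • (g : V ≃ₗ[ℝ] V) (Complex.I • v)) +
    (2 : ℝ)⁻¹ • ((g : V ≃ₗ[ℝ] V) v + Complex.I • (g : V ≃ₗ[ℝ] V) (Complex.I • v)) = _
  rw [← smul_add, sub_add_add_cancel, ← two_smul ℝ, smul_smul]
  simp

theorem im_inner_inv (g : SpGroup V) (x y : V) :
    (⟪(g : V ≃ₗ[ℝ] V) x, y⟫_ℂ).im = (⟪x, (g⁻¹ : SpGroup V).1 y⟫_ℂ).im := by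
  have := g.2 x ((g⁻¹ : SpGroup V).1 y)
  have h2 : (g : V ≃ₗ[ℝ] V) ((g⁻¹ : SpGroup V).1 y) = y := g.1.apply_symm_apply y
  rw [h2] at this
  exact this

theorem inner_Cg (g : SpGroup V) (x y : V) : ⟪Cg g x, y⟫_ℂ = ⟪x, Cg g⁻¹ y⟫_ℂ := by
  have e1 := im_inner_inv g x y
  have e2 := im_inner_inv g x (Complex.I • y)
  have e3 := im_inner_inv g (Complex.I • x) y
  have e4 := im_inner_inv g (Complex.I • x) (Complex.I • y)
  change ⟪(2 : ℝ)⁻¹ • ((g : V ≃ₗ[ℝ] V) x - Complex.I • (g : V ≃ₗ[ℝ] V) (Complex.I • x)), y⟫_ℂ =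
    ⟪x, (2 : ℝ)⁻¹ • ((g⁻¹ : SpGroup V).1 y - Complex.I • (g⁻¹ : SpGroup V).1 (Complex.I • y))⟫_ℂ
  rw [← Complex.coe_smul, ← Complex.coe_smul, inner_smul_left, inner_smul_right, inner_sub_left,
    inner_sub_right]
  simp only [inner_smul_left, inner_smul_right] at *
  apply Complex.ext <;> simp at * <;> linarith

theorem inner_Ag (g : SpGroup V) (x y : V) : ⟪Ag g x, y⟫_ℂ = -⟪Ag g⁻¹ y, x⟫_ℂ := by
  have e1 := im_inner_inv g x y
  have e2 := im_inner_inv g x (Complex.I • y)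
  have e3 := im_inner_inv g (Complex.I • x) y
  have e4 := im_inner_inv g (Complex.I • x) (Complex.I • y)
  rw [← inner_conj_symm (Ag g⁻¹ y) x]
  change ⟪(2 : ℝ)⁻¹ • ((g : V ≃ₗ[ℝ] V) x + Complex.I • (g : V ≃ₗ[ℝ] V) (Complex.I • x)), y⟫_ℂ =
    -conj ⟪x, (2 : ℝ)⁻¹ • ((g⁻¹ : SpGroup V).1 y +
      Complex.I • (g⁻¹ : SpGroup V).1 (Complex.I • y))⟫_ℂ
  rw [← Complex.coe_smul, ← Complex.coe_smul, inner_smul_left, inner_smul_right, inner_add_left,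
    inner_add_right]
  simp only [inner_smul_left, inner_smul_right] at *
  apply Complex.ext <;> simp [-inner_conj_symm] at * <;> linarith

theorem lin_anti_unique {f f' : V →ₗ[ℂ] V} {k k' : V →ₗ⋆[ℂ] V}
    (h : ∀ v, f v + k v = f' v + k' v) (v : V) : f v = f' v ∧ k v = k' v := by
  have h1 := h v
  have h2 := h (Complex.I • v)
  simp only [map_smul, map_smulₛₗ, Complex.conj_I, neg_smul, ← sub_eq_add_neg, ← smul_sub] at h2
  have h3 := smul_right_injective V Complex.I_ne_zero h2
  have h4 : (2 : ℂ) • f v = (2 : ℂ) • f' v := by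
    rw [two_smul, two_smul]
    calc f v + f v = (f v + k v) + (f v - k v) := by abel
      _ = (f' v + k' v) + (f' v - k' v) := by rw [h1, h3]
      _ = _ := by abel
  have h5 : f v = f' v := smul_right_injective V two_ne_zero h4
  exact ⟨h5, by rw [h5] at h1; exact add_left_cancel h1⟩

theorem Cg_Ag_inv (g : SpGroup V) (v : V) :
    Cg g⁻¹ (Cg g v) + Ag g⁻¹ (Ag g v) = v ∧ Cg g⁻¹ (Ag g v) + Ag g⁻¹ (Cg g v) = 0 := by
  have := lin_anti_unique (f := (Cg g⁻¹).comp (Cg g) + (Ag g⁻¹).comp (Ag g)) (f' := LinearMap.id)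
    (k := (Cg g⁻¹).comp (Ag g) + (Ag g⁻¹).comp (Cg g)) (k' := 0) (fun v => ?_) v
  · simpa using this
  · have h1 : (g⁻¹ : SpGroup V).1 ((g : V ≃ₗ[ℝ] V) v) = v := g.1.symm_apply_apply v
    rw [← Cg_add_Ag g v, ← Cg_add_Ag g⁻¹] at h1
    simp only [map_add] at h1
    simp only [LinearMap.add_apply, LinearMap.comp_apply, LinearMap.id_apply, LinearMap.zero_apply,
      add_zero]
    conv_rhs => rw [← h1]
    abel

theorem norm_sq_Cg (g : SpGroup V) (v : V) : ‖Cg g v‖ ^ 2 = ‖v‖ ^ 2 + ‖Ag g v‖ ^ 2 := by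
  have h : ⟪Cg g v, Cg g v⟫_ℂ = ⟪v, v⟫_ℂ + ⟪Ag g v, Ag g v⟫_ℂ := by
    have h2 : ⟪v, Ag g⁻¹ (Ag g v)⟫_ℂ = -⟪Ag g v, Ag g v⟫_ℂ := by
      rw [← inner_conj_symm, ← neg_neg ⟪Ag g⁻¹ (Ag g v), v⟫_ℂ, ← inner_Ag, map_neg, inner_conj_symm]
    rw [inner_Cg, eq_sub_of_add_eq (Cg_Ag_inv g v).1, inner_sub_right, h2, sub_neg_eq_add]
  simp only [inner_self_eq_norm_sq_to_K] at h
  exact_mod_cast h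

theorem norm_le_norm_Cg (g : SpGroup V) (v : V) : ‖v‖ ≤ ‖Cg g v‖ := by
  have := norm_sq_Cg g v
  exact le_of_sq_le_sq (by nlinarith [sq_nonneg ‖Ag g v‖]) (norm_nonneg _)

variable [CompleteSpace V]

theorem continuous_Cg (g : SpGroup V) : Continuous (Cg g) := by
  refine LinearMap.continuous_of_seq_closed_graph (Cg g) fun u x y hu hCu => ?_
  refine ext_inner_right ℂ fun w => ?_
  rw [inner_Cg]
  refine tendsto_nhds_unique (hCu.inner tendsto_const_nhds) ?_
  simp only [Function.comp_apply, inner_Cg]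
  exact hu.inner tendsto_const_nhds

theorem bijective_Cg (g : SpGroup V) : Function.Bijective (Cg g) := by
  have hinj : ∀ g : SpGroup V, ∀ v, Cg g v = 0 → v = 0 := fun g v h => by
    have := norm_le_norm_Cg g v
    rw [h, norm_zero] at this
    exact norm_le_zero_iff.1 this
  refine ⟨(injective_iff_map_eq_zero _).2 (hinj g), LinearMap.range_eq_top.1 ?_⟩
  have hanti : AntilipschitzWith 1 (⟨Cg g, continuous_Cg g⟩ : V →L[ℂ] V) :=
    ContinuousLinearMap.antilipschitz_of_bound _ fun v => by simpa using norm_le_norm_Cg g v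
  have hclosed : IsClosed ((LinearMap.range (Cg g) : Submodule ℂ V) : Set V) := by
    have := hanti.isClosed_range (⟨Cg g, continuous_Cg g⟩ : V →L[ℂ] V).uniformContinuous
    exact this
  have : CompleteSpace (LinearMap.range (Cg g)) := hclosed.completeSpace_coe
  rw [← Submodule.orthogonal_eq_bot_iff, Submodule.eq_bot_iff]
  intro y hy
  refine hinj g⁻¹ y (ext_inner_left ℂ fun x => ?_)
  rw [← inner_Cg, inner_zero_right]
  exact hy _ ⟨x, rfl⟩

/-- `C_g`, which is invertible, as a linear equivalence. -/
def CgEquiv (g : SpGroup V) : V ≃ₗ[ℂ] V := LinearEquiv.ofBijective (Cg g) (bijective_Cg g)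

/-- `Z_g = C_g⁻¹ A_g`. -/
def Zg (g : SpGroup V) : V →ₗ⋆[ℂ] V := (CgEquiv g).symm.toLinearMap.comp (Ag g)

theorem Cg_CgEquiv_symm (g : SpGroup V) (v : V) : Cg g ((CgEquiv g).symm v) = v :=
  (CgEquiv g).apply_symm_apply v

theorem inner_CgEquiv_symm (g : SpGroup V) (v w : V) :
    ⟪(CgEquiv g).symm v, w⟫_ℂ = ⟪v, (CgEquiv g⁻¹).symm w⟫_ℂ := by
  conv_lhs => rw [← Cg_CgEquiv_symm g⁻¹ w]
  rw [← inner_Cg, Cg_CgEquiv_symm]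

theorem inner_Zg (g : SpGroup V) (x y : V) : ⟪y, Zg g x⟫_ℂ = ⟪x, Zg g y⟫_ℂ := by
  obtain ⟨w, rfl⟩ := (bijective_Cg g⁻¹).2 y
  have h1 : Zg g (Cg g⁻¹ w) = -Ag g⁻¹ w := by
    have h := (Cg_Ag_inv g⁻¹ w).2
    rw [inv_inv] at h
    apply (CgEquiv g).injective
    rw [map_neg]
    change Cg g ((CgEquiv g).symm (Ag g (Cg g⁻¹ w))) = -Cg g (Ag g⁻¹ w)
    rw [Cg_CgEquiv_symm]
    exact eq_neg_of_add_eq_zero_right h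
  rw [h1, inner_Cg, inv_inv, inner_neg_right, ← inner_conj_symm x, ← map_neg,
    ← inner_Ag, inner_conj_symm]
  exact congrArg _ (Cg_CgEquiv_symm g (Ag g x))

/-! ### Complexification and kernels -/

end Symplectic

section Kernel

variable {V : Type*} [NormedAddCommGroup V] [InnerProductSpace ℂ V]

/-- The complexification `V_ℂ = ℂ ⊗ V` of the real vector space underlying `V`. -/
abbrev Cplx (V : Type*) [NormedAddCommGroup V] [InnerProductSpace ℂ V] : Type _ := ℂ ⊗[ℝ] V

/-- The canonical conjugation of `V_ℂ`. -/
def cplxConj : Cplx V →ₗ⋆[ℂ] Cplx V where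
  toFun := TensorProduct.map Complex.conjAe.toLinearMap (LinearMap.id : V →ₗ[ℝ] V)
  map_add' := map_add _
  map_smul' r x := by
    induction x using TensorProduct.induction_on with
    | zero => simp
    | tmul z v => simp [TensorProduct.smul_tmul']
    | add x y hx hy => rw [smul_add, map_add, hx, hy, map_add, smul_add]

/-- The form `⟨x | y⟩ = Ω_ℂ(x̄, J_ℂ y)` on `V_ℂ`, antilinear in `x` and linear in `y`. -/
def cplxForm : Cplx V →ₗ⋆[ℂ] Cplx V →ₗ[ℂ] ℂ :=
  LinearMap.comp (((omega V).baseChange ℂ).compl₂ ((cplxJ V).baseChange ℂ)) cplxConj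

theorem cplxForm_tmul (a b : ℂ) (v w : V) :
    cplxForm (a ⊗ₜ[ℝ] v) (b ⊗ₜ[ℝ] w) = conj a * b * ((⟪v, w⟫_ℂ).re : ℂ) := by
  simp [cplxForm, cplxConj, cplxJ, omega]
  ring

/-- The isometry `V → V₊`, `v ↦ v₊ = (v - i J v) / √2`. -/
def plus : V →ₗ[ℂ] Cplx V :=
  toLin ((Real.sqrt 2)⁻¹ • (TensorProduct.mk ℝ ℂ V 1 - TensorProduct.mk ℝ ℂ V Complex.I ∘ₗ cplxJ V))
    fun v => by
      rw [LinearMap.smul_apply, LinearMap.smul_apply, smul_comm Complex.I]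
      congr 1
      simp [cplxJ, smul_smul, smul_sub, TensorProduct.smul_tmul', TensorProduct.tmul_neg,
        TensorProduct.neg_tmul]
      abel

/-- The antiisometry `V → V₋`, `v ↦ v₋ = (v + i J v) / √2`. -/
def minus : V →ₗ⋆[ℂ] Cplx V :=
  toAntilin
    ((Real.sqrt 2)⁻¹ • (TensorProduct.mk ℝ ℂ V 1 + TensorProduct.mk ℝ ℂ V Complex.I ∘ₗ cplxJ V))
    fun v => by
      rw [LinearMap.smul_apply, LinearMap.smul_apply, smul_comm Complex.I, ← smul_neg]
      congr 1
      simp [cplxJ, smul_smul, TensorProduct.smul_tmul', TensorProduct.tmul_neg,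
        TensorProduct.neg_tmul]

theorem plus_apply (v : V) : plus v =
    (Real.sqrt 2)⁻¹ • ((1 : ℂ) ⊗ₜ[ℝ] v - Complex.I ⊗ₜ[ℝ] (Complex.I • v)) := rfl

theorem minus_apply (v : V) : minus v =
    (Real.sqrt 2)⁻¹ • ((1 : ℂ) ⊗ₜ[ℝ] v + Complex.I ⊗ₜ[ℝ] (Complex.I • v)) := rfl

theorem cplxForm_tmul_plus (v w : V) :
    cplxForm ((1 : ℂ) ⊗ₜ[ℝ] w) (plus v) = ((Real.sqrt 2)⁻¹ : ℂ) * ⟪w, v⟫_ℂ := by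
  rw [plus_apply, ← algebraMap_smul ℂ, map_smul, map_sub, cplxForm_tmul, cplxForm_tmul]
  apply Complex.ext <;> simp

theorem cplxForm_tmul_minus (v w : V) :
    cplxForm ((1 : ℂ) ⊗ₜ[ℝ] w) (minus v) = ((Real.sqrt 2)⁻¹ : ℂ) * ⟪v, w⟫_ℂ := by
  rw [minus_apply, ← algebraMap_smul ℂ, map_smul, map_add, cplxForm_tmul, cplxForm_tmul,
    ← inner_conj_symm v w]
  apply Complex.ext <;> simp [-inner_conj_symm]

/-- The real-linear map underlying an antilinear map. -/
def antiReal (p : V →ₗ⋆[ℂ] Cplx V) : V →ₗ[ℝ] Cplx V where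
  toFun := p
  map_add' := map_add p
  map_smul' r v := by
    rw [← Complex.coe_smul, map_smulₛₗ, Complex.conj_ofReal, RingHom.id_apply]
    exact algebraMap_smul ℂ r (p v)

/-- The antilinear map `V_ℂ → V_ℂ` that is given on `V₊` by `v₊ ↦ p v` and on `V₋` by
`v₋ ↦ q v`. -/
def fromParts (p : V →ₗ⋆[ℂ] Cplx V) (q : V →ₗ[ℂ] Cplx V) : Cplx V →ₗ⋆[ℂ] Cplx V :=
  (LinearMap.liftBaseChange ℂ
    ((Real.sqrt 2)⁻¹ • (antiReal p + q.restrictScalars ℝ))).comp cplxConj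

theorem fromParts_tmul (p : V →ₗ⋆[ℂ] Cplx V) (q : V →ₗ[ℂ] Cplx V) (a : ℂ) (v : V) :
    fromParts p q (a ⊗ₜ[ℝ] v) = conj a • (Real.sqrt 2)⁻¹ • (p v + q v) := by
  simp [fromParts, cplxConj, antiReal]

theorem sqrt_two_smul_aux {E : Type*} [AddCommGroup E] [Module ℝ E] (x : E) :
    (Real.sqrt 2)⁻¹ • (Real.sqrt 2)⁻¹ • (x + x) = x := by
  rw [← two_smul ℝ, smul_smul, smul_smul, ← mul_inv, Real.mul_self_sqrt zero_le_two]
  simp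

theorem fromParts_plus (p : V →ₗ⋆[ℂ] Cplx V) (q : V →ₗ[ℂ] Cplx V) (v : V) :
    fromParts p q (plus v) = p v := by
  rw [plus_apply, ← algebraMap_smul ℂ, map_smulₛₗ, map_sub, fromParts_tmul, fromParts_tmul,
    Complex.coe_algebraMap, Complex.conj_ofReal, ← Complex.coe_algebraMap, algebraMap_smul,
    smul_comm (conj (1 : ℂ)), smul_comm (conj Complex.I), ← smul_sub]
  conv_rhs => rw [← sqrt_two_smul_aux (p v)]
  congr 2
  simp [smul_smul]

theorem fromParts_minus (p : V →ₗ⋆[ℂ] Cplx V) (q : V →ₗ[ℂ] Cplx V) (v : V) :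
    fromParts p q (minus v) = q v := by
  rw [minus_apply, ← algebraMap_smul ℂ, map_smulₛₗ, map_add, fromParts_tmul, fromParts_tmul,
    Complex.coe_algebraMap, Complex.conj_ofReal, ← Complex.coe_algebraMap, algebraMap_smul,
    smul_comm (conj (1 : ℂ)), smul_comm (conj Complex.I), ← smul_add]
  conv_rhs => rw [← sqrt_two_smul_aux (q v)]
  congr 2
  simp [smul_smul]
  abel

section Conj

/-- A complex algebra `A` with scalars acting through complex conjugation. -/
def ConjAlg (A : Type*) : Type _ := A

instance {A : Type*} [CommRing A] : CommRing (ConjAlg A) := inferInstanceAs (CommRing A)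

instance {A : Type*} [CommRing A] [Algebra ℂ A] : Algebra ℂ (ConjAlg A) :=
  RingHom.toAlgebra ((algebraMap ℂ A).comp (starRingEnd ℂ))

/-- Auxiliary homomorphism for `antiLift`. -/
def antiLiftAux {A : Type*} [CommRing A] [Algebra ℂ A] (f : V →ₗ⋆[ℂ] A) :
    SymAlgC V →ₐ[ℂ] ConjAlg A :=
  SymmetricAlgebra.lift
    { toFun := fun v => (f v : A)
      map_add' := fun v w => map_add f v w
      map_smul' := fun r v => (map_smulₛₗ f r v).trans (Algebra.smul_def (A := A) _ _) }

/-- The antilinear multiplicative extension to `SV` of an antilinear map from `V` to a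
commutative algebra. -/
def antiLift {A : Type*} [CommRing A] [Algebra ℂ A] (f : V →ₗ⋆[ℂ] A) : SymAlgC V →ₗ⋆[ℂ] A where
  toFun θ := (antiLiftAux f θ : A)
  map_add' θ η := map_add (antiLiftAux f) θ η
  map_smul' r θ := (map_smul (antiLiftAux f) r θ).trans (Algebra.smul_def (A := A) _ _).symm

theorem antiLift_gen {A : Type*} [CommRing A] [Algebra ℂ A] (f : V →ₗ⋆[ℂ] A) (v : V) :
    antiLift f (gen v) = f v :=
  SymmetricAlgebra.lift_ι_apply (A := ConjAlg A) _ v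

theorem antiLift_one {A : Type*} [CommRing A] [Algebra ℂ A] (f : V →ₗ⋆[ℂ] A) :
    antiLift f 1 = 1 :=
  map_one (antiLiftAux f)

theorem antiLift_mul {A : Type*} [CommRing A] [Algebra ℂ A] (f : V →ₗ⋆[ℂ] A) (θ η : SymAlgC V) :
    antiLift f (θ * η) = antiLift f θ * antiLift f η :=
  map_mul (antiLiftAux f) θ η

end Conj

/-- The algebra homomorphism `SV → SV_ℂ`, `φ ↦ φ₊`, extending `v ↦ v₊`. -/
def symPlus : SymAlgC V →ₐ[ℂ] SymAlgC (Cplx V) :=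
  SymmetricAlgebra.lift (SymmetricAlgebra.ι ℂ (Cplx V) ∘ₗ plus)

/-- The antilinear algebra homomorphism `SV → SV_ℂ`, `φ ↦ φ₋`, extending `v ↦ v₋`. -/
def symMinus : SymAlgC V →ₗ⋆[ℂ] SymAlgC (Cplx V) :=
  antiLift ((SymmetricAlgebra.ι ℂ (Cplx V)).comp minus)

/-- The linear map `U : SV → SV'` with kernel `u ∈ SV_ℂ'`: `[U φ](ψ) = u(ψ₊ φ₋)`. -/
def ofKernel (u : AntiDual (Cplx V)) : SymAlgC V →ₗ[ℂ] AntiDual V :=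
  LinearMap.mk₂'ₛₗ (RingHom.id ℂ) (starRingEnd ℂ) (fun φ ψ => u (symPlus ψ * symMinus φ))
    (by intros; simp [mul_add]) (by intros; simp)
    (by intros; simp [add_mul]) (by intros; simp)

end Kernel

/-! ### Metaplectic operators -/

section Metaplectic

variable {V : Type*} [NormedAddCommGroup V] [InnerProductSpace ℂ V]

/-- A weak metaplectic operator for `g`: a nonzero linear map `U : SV → SV'` with
`U π(v) = π(g v) U` for all `v`. -/
def IsWeakMetaplectic (g : SpGroup V) (U : SymAlgC V →ₗ[ℂ] AntiDual V) : Prop :=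
  U ≠ 0 ∧ ∀ (v : V) (φ : SymAlgC V), U (field v φ) = dualField ((g : V ≃ₗ[ℝ] V) v) (U φ)

/-- `T` is unitary on Fock space and its restriction to `SV` is a weak metaplectic operator
for `g`. -/
def IsUnitaryMetaplectic (g : SpGroup V) (T : Fock V →L[ℂ] Fock V) : Prop :=
  T ∈ unitary (Fock V →L[ℂ] Fock V) ∧
    IsWeakMetaplectic g (fockToDual ∘ₗ T.toLinearMap ∘ₗ toFock.toLinearMap)

/-- `T` is unitary on Fock space and `T π(v) T⁻¹ = π(g v)` for all `v`, as an equality of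
selfadjoint operators in Fock space with their natural domains. -/
def IsUnitaryImplementer (g : SpGroup V) (T : Fock V →L[ℂ] Fock V) : Prop :=
  T ∈ unitary (Fock V →L[ℂ] Fock V) ∧
    ∀ (v : V) (Φ Ψ : Fock V), IsFieldValue v Φ Ψ ↔ IsFieldValue ((g : V ≃ₗ[ℝ] V) v) (T Φ) (T Ψ)

/-- Hilbert-Schmidt antilinear operators. -/
def IsHilbertSchmidt (Z : V →ₗ⋆[ℂ] V) : Prop :=
  Continuous Z ∧ ∃ (s : Set V) (b : HilbertBasis s ℂ V), Summable fun i => ‖Z (b i)‖ ^ 2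

/-- The Fredholm determinant of an operator `T` differing from the identity by a trace-class
operator: the product of the eigenvalues of `T`, counted with algebraic multiplicity.
(Eigenvalues other than `1` have finite multiplicity; the eigenvalue `1` contributes `1`.) -/
def fredholmDet (T : Module.End ℂ V) : ℂ :=
  ∏' ν : ℂ, ν ^ Module.finrank ℂ (T.maxGenEigenspace ν)

variable [CompleteSpace V]

/-- The antilinear map `Z : V_ℂ → V_ℂ` with `Z(v₊) = (C_g⁻¹ v)₋ + (Z_{g⁻¹} v)₊` and
`Z(v₋) = (C_{g⁻¹}⁻¹ v)₊ + (Z_g v)₋`. -/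
def kernelMap (g : SpGroup V) : Cplx V →ₗ⋆[ℂ] Cplx V :=
  fromParts (minus.comp (CgEquiv g).symm.toLinearMap + plus.comp (Zg g⁻¹))
    (plus.comp (CgEquiv g⁻¹).symm.toLinearMap + minus.comp (Zg g))

/-- The map `V_ℂ → V_ℂ'` corresponding to `kernelMap g`, that is `(x, y) ↦ ⟨y | Z x⟩`. -/
def kernelForm (g : SpGroup V) : Cplx V →ₗ⋆[ℂ] Cplx V →ₗ⋆[ℂ] ℂ :=
  cplxForm.flip.comp (kernelMap g)

theorem kernelForm_symm (g : SpGroup V) : IsSymmForm (kernelForm g) := by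
  intro x y
  induction x using TensorProduct.induction_on with
  | zero => simp
  | add x x' h h' => simp [h, h']
  | tmul a v =>
    induction y using TensorProduct.induction_on with
    | zero => simp
    | add x x' h h' => simp [h, h']
    | tmul b w =>
      have key : ∀ v w : V, kernelForm g ((1 : ℂ) ⊗ₜ[ℝ] v) ((1 : ℂ) ⊗ₜ[ℝ] w) =
          ((Real.sqrt 2)⁻¹ : ℂ) * (((Real.sqrt 2)⁻¹ : ℂ) *
            (⟪(CgEquiv g).symm v, w⟫_ℂ + ⟪w, Zg g⁻¹ v⟫_ℂ + ⟪w, (CgEquiv g⁻¹).symm v⟫_ℂ +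
              ⟪Zg g v, w⟫_ℂ)) := by
        intro v w
        change cplxForm ((1 : ℂ) ⊗ₜ[ℝ] w) (kernelMap g ((1 : ℂ) ⊗ₜ[ℝ] v)) = _
        rw [kernelMap, fromParts_tmul, map_one, one_smul, ← algebraMap_smul ℂ, map_smul]
        simp only [LinearMap.add_apply, LinearMap.comp_apply, map_add, cplxForm_tmul_plus,
          cplxForm_tmul_minus, LinearEquiv.coe_coe]
        simp
        ring
      have h1 : ∀ (c : ℂ) (u : V), c ⊗ₜ[ℝ] u = c • ((1 : ℂ) ⊗ₜ[ℝ] u) := by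
        intro c u; simp [TensorProduct.smul_tmul']
      rw [h1 a, h1 b]
      simp only [map_smulₛₗ, LinearMap.smul_apply, key, smul_eq_mul]
      have e1 := inner_CgEquiv_symm g v w
      have e2 := inner_CgEquiv_symm g w v
      have e3 := inner_Zg g⁻¹ v w
      have e4 : ⟪Zg g v, w⟫_ℂ = ⟪Zg g w, v⟫_ℂ := by
        rw [← inner_conj_symm, inner_Zg, inner_conj_symm]
      rw [e1, e2, e3, e4]
      ring

/-- The weak metaplectic operator `U_g : SV → SV'` with Gaussian kernel `u_g = e^Z`. -/
def weakOp (g : SpGroup V) : SymAlgC V →ₗ[ℂ] AntiDual V :=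
  ofKernel (gaussian (kernelForm g) (kernelForm_symm g))

end Metaplectic

end BosonicFock

end

/-!
Up to a factor, `e^Z` is the only antilinear functional solving the Gaussian differential equation
`Φ (v θ) = Φ (a (Z v) θ)`. If `T` is a unitary metaplectic operator for `g`, then `T 1` is a Fock
vector solving this equation for `Z = Z_{g⁻¹}`; pairing it with `∑ e_i (Z e_i)` bounds
`∑ ‖Z e_i‖²`, and the same argument for `T⁻¹` gives `Z_g`.

Conversely, a Hilbert-Schmidt `Z_g` is symmetric and antilinear, so it has a Takagi diagonalisation
`Z_g e_i = λ_i e_i` with `0 ≤ λ_i < 1`. In the monomials in the `e_i` its Gaussian factors into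
one-dimensional ones, whence it is a Fock vector of squared norm
`∏ (1 - λ_i ^ 2) ^ (-1/2) = Det (1 - Z_g ^ 2) ^ (-1/2)`. As `t ^ 2 * λ_i < 1` still holds for
some `t > 1`, the Gaussian decays geometrically in the degree; creators and annihilators preserve
such decay, so every `U_g φ` is a Fock vector. Finally the intertwining relation determines the
inner products `⟪U_g φ, U_g ψ⟫` up to the scalar `‖U_g 1‖²`: here one needs that `π(v)` is symmetric
on its natural domain, which is proved by cutting off at high degree.
-/

noncomputable section

namespace BosonicFock

/-! ### The algebra of antilinear functionals and Gaussians -/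

section Algebraic

variable {W : Type*} [AddCommGroup W] [Module ℂ W]

theorem antiShift_apply (a θ : SymAlgC W) (Φ : AntiDual W) : antiShift a Φ θ = Φ (a * θ) := rfl

theorem antiShift_add (a : SymAlgC W) (Φ Ψ : AntiDual W) :
    antiShift a (Φ + Ψ) = antiShift a Φ + antiShift a Ψ := rfl

theorem antiShift_smul (a : SymAlgC W) (r : ℂ) (Φ : AntiDual W) :
    antiShift a (r • Φ) = r • antiShift a Φ := rfl

theorem antiShift_gen_vac (w : W) : antiShift (gen w) (vac : AntiDual W) = 0 := by
  ext θ
  simp [antiShift, vac, SymmetricAlgebra.algebraMapInv_ι]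

theorem antiMul_gen_mul (w : W) (Φ Ψ : AntiDual W) (θ : SymAlgC W) :
    antiMul Φ Ψ (gen w * θ) =
      antiMul (antiShift (gen w) Φ) Ψ θ + antiMul Φ (antiShift (gen w) Ψ) θ :=
  LinearMap.congr_fun (antiShift_antiMul w Φ Ψ) θ

theorem antiMul_add_left (Φ Φ' Ψ : AntiDual W) :
    antiMul (Φ + Φ') Ψ = antiMul Φ Ψ + antiMul Φ' Ψ := by
  ext θ
  induction θ using sym_induction generalizing Φ Φ' Ψ with
  | one => simp only [antiMul_one, LinearMap.add_apply, add_mul]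
  | gen_mul w θ ih =>
    simp only [antiMul_gen_mul, antiShift_add, LinearMap.add_apply, ih]
    ring
  | add θ η hθ hη => rw [map_add, hθ, hη, map_add]
  | smul r θ hθ => rw [map_smulₛₗ, hθ, map_smulₛₗ]

theorem antiMul_smul_left (r : ℂ) (Φ Ψ : AntiDual W) :
    antiMul (r • Φ) Ψ = r • antiMul Φ Ψ := by
  ext θ
  induction θ using sym_induction generalizing Φ Ψ with
  | one => simp only [antiMul_one, LinearMap.smul_apply, smul_eq_mul, mul_assoc]
  | gen_mul w θ ih =>
    simp only [antiMul_gen_mul, antiShift_smul, LinearMap.smul_apply, ih, smul_add]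
  | add θ η hθ hη => rw [map_add, hθ, hη, map_add]
  | smul s θ hθ => rw [map_smulₛₗ, hθ, map_smulₛₗ]

theorem antiMul_comm (Φ Ψ : AntiDual W) : antiMul Φ Ψ = antiMul Ψ Φ := by
  ext θ
  induction θ using sym_induction generalizing Φ Ψ with
  | one => rw [antiMul_one, antiMul_one, mul_comm]
  | gen_mul w θ ih => rw [antiMul_gen_mul, antiMul_gen_mul, ih, ih Φ, add_comm]
  | add θ η hθ hη => rw [map_add, hθ, hη, map_add]
  | smul r θ hθ => rw [map_smulₛₗ, hθ, map_smulₛₗ]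

theorem antiMul_add_right (Φ Ψ Ψ' : AntiDual W) :
    antiMul Φ (Ψ + Ψ') = antiMul Φ Ψ + antiMul Φ Ψ' := by
  simp only [antiMul_comm Φ, antiMul_add_left]

theorem antiMul_smul_right (r : ℂ) (Φ Ψ : AntiDual W) :
    antiMul Φ (r • Ψ) = r • antiMul Φ Ψ := by
  simp only [antiMul_comm Φ, antiMul_smul_left]

theorem antiMul_zero_left (Ψ : AntiDual W) : antiMul 0 Ψ = 0 := by
  simpa using antiMul_smul_left 0 0 Ψ

theorem antiMul_assoc (Φ Ψ Ξ : AntiDual W) :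
    antiMul (antiMul Φ Ψ) Ξ = antiMul Φ (antiMul Ψ Ξ) := by
  ext θ
  induction θ using sym_induction generalizing Φ Ψ Ξ with
  | one => simp only [antiMul_one, mul_assoc]
  | gen_mul w θ ih =>
    simp only [antiMul_gen_mul, antiShift_antiMul, antiMul_add_left, antiMul_add_right,
      LinearMap.add_apply, ih, add_assoc]
  | add θ η hθ hη => rw [map_add, hθ, hη, map_add]
  | smul r θ hθ => rw [map_smulₛₗ, hθ, map_smulₛₗ]

theorem vac_antiMul (Ψ : AntiDual W) : antiMul vac Ψ = Ψ := by
  ext θ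
  induction θ using sym_induction generalizing Ψ with
  | one => simp [antiMul_one, vac]
  | gen_mul w θ ih =>
    rw [antiMul_gen_mul, antiShift_gen_vac, antiMul_zero_left, ih, LinearMap.zero_apply, zero_add,
      antiShift_apply]
  | add θ η hθ hη => rw [map_add, hθ, hη, map_add]
  | smul r θ hθ => rw [map_smulₛₗ, hθ, map_smulₛₗ]

theorem antiShift_antiPow_succ (w : W) (Φ : AntiDual W) (n : ℕ) :
    antiShift (gen w) (antiPow Φ (n + 1)) =
      (n + 1 : ℂ) • antiMul (antiShift (gen w) Φ) (antiPow Φ n) := by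
  induction n with
  | zero =>
    change antiShift (gen w) (antiMul Φ vac) = _
    rw [antiShift_antiMul, antiShift_gen_vac, antiMul_comm Φ 0, antiMul_zero_left, antiPow]
    simp
  | succ n ih =>
    rw [antiPow, antiShift_antiMul, ih, antiMul_smul_right, ← antiMul_assoc,
      antiMul_comm Φ (antiShift _ Φ), antiMul_assoc, ← antiPow]
    push_cast
    module

theorem contract_one (f : W →ₗ[ℂ] ℂ) : contract f 1 = 0 := Derivation.map_one_eq_zero _

theorem contract_gen_mul (f : W →ₗ[ℂ] ℂ) (w : W) (θ : SymAlgC W) :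
    contract f (gen w * θ) = f w • θ + gen w * contract f θ := by
  rw [Derivation.leibniz, contract_gen, smul_eq_mul, smul_eq_mul, Algebra.smul_def]
  ring

theorem antiShift_antiShift_quadratic (Z : W →ₗ⋆[ℂ] W →ₗ⋆[ℂ] ℂ) (hZ : IsSymmForm Z) (x y : W) :
    antiShift (gen y) (antiShift (gen x) (quadratic Z hZ)) = Z x y • vac := by
  ext θ
  induction θ using sym_induction with
  | one => simp [antiShift, quadratic_gen_mul_gen, vac]
  | gen_mul w θ _ =>
    rw [LinearMap.smul_apply, ← antiShift_apply (gen w) θ vac, antiShift_gen_vac, antiShift_apply,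
      antiShift_apply, quadratic_of_three, LinearMap.zero_apply, smul_zero]
  | add θ η hθ hη => rw [map_add, hθ, hη, map_add]
  | smul r θ hθ => rw [map_smulₛₗ, hθ, map_smulₛₗ]

theorem antiMul_antiShift_quadratic (Z : W →ₗ⋆[ℂ] W →ₗ⋆[ℂ] ℂ) (hZ : IsSymmForm Z) (x : W)
    (Ψ : AntiDual W) (θ : SymAlgC W) :
    antiMul (antiShift (gen x) (quadratic Z hZ)) Ψ θ = Ψ (contract (conjForm Z x) θ) := by
  induction θ using sym_induction generalizing Ψ with
  | one => simp [antiMul_one, antiShift, quadratic_gen]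
  | gen_mul w θ ih =>
    rw [antiMul_gen_mul, antiShift_antiShift_quadratic, antiMul_smul_left, vac_antiMul, ih,
      contract_gen_mul]
    simp [conjForm, antiShift]
  | add θ η hθ hη => simp only [map_add, hθ, hη]
  | smul r θ hθ => simp only [map_smulₛₗ, hθ, Derivation.map_smul]

/-- The differential equation `Φ(w ·) = Φ ∘ ∂_{f w}` of a Gaussian with covariance `f`, where
`∂_{f w}` is the derivation of the symmetric algebra extending the functional `f w`. -/
def IsGaussian (f : W → W →ₗ[ℂ] ℂ) (Φ : AntiDual W) : Prop :=
  ∀ w θ, Φ (gen w * θ) = Φ (contract (f w) θ)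

theorem gaussian_one (Z : W →ₗ⋆[ℂ] W →ₗ⋆[ℂ] ℂ) (hZ : IsSymmForm Z) : gaussian Z hZ 1 = 1 := by
  change ∑' n : ℕ, ((n.factorial : ℂ)⁻¹) * antiPow (quadratic Z hZ) n 1 = 1
  rw [tsum_eq_single 0]
  · simp [antiPow, vac]
  · rintro (_ | n) hn
    · exact absurd rfl hn
    · rw [antiPow, antiMul_one, quadratic_one, zero_mul, mul_zero]

theorem isGaussian_gaussian (Z : W →ₗ⋆[ℂ] W →ₗ⋆[ℂ] ℂ) (hZ : IsSymmForm Z) :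
    IsGaussian (conjForm Z) (gaussian Z hZ) := fun x θ => by
  change ∑' n : ℕ, ((n.factorial : ℂ)⁻¹) * antiPow (quadratic Z hZ) n (gen x * θ) =
    ∑' n : ℕ, ((n.factorial : ℂ)⁻¹) * antiPow (quadratic Z hZ) n (contract (conjForm Z x) θ)
  have constant_term : antiPow (quadratic Z hZ) 0 (gen x * θ) = 0 :=
    LinearMap.congr_fun (antiShift_gen_vac x) θ
  rw [(summable_antiPow (lowVanish_quadratic Z hZ) _).tsum_eq_zero_add, constant_term, mul_zero,
    zero_add]
  refine tsum_congr fun n => ?_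
  rw [← antiShift_apply, antiShift_antiPow_succ, LinearMap.smul_apply, antiMul_antiShift_quadratic,
    Nat.factorial_succ]
  have : (n + 1 : ℂ) ≠ 0 := n.cast_add_one_ne_zero
  push_cast
  rw [smul_eq_mul, mul_inv]
  field_simp

theorem LowVanish.comp_contract {k : ℕ} {Φ : AntiDual W} (hΦ : LowVanish k Φ) (f : W →ₗ[ℂ] ℂ) :
    LowVanish k (Φ.comp (contract f : SymAlgC W →ₗ[ℂ] SymAlgC W)) := by
  induction k generalizing Φ with
  | zero => trivial
  | succ k ih =>
    refine ⟨by simp, fun w => ?_⟩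
    have leibniz : antiShift (gen w) (Φ.comp (contract f : SymAlgC W →ₗ[ℂ] SymAlgC W)) =
        conj (f w) • Φ + (antiShift (gen w) Φ).comp (contract f : SymAlgC W →ₗ[ℂ] SymAlgC W) := by
      ext θ
      simp [antiShift, -Derivation.leibniz, contract_gen_mul]
    rw [leibniz]
    exact (hΦ.mono.smul _).add (ih (hΦ.2 w))

namespace IsGaussian

variable {f : W → W →ₗ[ℂ] ℂ} {Φ Ψ : AntiDual W}

theorem lowVanish (hΦ : IsGaussian f Φ) (hΦ_one : Φ 1 = 0) (k : ℕ) : LowVanish k Φ := by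
  induction k with
  | zero => trivial
  | succ k ih =>
    refine ⟨hΦ_one, fun w => ?_⟩
    rw [show antiShift (gen w) Φ = Φ.comp (contract (f w) : SymAlgC W →ₗ[ℂ] SymAlgC W) from
      LinearMap.ext (hΦ w)]
    exact ih.comp_contract _

theorem eq_zero (hΦ : IsGaussian f Φ) (hΦ_one : Φ 1 = 0) : Φ = 0 := by
  ext θ
  obtain ⟨k, hk⟩ := exists_lowVanish_apply θ
  exact hk Φ (hΦ.lowVanish hΦ_one k)

theorem ext (hΦ : IsGaussian f Φ) (hΨ : IsGaussian f Ψ) (h : Φ 1 = Ψ 1) : Φ = Ψ :=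
  sub_eq_zero.1 <| eq_zero (f := f)
    (fun w θ => by rw [LinearMap.sub_apply, hΦ w θ, hΨ w θ, LinearMap.sub_apply])
    (sub_eq_zero.2 h)

end IsGaussian

end Algebraic

/-! ### Commutation relations of the kernel operator -/

section Kernel

variable {V : Type*} [NormedAddCommGroup V] [InnerProductSpace ℂ V]

theorem sqrt_two_inv_mul_self : ((Real.sqrt 2 : ℂ)⁻¹) * (Real.sqrt 2 : ℂ)⁻¹ = 2⁻¹ := by
  rw [← mul_inv, ← Complex.ofReal_mul, Real.mul_self_sqrt zero_le_two, Complex.ofReal_ofNat]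

theorem cplxForm_plus_left (w : V) (x : Cplx V) :
    cplxForm (plus w) x = ((Real.sqrt 2 : ℂ)⁻¹) * (cplxForm ((1 : ℂ) ⊗ₜ[ℝ] w) x +
      Complex.I * cplxForm ((1 : ℂ) ⊗ₜ[ℝ] (Complex.I • w)) x) := by
  have I_tmul : Complex.I ⊗ₜ[ℝ] (Complex.I • w) =
      Complex.I • ((1 : ℂ) ⊗ₜ[ℝ] (Complex.I • w)) := by simp [TensorProduct.smul_tmul']
  rw [plus_apply, ← algebraMap_smul ℂ, I_tmul, map_smulₛₗ, map_sub, map_smulₛₗ]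
  simp [mul_add]

theorem cplxForm_minus_left (w : V) (x : Cplx V) :
    cplxForm (minus w) x = ((Real.sqrt 2 : ℂ)⁻¹) * (cplxForm ((1 : ℂ) ⊗ₜ[ℝ] w) x -
      Complex.I * cplxForm ((1 : ℂ) ⊗ₜ[ℝ] (Complex.I • w)) x) := by
  have I_tmul : Complex.I ⊗ₜ[ℝ] (Complex.I • w) =
      Complex.I • ((1 : ℂ) ⊗ₜ[ℝ] (Complex.I • w)) := by simp [TensorProduct.smul_tmul']
  rw [minus_apply, ← algebraMap_smul ℂ, I_tmul, map_smulₛₗ, map_add, map_smulₛₗ]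
  simp [sub_eq_add_neg, mul_add]

theorem cplxForm_plus_plus (w v : V) : cplxForm (plus w) (plus v) = ⟪w, v⟫_ℂ := by
  rw [cplxForm_plus_left, cplxForm_tmul_plus, cplxForm_tmul_plus, inner_smul_left,
    Complex.conj_I]
  linear_combination (1 - Complex.I ^ 2) * ⟪w, v⟫_ℂ * sqrt_two_inv_mul_self
    - ⟪w, v⟫_ℂ / 2 * Complex.I_sq

theorem cplxForm_plus_minus (w v : V) : cplxForm (plus w) (minus v) = 0 := by
  rw [cplxForm_plus_left, cplxForm_tmul_minus, cplxForm_tmul_minus, inner_smul_right]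
  linear_combination (1 + Complex.I ^ 2) * ⟪v, w⟫_ℂ * sqrt_two_inv_mul_self
    + ⟪v, w⟫_ℂ / 2 * Complex.I_sq

theorem cplxForm_minus_plus (w v : V) : cplxForm (minus w) (plus v) = 0 := by
  rw [cplxForm_minus_left, cplxForm_tmul_plus, cplxForm_tmul_plus, inner_smul_left, Complex.conj_I]
  linear_combination (1 + Complex.I ^ 2) * ⟪w, v⟫_ℂ * sqrt_two_inv_mul_self
    + ⟪w, v⟫_ℂ / 2 * Complex.I_sq

theorem cplxForm_minus_minus (w v : V) : cplxForm (minus w) (minus v) = ⟪v, w⟫_ℂ := by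
  rw [cplxForm_minus_left, cplxForm_tmul_minus, cplxForm_tmul_minus, inner_smul_right]
  linear_combination (1 - Complex.I ^ 2) * ⟪v, w⟫_ℂ * sqrt_two_inv_mul_self
    - ⟪v, w⟫_ℂ / 2 * Complex.I_sq

theorem symPlus_gen_mul (v : V) (ψ : SymAlgC V) :
    symPlus (gen v * ψ) = gen (plus v) * symPlus ψ := by
  simp [symPlus]

theorem symMinus_gen_mul (v : V) (φ : SymAlgC V) :
    symMinus (gen v * φ) = gen (minus v) * symMinus φ := by
  rw [symMinus, antiLift_mul, antiLift_gen]
  rfl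

theorem symMinus_one : symMinus (1 : SymAlgC V) = 1 := antiLift_one _

theorem contract_symPlus {f : Cplx V →ₗ[ℂ] ℂ} {u : V} (hf : ∀ w, f (plus w) = ⟪u, w⟫_ℂ)
    (ψ : SymAlgC V) : contract f (symPlus ψ) = symPlus (annihilator u ψ) := by
  induction ψ using sym_induction with
  | one => rw [map_one, contract_one, annihilator_one, map_zero]
  | gen_mul w θ ih =>
    rw [symPlus_gen_mul, contract_gen_mul, annihilator_gen_mul, ih, map_add, map_smul,
      symPlus_gen_mul, hf]
  | add θ η hθ hη => simp only [map_add, hθ, hη]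
  | smul r θ hθ => simp only [map_smul, Derivation.map_smul, hθ]

theorem contract_symMinus {f : Cplx V →ₗ[ℂ] ℂ} {u : V} (hf : ∀ w, f (minus w) = ⟪w, u⟫_ℂ)
    (φ : SymAlgC V) : contract f (symMinus φ) = symMinus (annihilator u φ) := by
  induction φ using sym_induction with
  | one => rw [symMinus_one, contract_one, annihilator_one, map_zero]
  | gen_mul w θ ih =>
    rw [symMinus_gen_mul, contract_gen_mul, annihilator_gen_mul, ih, map_add, map_smulₛₗ,
      symMinus_gen_mul, hf, inner_conj_symm]
  | add θ η hθ hη => simp only [map_add, hθ, hη]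
  | smul r θ hθ => simp only [map_smulₛₗ, Derivation.map_smul, hθ, RingHom.id_apply]

theorem gen_add (v w : V) : (gen (v + w) : SymAlgC V) = gen v + gen w := map_add _ _ _

theorem annihilator_neg (v : V) : annihilator (-v) = -annihilator v := by
  ext θ
  simpa using LinearMap.congr_fun (annihilator_smul (-1) v) θ

end Kernel

section Symplectic

variable {V : Type*} [NormedAddCommGroup V] [InnerProductSpace ℂ V] [CompleteSpace V]

theorem CgEquiv_apply (g : SpGroup V) (v : V) : CgEquiv g v = Cg g v := rfl

theorem Cg_Zg (g : SpGroup V) (v : V) : Cg g (Zg g v) = Ag g v := Cg_CgEquiv_symm g (Ag g v)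

theorem Zg_inv_Cg (g : SpGroup V) (v : V) : Zg g⁻¹ (Cg g v) = -Ag g v := by
  apply (CgEquiv g⁻¹).injective
  rw [CgEquiv_apply, CgEquiv_apply, map_neg, Cg_Zg]
  exact eq_neg_of_add_eq_zero_right (Cg_Ag_inv g v).2

theorem CgEquiv_inv_symm_add_Ag_Zg (g : SpGroup V) (v : V) :
    (CgEquiv g⁻¹).symm v + Ag g (Zg g v) = Cg g v := by
  apply (CgEquiv g⁻¹).injective
  rw [CgEquiv_apply, CgEquiv_apply, map_add, Cg_CgEquiv_symm,
    eq_neg_of_add_eq_zero_left (Cg_Ag_inv g (Zg g v)).2, Cg_Zg,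
    eq_sub_of_add_eq (Cg_Ag_inv g v).1, sub_eq_add_neg]

theorem conjForm_kernelForm_plus_plus (g : SpGroup V) (v w : V) :
    conjForm (kernelForm g) (plus v) (plus w) = ⟪Zg g⁻¹ v, w⟫_ℂ := by
  change conj (cplxForm (plus w) (kernelMap g (plus v))) = _
  rw [kernelMap, fromParts_plus]
  simp [cplxForm_plus_plus, cplxForm_plus_minus]

theorem conjForm_kernelForm_plus_minus (g : SpGroup V) (v w : V) :
    conjForm (kernelForm g) (plus v) (minus w) = ⟪w, (CgEquiv g).symm v⟫_ℂ := by
  change conj (cplxForm (minus w) (kernelMap g (plus v))) = _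
  rw [kernelMap, fromParts_plus]
  simp [cplxForm_minus_plus, cplxForm_minus_minus]

theorem conjForm_kernelForm_minus_plus (g : SpGroup V) (v w : V) :
    conjForm (kernelForm g) (minus v) (plus w) = ⟪(CgEquiv g⁻¹).symm v, w⟫_ℂ := by
  change conj (cplxForm (plus w) (kernelMap g (minus v))) = _
  rw [kernelMap, fromParts_minus]
  simp [cplxForm_plus_plus, cplxForm_plus_minus]

theorem conjForm_kernelForm_minus_minus (g : SpGroup V) (v w : V) :
    conjForm (kernelForm g) (minus v) (minus w) = ⟪w, Zg g v⟫_ℂ := by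
  change conj (cplxForm (minus w) (kernelMap g (minus v))) = _
  rw [kernelMap, fromParts_minus]
  simp [cplxForm_minus_plus, cplxForm_minus_minus]

theorem weakOp_apply (g : SpGroup V) (φ ψ : SymAlgC V) : weakOp g φ ψ =
    gaussian (kernelForm g) (kernelForm_symm g) (symPlus ψ * symMinus φ) := rfl

theorem weakOp_one_one (g : SpGroup V) : weakOp g 1 1 = 1 := by
  rw [weakOp_apply, map_one, symMinus_one, one_mul, gaussian_one]

theorem weakOp_gen_mul (g : SpGroup V) (v : V) (φ ψ : SymAlgC V) :
    weakOp g (gen v * φ) ψ =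
      weakOp g φ (annihilator ((CgEquiv g⁻¹).symm v) ψ) + weakOp g (annihilator (Zg g v) φ) ψ := by
  rw [weakOp_apply, symMinus_gen_mul, mul_left_comm, isGaussian_gaussian, Derivation.leibniz,
    contract_symPlus (conjForm_kernelForm_minus_plus g v),
    contract_symMinus (conjForm_kernelForm_minus_minus g v), map_add, weakOp_apply, weakOp_apply,
    smul_eq_mul, smul_eq_mul, mul_comm (symMinus φ), add_comm]

theorem weakOp_apply_gen_mul (g : SpGroup V) (v : V) (φ ψ : SymAlgC V) :
    weakOp g φ (gen v * ψ) =
      weakOp g φ (annihilator (Zg g⁻¹ v) ψ) + weakOp g (annihilator ((CgEquiv g).symm v) φ) ψ := by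
  rw [weakOp_apply, symPlus_gen_mul, mul_assoc, isGaussian_gaussian, Derivation.leibniz,
    contract_symPlus (conjForm_kernelForm_plus_plus g v),
    contract_symMinus (conjForm_kernelForm_plus_minus g v), map_add, weakOp_apply, weakOp_apply,
    smul_eq_mul, smul_eq_mul, mul_comm (symMinus φ), add_comm]

theorem weakOp_annihilator (g : SpGroup V) (v : V) (φ ψ : SymAlgC V) :
    weakOp g (annihilator v φ) ψ =
      weakOp g φ (gen (Cg g v) * ψ) + weakOp g φ (annihilator (Ag g v) ψ) := by
  rw [weakOp_apply_gen_mul, Zg_inv_Cg, ← CgEquiv_apply, LinearEquiv.symm_apply_apply,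
    annihilator_neg, LinearMap.neg_apply, map_neg, neg_add_cancel_comm]

theorem weakOp_creator (g : SpGroup V) (v : V) (φ ψ : SymAlgC V) :
    weakOp g (gen v * φ) ψ =
      weakOp g φ (annihilator (Cg g v) ψ) + weakOp g φ (gen (Ag g v) * ψ) := by
  rw [weakOp_gen_mul, weakOp_annihilator, Cg_Zg, ← CgEquiv_inv_symm_add_Ag_Zg, annihilator_add,
    LinearMap.add_apply, map_add]
  ring

theorem weakOp_ne_zero (g : SpGroup V) : weakOp g ≠ 0 := fun h => by
  simpa [h] using weakOp_one_one g

theorem isWeakMetaplectic_weakOp (g : SpGroup V) : IsWeakMetaplectic g (weakOp g) := by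
  refine ⟨weakOp_ne_zero g, fun v φ => ?_⟩
  ext ψ
  change weakOp g (((Real.sqrt 2 : ℂ)⁻¹) • (gen v * φ + annihilator v φ)) ψ =
    weakOp g φ (((Real.sqrt 2 : ℂ)⁻¹) • (gen ((g : V ≃ₗ[ℝ] V) v) * ψ +
      annihilator ((g : V ≃ₗ[ℝ] V) v) ψ))
  rw [← Cg_add_Ag, annihilator_add, gen_add, map_smul, map_smulₛₗ, LinearMap.smul_apply, map_add,
    LinearMap.add_apply, weakOp_creator, weakOp_annihilator, add_mul, LinearMap.add_apply]
  simp only [map_add, map_inv₀, Complex.conj_ofReal, smul_eq_mul]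
  ring

end Symplectic

section Covariance

variable {V : Type*} [NormedAddCommGroup V] [InnerProductSpace ℂ V]

/-- `Φ` solves the Gaussian differential equation whose covariance is given by a map `Z` of `V`:
the functional attached to `v` is `⟪Z v, ·⟫`. -/
def IsGaussianWith (Z : V → V) (Φ : AntiDual V) : Prop :=
  IsGaussian (fun v => (innerSL ℂ (Z v)).toLinearMap) Φ

theorem isGaussianWith_iff {Z : V → V} {Φ : AntiDual V} :
    IsGaussianWith Z Φ ↔ ∀ v θ, Φ (gen v * θ) = Φ (annihilator (Z v) θ) := Iff.rfl

variable [CompleteSpace V]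

theorem isGaussianWith_weakOp_one (g : SpGroup V) : IsGaussianWith (Zg g⁻¹) (weakOp g 1) :=
  isGaussianWith_iff.2 fun v ψ => by
    rw [weakOp_apply_gen_mul, annihilator_one, map_zero, LinearMap.zero_apply, add_zero]

theorem conj_weakOp_inv_one (g : SpGroup V) (ψ : SymAlgC V) :
    conj (weakOp g⁻¹ ψ 1) = weakOp g 1 ψ := by
  let Ψ : AntiDual V :=
    { toFun := fun ψ => conj (weakOp g⁻¹ ψ 1)
      map_add' := fun ψ ψ' => by simp
      map_smul' := fun r ψ => by simp }
  have isGaussianWith_Ψ : IsGaussianWith (Zg g⁻¹) Ψ := isGaussianWith_iff.2 fun v ψ => by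
    change conj (weakOp g⁻¹ (gen v * ψ) 1) = conj (weakOp g⁻¹ (annihilator (Zg g⁻¹ v) ψ) 1)
    rw [weakOp_gen_mul, annihilator_one, map_zero, zero_add]
  have Ψ_one : Ψ 1 = weakOp g 1 1 := by
    change conj (weakOp g⁻¹ 1 1) = _
    rw [weakOp_one_one, weakOp_one_one, map_one]
  exact LinearMap.congr_fun (isGaussianWith_Ψ.ext (isGaussianWith_weakOp_one g) Ψ_one) ψ

theorem weakOp_inv_apply_gen_mul (g : SpGroup V) (v : V) (φ ψ : SymAlgC V) :
    weakOp g⁻¹ ψ (gen v * φ) =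
      weakOp g⁻¹ (annihilator (Cg g v) ψ) φ + weakOp g⁻¹ (gen (Ag g v) * ψ) φ := by
  obtain ⟨hC, hA⟩ := Cg_Ag_inv g v
  have hA_neg : annihilator (Ag g⁻¹ (Cg g v)) = -annihilator (Cg g⁻¹ (Ag g v)) := by
    rw [eq_neg_of_add_eq_zero_right hA, annihilator_neg]
  rw [weakOp_annihilator, weakOp_creator, hA_neg, LinearMap.neg_apply, map_neg]
  conv_lhs => rw [← hC, gen_add, add_mul, map_add]
  ring

theorem conj_weakOp_inv (g : SpGroup V) (φ ψ : SymAlgC V) :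
    conj (weakOp g⁻¹ ψ φ) = weakOp g φ ψ := by
  induction φ using sym_induction generalizing ψ with
  | one => exact conj_weakOp_inv_one g ψ
  | gen_mul v φ ih => rw [weakOp_creator, ← ih, ← ih, ← map_add, weakOp_inv_apply_gen_mul]
  | add θ η hθ hη => rw [map_add, map_add, map_add, LinearMap.add_apply, hθ, hη]
  | smul r θ hθ => simp [← hθ]

end Covariance

/-! ### The grading and number estimates -/

section SymmetricProjection

variable {𝕜 E : Type*} [RCLike 𝕜] [NormedAddCommGroup E] [InnerProductSpace 𝕜 E]
  {p : E →ₗ[𝕜] E}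

theorem inner_symmetricProjection_self (hp : p.IsSymmetricProjection) (x : E) :
    ⟪x, p x⟫_𝕜 = ((‖p x‖ ^ 2 : ℝ) : 𝕜) := by
  have idem : p (p x) = p x := LinearMap.congr_fun hp.isIdempotentElem x
  rw [← idem, ← hp.isSymmetric, idem, inner_self_eq_norm_sq_to_K, RCLike.ofReal_pow]

theorem norm_symmetricProjection_le (hp : p.IsSymmetricProjection) (x : E) : ‖p x‖ ≤ ‖x‖ := by
  have cauchy_schwarz := norm_inner_le_norm (𝕜 := 𝕜) x (p x)
  rw [inner_symmetricProjection_self hp, RCLike.norm_ofReal, abs_of_nonneg (sq_nonneg _), sq]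
    at cauchy_schwarz
  rcases (norm_nonneg (p x)).eq_or_lt with h | h
  · exact h ▸ norm_nonneg x
  · exact le_of_mul_le_mul_right cauchy_schwarz h

end SymmetricProjection

section Degree

variable {V : Type*} [NormedAddCommGroup V] [InnerProductSpace ℂ V]

/-- The algebra homomorphism `SV → SV[X]` that multiplies the part of degree `n` by `Xⁿ`: it
encodes the grading of `SV`. -/
def degHom : SymAlgC V →ₐ[ℂ] Polynomial (SymAlgC V) :=
  SymmetricAlgebra.lift
    (((Polynomial.monomial 1 : SymAlgC V →ₗ[SymAlgC V] _).restrictScalars ℂ) ∘ₗ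
      SymmetricAlgebra.ι ℂ V)

/-- The projection of `SV` onto its homogeneous summand of degree `n`. -/
def degPart (n : ℕ) : SymAlgC V →ₗ[ℂ] SymAlgC V :=
  ((Polynomial.lcoeff (SymAlgC V) n).restrictScalars ℂ) ∘ₗ degHom.toLinearMap

theorem degPart_apply (n : ℕ) (θ : SymAlgC V) : degPart n θ = (degHom θ).coeff n := rfl

theorem degHom_gen (v : V) : degHom (gen v) = Polynomial.C (gen v) * Polynomial.X := by
  simp [degHom, Polynomial.C_mul_X_eq_monomial]

theorem degPart_one (n : ℕ) : degPart n (1 : SymAlgC V) = if n = 0 then 1 else 0 := by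
  rw [degPart_apply, map_one, Polynomial.coeff_one]

theorem degPart_zero_gen_mul (v : V) (θ : SymAlgC V) : degPart 0 (gen v * θ) = 0 := by
  rw [degPart_apply, map_mul, degHom_gen, mul_assoc, Polynomial.coeff_C_mul,
    Polynomial.coeff_X_mul_zero, mul_zero]

theorem degPart_succ_gen_mul (n : ℕ) (v : V) (θ : SymAlgC V) :
    degPart (n + 1) (gen v * θ) = gen v * degPart n θ := by
  rw [degPart_apply, map_mul, degHom_gen, mul_assoc, Polynomial.coeff_C_mul,
    Polynomial.coeff_X_mul, degPart_apply]

theorem annihilator_degPart_zero (v : V) (θ : SymAlgC V) : annihilator v (degPart 0 θ) = 0 := by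
  induction θ using sym_induction with
  | one => rw [degPart_one, if_pos rfl, annihilator_one]
  | gen_mul w θ _ => rw [degPart_zero_gen_mul, map_zero]
  | add θ η hθ hη => rw [map_add, map_add, hθ, hη, add_zero]
  | smul r θ hθ => rw [map_smul, map_smul, hθ, smul_zero]

theorem annihilator_degPart_succ (n : ℕ) (v : V) (θ : SymAlgC V) :
    annihilator v (degPart (n + 1) θ) = degPart n (annihilator v θ) := by
  induction θ using sym_induction generalizing n with
  | one => rw [degPart_one, if_neg n.succ_ne_zero, annihilator_one, map_zero, map_zero]
  | gen_mul w θ ih =>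
    rw [degPart_succ_gen_mul, annihilator_gen_mul, annihilator_gen_mul, map_add, map_smul]
    cases n with
    | zero => rw [annihilator_degPart_zero, degPart_zero_gen_mul, mul_zero]
    | succ n => rw [ih n, degPart_succ_gen_mul]
  | add θ η hθ hη => simp only [map_add, hθ, hη]
  | smul r θ hθ => simp only [map_smul, hθ]

theorem degPart_degPart (m n : ℕ) (θ : SymAlgC V) :
    degPart m (degPart n θ) = if m = n then degPart n θ else 0 := by
  induction θ using sym_induction generalizing m n with
  | one =>
    rcases eq_or_ne n 0 with rfl | hn
    · simp only [degPart_one, if_true]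
    · simp only [degPart_one, hn, if_false, map_zero, ite_self]
  | gen_mul w θ ih =>
    rcases m with _ | m <;> rcases n with _ | n <;>
      simp [degPart_zero_gen_mul, degPart_succ_gen_mul, ih]
  | add θ η hθ hη => simp only [map_add, hθ, hη, ite_add_ite, add_zero]
  | smul r θ hθ => simp only [map_smul, hθ, smul_ite, smul_zero]

theorem exists_sum_degPart (θ : SymAlgC V) :
    ∃ N, ∀ M, N ≤ M → ∑ n ∈ Finset.range M, degPart n θ = θ := by
  induction θ using sym_induction with
  | one =>
    refine ⟨1, fun M hM => ?_⟩
    rw [Finset.sum_eq_single 0 (fun n _ hn => by rw [degPart_one, if_neg hn])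
      (fun h => absurd (Finset.mem_range.2 hM) h), degPart_one, if_pos rfl]
  | gen_mul w θ ih =>
    obtain ⟨N, hN⟩ := ih
    refine ⟨N + 1, fun M hM => ?_⟩
    obtain ⟨M, rfl⟩ := Nat.exists_eq_add_of_le' (Nat.one_le_of_lt hM)
    rw [Finset.sum_range_succ', degPart_zero_gen_mul, add_zero]
    simp only [degPart_succ_gen_mul]
    rw [← Finset.mul_sum, hN M (Nat.le_of_succ_le_succ hM)]
  | add θ η hθ hη =>
    obtain ⟨N, hN⟩ := hθ
    obtain ⟨N', hN'⟩ := hη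
    refine ⟨max N N', fun M hM => ?_⟩
    simp only [map_add, Finset.sum_add_distrib]
    rw [hN M (le_of_max_le_left hM), hN' M (le_of_max_le_right hM)]
  | smul r θ hθ =>
    obtain ⟨N, hN⟩ := hθ
    exact ⟨N, fun M hM => by simp only [map_smul, ← Finset.smul_sum, hN M hM]⟩

theorem vac_degPart (n : ℕ) (θ : SymAlgC V) :
    vac (degPart n θ) = if n = 0 then vac θ else 0 := by
  induction θ using sym_induction generalizing n with
  | one => rw [degPart_one, apply_ite vac, map_zero]
  | gen_mul w θ _ =>
    cases n with
    | zero => rw [degPart_zero_gen_mul, vac_gen_mul, map_zero, ite_self]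
    | succ n => rw [degPart_succ_gen_mul, vac_gen_mul, vac_gen_mul, ite_self]
  | add θ η hθ hη => simp only [map_add, hθ, hη, ite_add_ite, add_zero]
  | smul r θ hθ => simp only [map_smulₛₗ, hθ, smul_ite, smul_zero, RingHom.id_apply]

theorem symToDual_degPart (n : ℕ) (φ ψ : SymAlgC V) :
    symToDual (degPart n φ) ψ = symToDual φ (degPart n ψ) := by
  induction φ using sym_induction generalizing n ψ with
  | one =>
    rw [degPart_one, symToDual_one, vac_degPart, apply_ite symToDual, symToDual_one, map_zero]
    split_ifs <;> rfl
  | gen_mul w φ ih =>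
    cases n with
    | zero =>
      rw [degPart_zero_gen_mul, symToDual_gen_mul, annihilator_degPart_zero, map_zero, map_zero,
        LinearMap.zero_apply]
    | succ n =>
      rw [degPart_succ_gen_mul, symToDual_gen_mul, symToDual_gen_mul, ih, annihilator_degPart_succ]
  | add θ η hθ hη => simp only [map_add, LinearMap.add_apply, hθ, hη]
  | smul r θ hθ => simp only [map_smul, LinearMap.smul_apply, hθ]

theorem inner_gen_mul_left (v : V) (ψ φ : SymAlgC V) :
    ⟪gen v * ψ, φ⟫_ℂ = ⟪ψ, annihilator v φ⟫_ℂ := symToDual_apply_gen_mul v φ ψ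

theorem inner_gen_mul_right (v : V) (ψ φ : SymAlgC V) :
    ⟪ψ, gen v * φ⟫_ℂ = ⟪annihilator v ψ, φ⟫_ℂ := symToDual_gen_mul v φ ψ

theorem inner_one_left (φ : SymAlgC V) : ⟪1, φ⟫_ℂ = symToDual φ 1 := rfl

theorem inner_one_one : ⟪(1 : SymAlgC V), 1⟫_ℂ = 1 := by
  rw [inner_one_left, symToDual_one, vac_one]

theorem isSymmetricProjection_degPart (n : ℕ) :
    (degPart n : SymAlgC V →ₗ[ℂ] SymAlgC V).IsSymmetricProjection where
  isIdempotentElem := LinearMap.ext fun θ => (degPart_degPart n n θ).trans (if_pos rfl)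
  isSymmetric ψ φ := (symToDual_degPart n φ ψ).symm

theorem inner_degPart_left (n : ℕ) (ψ φ : SymAlgC V) :
    ⟪degPart n ψ, φ⟫_ℂ = ⟪ψ, degPart n φ⟫_ℂ := (isSymmetricProjection_degPart n).isSymmetric ψ φ

theorem norm_degPart_le (n : ℕ) (θ : SymAlgC V) : ‖degPart n θ‖ ≤ ‖θ‖ :=
  norm_symmetricProjection_le (isSymmetricProjection_degPart n) θ

/-- The projection of `SV` onto the sum of its homogeneous summands of degree below `M`; it makes
the field operators bounded. -/
def degCut (M : ℕ) : SymAlgC V →ₗ[ℂ] SymAlgC V := ∑ n ∈ Finset.range M, degPart n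

theorem degCut_apply (M : ℕ) (θ : SymAlgC V) :
    degCut M θ = ∑ n ∈ Finset.range M, degPart n θ := by
  rw [degCut, LinearMap.sum_apply]

theorem isSymmetricProjection_degCut (M : ℕ) :
    (degCut M : SymAlgC V →ₗ[ℂ] SymAlgC V).IsSymmetricProjection where
  isIdempotentElem := by
    ext θ : 1
    change degCut M (degCut M θ) = degCut M θ
    simp only [degCut_apply, map_sum, degPart_degPart]
    rw [Finset.sum_comm]
    exact Finset.sum_congr rfl fun n hn => by rw [Finset.sum_ite_eq (Finset.range M) n, if_pos hn]
  isSymmetric ψ φ := by simp only [degCut_apply, sum_inner, inner_sum, inner_degPart_left]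

theorem norm_degCut_le (M : ℕ) (θ : SymAlgC V) : ‖degCut M θ‖ ≤ ‖θ‖ :=
  norm_symmetricProjection_le (isSymmetricProjection_degCut M) θ

theorem sum_norm_degPart_sq (M : ℕ) (θ : SymAlgC V) :
    ∑ n ∈ Finset.range M, ‖degPart n θ‖ ^ 2 = ‖degCut M θ‖ ^ 2 := by
  refine Complex.ofReal_injective ?_
  have inner_degCut := inner_symmetricProjection_self (isSymmetricProjection_degCut M) θ
  rw [degCut_apply, inner_sum] at inner_degCut
  simp only [inner_symmetricProjection_self (isSymmetricProjection_degPart _)] at inner_degCut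
  rw [degCut_apply, Complex.ofReal_sum]
  exact inner_degCut

theorem sum_norm_degPart_sq_le (M : ℕ) (θ : SymAlgC V) :
    ∑ n ∈ Finset.range M, ‖degPart n θ‖ ^ 2 ≤ ‖θ‖ ^ 2 := by
  rw [sum_norm_degPart_sq]
  gcongr
  exact norm_degCut_le M θ

theorem norm_gen_mul_sq (v : V) (θ : SymAlgC V) :
    ‖gen v * θ‖ ^ 2 = ‖annihilator v θ‖ ^ 2 + ‖v‖ ^ 2 * ‖θ‖ ^ 2 := by
  have h : ⟪gen v * θ, gen v * θ⟫_ℂ =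
      ⟪annihilator v θ, annihilator v θ⟫_ℂ + ⟪v, v⟫_ℂ * ⟪θ, θ⟫_ℂ := by
    rw [inner_gen_mul_left, annihilator_gen_mul, inner_add_right, inner_smul_right,
      inner_gen_mul_right, add_comm]
  simp only [inner_self_eq_norm_sq_to_K] at h
  exact_mod_cast h

theorem norm_annihilator_sq_le (v : V) (θ : SymAlgC V) :
    ‖annihilator v θ‖ ^ 2 ≤ ‖gen v * annihilator v θ‖ * ‖θ‖ := by
  have cauchy_schwarz := norm_inner_le_norm (𝕜 := ℂ) (gen v * annihilator v θ) θ
  rwa [inner_gen_mul_left, inner_self_eq_norm_sq_to_K, norm_pow, RCLike.norm_ofReal, abs_norm]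
    at cauchy_schwarz

theorem norm_gen_mul_le_of_norm_annihilator_le {v : V} {θ : SymAlgC V} {n : ℕ}
    (h : ‖annihilator v θ‖ ≤ Real.sqrt n * ‖v‖ * ‖θ‖) :
    ‖gen v * θ‖ ≤ Real.sqrt (n + 1) * ‖v‖ * ‖θ‖ := by
  refine le_of_sq_le_sq ?_ (by positivity)
  calc ‖gen v * θ‖ ^ 2 = ‖annihilator v θ‖ ^ 2 + ‖v‖ ^ 2 * ‖θ‖ ^ 2 := norm_gen_mul_sq v θ
    _ ≤ (Real.sqrt n * ‖v‖ * ‖θ‖) ^ 2 + ‖v‖ ^ 2 * ‖θ‖ ^ 2 := by gcongr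
    _ = (Real.sqrt (n + 1) * ‖v‖ * ‖θ‖) ^ 2 := by
      simp only [mul_pow, Real.sq_sqrt n.cast_nonneg, Real.sq_sqrt n.cast_add_one_pos.le]
      ring

theorem norm_annihilator_degPart_le (n : ℕ) (v : V) (θ : SymAlgC V) :
    ‖annihilator v (degPart n θ)‖ ≤ Real.sqrt n * ‖v‖ * ‖degPart n θ‖ := by
  induction n generalizing θ with
  | zero => rw [annihilator_degPart_zero, norm_zero]; positivity
  | succ n ih =>
    have creator_bound : ‖gen v * annihilator v (degPart (n + 1) θ)‖ ≤
        Real.sqrt (n + 1) * ‖v‖ * ‖annihilator v (degPart (n + 1) θ)‖ := by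
      rw [annihilator_degPart_succ]
      exact norm_gen_mul_le_of_norm_annihilator_le (ih _)
    rcases (norm_nonneg (annihilator v (degPart (n + 1) θ))).eq_or_lt with h | h
    · rw [← h]; positivity
    · refine le_of_mul_le_mul_right ?_ h
      calc _ = ‖annihilator v (degPart (n + 1) θ)‖ ^ 2 := (sq _).symm
        _ ≤ _ := norm_annihilator_sq_le v _
        _ ≤ _ := mul_le_mul_of_nonneg_right creator_bound (norm_nonneg _)
        _ = _ := by push_cast; ring

theorem norm_gen_mul_degPart_le (n : ℕ) (v : V) (θ : SymAlgC V) :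
    ‖gen v * degPart n θ‖ ≤ Real.sqrt (n + 1) * ‖v‖ * ‖degPart n θ‖ :=
  norm_gen_mul_le_of_norm_annihilator_le (norm_annihilator_degPart_le n v θ)

theorem denseRange_toFock : DenseRange (toFock : SymAlgC V → Fock V) :=
  UniformSpace.Completion.denseRange_coe

theorem fock_induction {P : Fock V → Prop} (isClosed : IsClosed {Φ | P Φ})
    (toFock : ∀ θ, P (toFock θ)) (Φ : Fock V) : P Φ :=
  denseRange_toFock.induction_on Φ isClosed toFock

theorem fockToDual_injective : Function.Injective (fockToDual : Fock V → AntiDual V) := by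
  refine (injective_iff_map_eq_zero (fockToDual : Fock V →ₗ[ℂ] AntiDual V)).2 fun Φ hΦ => ?_
  exact (inner_self_eq_zero (𝕜 := ℂ)).1 <| fock_induction (P := fun Ξ => ⟪Ξ, Φ⟫_ℂ = 0)
    (isClosed_eq (by fun_prop) (by fun_prop)) (LinearMap.congr_fun hΦ) Φ

theorem fockToDual_apply (Φ : Fock V) (θ : SymAlgC V) : fockToDual Φ θ = ⟪toFock θ, Φ⟫_ℂ := rfl

/-- The projection of Fock space onto its homogeneous summand of degree `n`. -/
def fockPart (n : ℕ) : Fock V →L[ℂ] Fock V :=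
  ((degPart n).mkContinuous 1 fun θ => by rw [one_mul]; exact norm_degPart_le n θ).completion

theorem fockPart_toFock (n : ℕ) (θ : SymAlgC V) : fockPart n (toFock θ) = toFock (degPart n θ) :=
  ContinuousLinearMap.completion_apply_coe _ θ

theorem sum_norm_fockPart_sq_le (M : ℕ) (Φ : Fock V) :
    ∑ n ∈ Finset.range M, ‖fockPart n Φ‖ ^ 2 ≤ ‖Φ‖ ^ 2 := by
  induction Φ using fock_induction with
  | isClosed => exact isClosed_le (by fun_prop) (by fun_prop)
  | toFock θ =>
    simp only [fockPart_toFock, LinearIsometry.norm_map]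
    exact sum_norm_degPart_sq_le M θ

theorem summable_norm_fockPart_sq (Φ : Fock V) : Summable fun n => ‖fockPart n Φ‖ ^ 2 :=
  summable_of_sum_range_le (fun _ => sq_nonneg _) fun M => sum_norm_fockPart_sq_le M Φ

/-- The projection of Fock space onto the sum of its homogeneous summands of degree below `M`. -/
def fockCut (M : ℕ) : Fock V →L[ℂ] Fock V :=
  ((degCut M).mkContinuous 1 fun θ => by rw [one_mul]; exact norm_degCut_le M θ).completion

theorem fockCut_toFock (M : ℕ) (θ : SymAlgC V) : fockCut M (toFock θ) = toFock (degCut M θ) :=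
  ContinuousLinearMap.completion_apply_coe _ θ

theorem norm_fockCut_le (M : ℕ) (Φ : Fock V) : ‖fockCut M Φ‖ ≤ ‖Φ‖ := by
  induction Φ using fock_induction with
  | isClosed => exact isClosed_le (by fun_prop) (by fun_prop)
  | toFock θ =>
    rw [fockCut_toFock, LinearIsometry.norm_map, LinearIsometry.norm_map]
    exact norm_degCut_le M θ

theorem tendsto_fockCut (Φ : Fock V) :
    Filter.Tendsto (fun M => fockCut M Φ) Filter.atTop (nhds Φ) := by
  rw [Metric.tendsto_atTop]
  intro ε hε
  obtain ⟨θ, hθ⟩ := denseRange_toFock.exists_dist_lt Φ (half_pos hε)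
  obtain ⟨N, hN⟩ := exists_sum_degPart θ
  refine ⟨N, fun M hM => ?_⟩
  have fockCut_θ : fockCut M (toFock θ) = toFock θ := by
    rw [fockCut_toFock, degCut_apply, hN M hM]
  rw [dist_eq_norm] at hθ ⊢
  calc ‖fockCut M Φ - Φ‖ = ‖fockCut M (Φ - toFock θ) - (Φ - toFock θ)‖ := by
        rw [map_sub, fockCut_θ, sub_sub_sub_cancel_right]
    _ ≤ ‖fockCut M (Φ - toFock θ)‖ + ‖Φ - toFock θ‖ := norm_sub_le _ _
    _ ≤ ‖Φ - toFock θ‖ + ‖Φ - toFock θ‖ := by gcongr; exact norm_fockCut_le _ _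
    _ < ε := by linarith

end Degree

/-! ### Symmetry of the field operators on their natural domains -/

theorem eq_zero_of_tendsto_of_norm_le_sqrt_mul {E : Type*} [NormedAddCommGroup E] {S : ℕ → E}
    {x : E} (hS : Filter.Tendsto S Filter.atTop (nhds x)) {t : ℕ → ℝ} (ht : Summable t)
    (h : ∀ n, ‖S n‖ ≤ Real.sqrt (n + 1) * t n) : x = 0 := by
  by_contra hx
  have norm_pos : 0 < ‖x‖ / 2 := half_pos (norm_pos_iff.2 hx)
  have eventually_lt : ∀ᶠ n in Filter.atTop, ‖x‖ / 2 < ‖S n‖ :=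
    hS.norm.eventually_const_lt (half_lt_self (norm_pos_iff.2 hx))
  have summable_sqrt : Summable fun n : ℕ => 1 / ((n + 1 : ℕ) : ℝ) ^ (1 / 2 : ℝ) := by
    refine Summable.of_norm_bounded_eventually_nat (ht.mul_left (‖x‖ / 2)⁻¹) ?_
    filter_upwards [eventually_lt] with n hn
    have sqrt_pos : 0 < Real.sqrt (n + 1) := Real.sqrt_pos.2 n.cast_add_one_pos
    rw [← Real.sqrt_eq_rpow, Nat.cast_succ, Real.norm_of_nonneg (by positivity),
      inv_mul_eq_div, div_le_div_iff₀ sqrt_pos norm_pos, one_mul, mul_comm (t n)]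
    exact hn.le.trans (h n)
  have exponent_gt : (1 : ℝ) < 1 / 2 :=
    Real.summable_one_div_nat_rpow.1 ((summable_nat_add_iff 1).1 summable_sqrt)
  norm_num at exponent_gt

theorem summable_mul_of_summable_sq {ι : Type*} {a b : ι → ℝ} (ha : Summable fun i => a i ^ 2)
    (hb : Summable fun i => b i ^ 2) : Summable fun i => a i * b i := by
  refine Summable.of_norm_bounded (ha.add hb) fun i => ?_
  rw [Real.norm_eq_abs, abs_le]
  constructor <;> nlinarith [sq_nonneg (a i + b i), sq_nonneg (a i - b i)]

section FieldSymm

variable {V : Type*} [NormedAddCommGroup V] [InnerProductSpace ℂ V]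

theorem field_apply (v : V) (θ : SymAlgC V) :
    field v θ = ((Real.sqrt 2 : ℂ)⁻¹) • (gen v * θ + annihilator v θ) := rfl

theorem inner_field_left (v : V) (ψ φ : SymAlgC V) : ⟪field v ψ, φ⟫_ℂ = ⟪ψ, field v φ⟫_ℂ := by
  rw [field_apply, field_apply, inner_smul_left, inner_smul_right, inner_add_left, inner_add_right,
    inner_gen_mul_left, inner_gen_mul_right, map_inv₀, Complex.conj_ofReal, add_comm]

theorem isFieldValue_iff (v : V) (Φ Ψ : Fock V) :
    IsFieldValue v Φ Ψ ↔ ∀ θ, ⟪toFock θ, Ψ⟫_ℂ = ⟪toFock (field v θ), Φ⟫_ℂ :=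
  LinearMap.ext_iff

theorem isFieldValue_toFock (v : V) (φ : SymAlgC V) :
    IsFieldValue v (toFock φ) (toFock (field v φ)) := by
  rw [isFieldValue_iff]
  intro θ
  rw [LinearIsometry.inner_map_map, LinearIsometry.inner_map_map, inner_field_left]

theorem degCut_succ_gen_mul (M : ℕ) (v : V) (θ : SymAlgC V) :
    degCut (M + 1) (gen v * θ) = gen v * degCut M θ := by
  rw [degCut_apply, Finset.sum_range_succ', degPart_zero_gen_mul, add_zero, degCut_apply,
    Finset.mul_sum]
  simp only [degPart_succ_gen_mul]

theorem annihilator_degCut_succ (M : ℕ) (v : V) (θ : SymAlgC V) :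
    annihilator v (degCut (M + 1) θ) = degCut M (annihilator v θ) := by
  rw [degCut_apply, Finset.sum_range_succ', map_add, annihilator_degPart_zero, add_zero, map_sum,
    degCut_apply]
  simp only [annihilator_degPart_succ]

theorem degCut_succ (M : ℕ) (θ : SymAlgC V) :
    degCut (M + 1) θ = degCut M θ + degPart M θ := by
  rw [degCut_apply, Finset.sum_range_succ, degCut_apply]

theorem degCut_field_sub (M : ℕ) (v : V) (θ : SymAlgC V) :
    degCut (M + 1) (field v θ) - field v (degCut (M + 1) θ) =
      ((Real.sqrt 2 : ℂ)⁻¹) • (annihilator v (degPart (M + 1) θ) - gen v * degPart M θ) := by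
  rw [field_apply, field_apply, map_smul, map_add, degCut_succ_gen_mul, ← annihilator_degCut_succ,
    ← smul_sub, degCut_succ (M + 1), map_add, degCut_succ M, mul_add]
  congr 1
  abel

theorem norm_sqrt_two_inv_le_one : ‖(Real.sqrt 2 : ℂ)⁻¹‖ ≤ 1 := by
  rw [norm_inv, Complex.norm_real, Real.norm_of_nonneg (Real.sqrt_nonneg _)]
  exact inv_le_one_of_one_le₀ (Real.one_le_sqrt.2 one_le_two)

theorem norm_field_degPart_le (n : ℕ) (v : V) (θ : SymAlgC V) :
    ‖field v (degPart n θ)‖ ≤ (Real.sqrt (n + 1) * ‖v‖ + Real.sqrt n * ‖v‖) * ‖θ‖ := by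
  rw [field_apply, norm_smul]
  calc _ ≤ ‖gen v * degPart n θ + annihilator v (degPart n θ)‖ :=
        mul_le_of_le_one_left (norm_nonneg _) norm_sqrt_two_inv_le_one
    _ ≤ ‖gen v * degPart n θ‖ + ‖annihilator v (degPart n θ)‖ := norm_add_le _ _
    _ ≤ (Real.sqrt (n + 1) * ‖v‖ + Real.sqrt n * ‖v‖) * ‖degPart n θ‖ := by
        rw [add_mul]
        exact add_le_add (norm_gen_mul_degPart_le n v θ) (norm_annihilator_degPart_le n v θ)
    _ ≤ _ := by gcongr; exact norm_degPart_le n θ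

theorem exists_bound_field_degCut (M : ℕ) (v : V) :
    ∃ C : ℝ, ∀ θ, ‖(field v ∘ₗ degCut M : SymAlgC V →ₗ[ℂ] SymAlgC V) θ‖ ≤ C * ‖θ‖ := by
  refine ⟨∑ n ∈ Finset.range M, (Real.sqrt (n + 1) * ‖v‖ + Real.sqrt n * ‖v‖), fun θ => ?_⟩
  rw [LinearMap.comp_apply, degCut_apply, map_sum, Finset.sum_mul]
  exact norm_sum_le_of_le _ fun n _ => norm_field_degPart_le n v θ

/-- The extension to Fock space of `π(v)` cut off to degrees below `M`, which is bounded. -/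
def fieldCut (M : ℕ) (v : V) : Fock V →L[ℂ] Fock V :=
  ((field v ∘ₗ degCut M).mkContinuous _ (exists_bound_field_degCut M v).choose_spec).completion

theorem fieldCut_toFock (M : ℕ) (v : V) (θ : SymAlgC V) :
    fieldCut M v (toFock θ) = toFock (field v (degCut M θ)) :=
  ContinuousLinearMap.completion_apply_coe _ θ

theorem norm_inner_field_degCut_sub_le (M : ℕ) (v : V) (ψ φ : SymAlgC V) :
    ‖⟪field v (degCut (M + 1) ψ), φ⟫_ℂ - ⟪ψ, field v (degCut (M + 1) φ)⟫_ℂ‖ ≤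
      Real.sqrt (M + 1) * (‖v‖ * (‖degPart M ψ‖ * ‖degPart (M + 1) φ‖ +
        ‖degPart (M + 1) ψ‖ * ‖degPart M φ‖)) := by
  have annihilator_bound : ‖⟪ψ, annihilator v (degPart (M + 1) φ)⟫_ℂ‖ ≤
      ‖degPart M ψ‖ * (Real.sqrt (M + 1) * ‖v‖ * ‖degPart (M + 1) φ‖) := by
    have inner_eq : ⟪ψ, annihilator v (degPart (M + 1) φ)⟫_ℂ =
        ⟪degPart M ψ, annihilator v (degPart (M + 1) φ)⟫_ℂ := by
      rw [inner_degPart_left, annihilator_degPart_succ, degPart_degPart, if_pos rfl]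
    rw [inner_eq]
    refine (norm_inner_le_norm _ _).trans ?_
    gcongr
    exact_mod_cast norm_annihilator_degPart_le (M + 1) v φ
  have gen_mul_bound : ‖⟪ψ, gen v * degPart M φ⟫_ℂ‖ ≤
      ‖degPart (M + 1) ψ‖ * (Real.sqrt (M + 1) * ‖v‖ * ‖degPart M φ‖) := by
    have inner_eq : ⟪ψ, gen v * degPart M φ⟫_ℂ = ⟪degPart (M + 1) ψ, gen v * degPart M φ⟫_ℂ := by
      rw [inner_degPart_left, degPart_succ_gen_mul, degPart_degPart, if_pos rfl]
    rw [inner_eq]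
    refine (norm_inner_le_norm _ _).trans ?_
    gcongr
    exact norm_gen_mul_degPart_le M v φ
  rw [inner_field_left, (isSymmetricProjection_degCut _).isSymmetric, ← inner_sub_right,
    degCut_field_sub, inner_smul_right, inner_sub_right, norm_mul]
  calc _ ≤ _ := mul_le_of_le_one_left (norm_nonneg _) norm_sqrt_two_inv_le_one
    _ ≤ _ := norm_sub_le _ _
    _ ≤ _ := add_le_add annihilator_bound gen_mul_bound
    _ = _ := by ring

theorem norm_inner_fieldCut_sub_le (M : ℕ) (v : V) (Φ' Φ : Fock V) :
    ‖⟪fieldCut (M + 1) v Φ', Φ⟫_ℂ - ⟪Φ', fieldCut (M + 1) v Φ⟫_ℂ‖ ≤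
      Real.sqrt (M + 1) * (‖v‖ * (‖fockPart M Φ'‖ * ‖fockPart (M + 1) Φ‖ +
        ‖fockPart (M + 1) Φ'‖ * ‖fockPart M Φ‖)) := by
  induction Φ using fock_induction with
  | isClosed => exact isClosed_le (by fun_prop) (by fun_prop)
  | toFock φ =>
  induction Φ' using fock_induction with
  | isClosed => exact isClosed_le (by fun_prop) (by fun_prop)
  | toFock ψ =>
  simp only [fieldCut_toFock, fockPart_toFock, LinearIsometry.inner_map_map,
    LinearIsometry.norm_map]
  exact norm_inner_field_degCut_sub_le M v ψ φ

theorem IsFieldValue.inner_fockCut {v : V} {Φ Ψ : Fock V} (h : IsFieldValue v Φ Ψ) (M : ℕ)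
    (Ξ : Fock V) : ⟪fockCut M Ξ, Ψ⟫_ℂ = ⟪fieldCut M v Ξ, Φ⟫_ℂ := by
  induction Ξ using fock_induction with
  | isClosed => exact isClosed_eq (by fun_prop) (by fun_prop)
  | toFock θ =>
    rw [fockCut_toFock, fieldCut_toFock]
    exact (isFieldValue_iff v Φ Ψ).1 h _

/-- Cutting off at degree `M` costs two boundary terms of size `√M ‖Φ_M‖ ‖Φ'_{M+1}‖`; since
`∑ ‖Φ_M‖ ‖Φ'_{M+1}‖` converges, they tend to zero along a subsequence. -/
theorem IsFieldValue.inner_symm {v : V} {Φ Ψ Φ' Ψ' : Fock V} (h : IsFieldValue v Φ Ψ)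
    (h' : IsFieldValue v Φ' Ψ') : ⟪Φ', Ψ⟫_ℂ = ⟪Ψ', Φ⟫_ℂ := by
  have tendsto_cut (Ξ : Fock V) :
      Filter.Tendsto (fun M => fockCut (M + 1) Ξ) Filter.atTop (nhds Ξ) :=
    (tendsto_fockCut Ξ).comp (Filter.tendsto_add_atTop_nat 1)
  have tendsto_sub :
      Filter.Tendsto (fun M => ⟪fockCut (M + 1) Φ', Ψ⟫_ℂ - ⟪Ψ', fockCut (M + 1) Φ⟫_ℂ)
        Filter.atTop (nhds (⟪Φ', Ψ⟫_ℂ - ⟪Ψ', Φ⟫_ℂ)) :=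
    ((tendsto_cut Φ').inner tendsto_const_nhds).sub (tendsto_const_nhds.inner (tendsto_cut Φ))
  have summable_succ (Ξ : Fock V) : Summable fun M => ‖fockPart (M + 1) Ξ‖ ^ 2 :=
    (summable_nat_add_iff 1).2 (summable_norm_fockPart_sq Ξ)
  have summable_boundary : Summable fun M => ‖v‖ * (‖fockPart M Φ'‖ * ‖fockPart (M + 1) Φ‖ +
      ‖fockPart (M + 1) Φ'‖ * ‖fockPart M Φ‖) :=
    ((summable_mul_of_summable_sq (summable_norm_fockPart_sq Φ') (summable_succ Φ)).add
      (summable_mul_of_summable_sq (summable_succ Φ') (summable_norm_fockPart_sq Φ))).mul_left _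
  refine sub_eq_zero.1 (eq_zero_of_tendsto_of_norm_le_sqrt_mul tendsto_sub summable_boundary
    fun M => ?_)
  rw [h.inner_fockCut, ← inner_conj_symm Ψ', h'.inner_fockCut, inner_conj_symm]
  exact norm_inner_fieldCut_sub_le M v Φ' Φ

theorem gen_smul (c : ℂ) (v : V) : (gen (c • v) : SymAlgC V) = c • gen v := map_smul _ _ _

theorem gen_mul_eq_field (v : V) (φ : SymAlgC V) : gen v * φ =
    ((Real.sqrt 2 : ℂ)⁻¹) • (field v φ - Complex.I • field (Complex.I • v) φ) := by
  rw [field_apply, field_apply, smul_comm Complex.I, ← smul_sub, smul_smul,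
    sqrt_two_inv_mul_self, annihilator_smul, gen_smul, LinearMap.smul_apply, Complex.conj_I,
    smul_mul_assoc, smul_add, smul_smul,
    smul_smul, mul_neg, Complex.I_mul_I]
  module

theorem annihilator_eq_field (v : V) (φ : SymAlgC V) : annihilator v φ =
    ((Real.sqrt 2 : ℂ)⁻¹) • (field v φ + Complex.I • field (Complex.I • v) φ) := by
  rw [field_apply, field_apply, smul_comm Complex.I, ← smul_add, smul_smul,
    sqrt_two_inv_mul_self, annihilator_smul, gen_smul, LinearMap.smul_apply, Complex.conj_I,
    smul_mul_assoc, smul_add Complex.I, smul_smul,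
    smul_smul, mul_neg, Complex.I_mul_I]
  module

/-! ### Intertwining operators -/

/-- A linear map from `SV` to Fock space intertwines `π(v)` and `π(g v)` for all `v` if it maps
each `φ` into the natural domain of `π(g v)`, where `π(g v) (U φ) = U (π(v) φ)`. -/
def Intertwines (g : SpGroup V) (U : SymAlgC V →ₗ[ℂ] Fock V) : Prop :=
  ∀ v φ, IsFieldValue ((g : V ≃ₗ[ℝ] V) v) (U φ) (U (field v φ))

theorem Intertwines.inner_gen_mul {g : SpGroup V} {U : SymAlgC V →ₗ[ℂ] Fock V}
    (hU : Intertwines g U) (v : V) (φ ψ : SymAlgC V) :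
    ⟪U φ, U (gen v * ψ)⟫_ℂ = ⟪U (annihilator v φ), U ψ⟫_ℂ := by
  have inner_field : ∀ w, ⟪U φ, U (field w ψ)⟫_ℂ = ⟪U (field w φ), U ψ⟫_ℂ :=
    fun w => (hU w ψ).inner_symm (hU w φ)
  rw [gen_mul_eq_field, annihilator_eq_field]
  simp only [map_smul, map_sub, map_add, inner_smul_left, inner_smul_right, inner_sub_right,
    inner_add_left, inner_field, map_inv₀, Complex.conj_ofReal, Complex.conj_I]
  ring

theorem Intertwines.inner_map_map {g : SpGroup V} {U : SymAlgC V →ₗ[ℂ] Fock V}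
    (hU : Intertwines g U) (φ ψ : SymAlgC V) :
    ⟪U φ, U ψ⟫_ℂ = (‖U 1‖ ^ 2 : ℝ) * ⟪φ, ψ⟫_ℂ := by
  induction ψ using sym_induction generalizing φ with
  | one =>
    induction φ using sym_induction with
    | one =>
      rw [inner_self_eq_norm_sq_to_K, inner_one_one, mul_one, Complex.ofReal_pow]
      rfl
    | gen_mul w φ _ =>
      rw [← inner_conj_symm, hU.inner_gen_mul, annihilator_one, map_zero, inner_zero_left,
        map_zero, inner_gen_mul_left, annihilator_one, inner_zero_right, mul_zero]
    | add θ η hθ hη => rw [map_add, inner_add_left, inner_add_left, hθ, hη, mul_add]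
    | smul r θ hθ => rw [map_smul, inner_smul_left, inner_smul_left, hθ]; ring
  | gen_mul w ψ ih => rw [hU.inner_gen_mul, ih, inner_gen_mul_right]
  | add θ η hθ hη => rw [map_add, inner_add_right, inner_add_right, hθ, hη, mul_add]
  | smul r θ hθ => rw [map_smul, inner_smul_right, inner_smul_right, hθ]; ring

theorem Intertwines.norm_map {g : SpGroup V} {U : SymAlgC V →ₗ[ℂ] Fock V}
    (hU : Intertwines g U) (φ : SymAlgC V) : ‖U φ‖ = ‖U 1‖ * ‖φ‖ := by
  have inner_eq := hU.inner_map_map φ φ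
  simp only [inner_self_eq_norm_sq_to_K] at inner_eq
  refine (sq_eq_sq₀ (norm_nonneg _) (by positivity)).1 ?_
  rw [mul_pow]
  exact Complex.ofReal_injective (by push_cast at inner_eq ⊢; exact inner_eq)

/-- The restriction to `SV` of a bounded operator on Fock space. -/
def restr (T : Fock V →L[ℂ] Fock V) : SymAlgC V →ₗ[ℂ] Fock V := T.toLinearMap ∘ₗ toFock.toLinearMap

theorem restr_apply (T : Fock V →L[ℂ] Fock V) (φ : SymAlgC V) : restr T φ = T (toFock φ) := rfl

theorem spGroup_apply_inv_apply (g : SpGroup V) (v : V) :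
    (g : V ≃ₗ[ℝ] V) ((g⁻¹ : SpGroup V).1 v) = v := g.1.apply_symm_apply v

theorem spGroup_inv_apply_apply (g : SpGroup V) (v : V) :
    (g⁻¹ : SpGroup V).1 ((g : V ≃ₗ[ℝ] V) v) = v := g.1.symm_apply_apply v

theorem Intertwines.adjoint {g : SpGroup V} {T : Fock V →L[ℂ] Fock V}
    (hT : Intertwines g (restr T)) : Intertwines g⁻¹ (restr (ContinuousLinearMap.adjoint T)) := by
  intro w φ
  rw [isFieldValue_iff]
  intro θ
  have field_T := (isFieldValue_iff _ _ _).1 (hT ((g⁻¹ : SpGroup V).1 w) θ) φ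
  rw [spGroup_apply_inv_apply] at field_T
  rw [restr_apply, restr_apply, ContinuousLinearMap.adjoint_inner_right,
    ContinuousLinearMap.adjoint_inner_right, ← inner_conj_symm, ← inner_conj_symm (T _) (toFock φ)]
  exact congrArg conj field_T.symm

theorem Intertwines.map_isFieldValue {g : SpGroup V} {T : Fock V →L[ℂ] Fock V}
    (hT : Intertwines g (restr T)) {v : V} {Φ Ψ : Fock V} (h : IsFieldValue v Φ Ψ) :
    IsFieldValue ((g : V ≃ₗ[ℝ] V) v) (T Φ) (T Ψ) := by
  rw [isFieldValue_iff]
  intro θ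
  have field_adjoint := hT.adjoint ((g : V ≃ₗ[ℝ] V) v) θ
  rw [spGroup_inv_apply_apply] at field_adjoint
  simpa only [restr_apply, ContinuousLinearMap.adjoint_inner_left] using
    h.inner_symm field_adjoint

theorem toFock_one_ne_zero : (toFock 1 : Fock V) ≠ 0 := fun eq_zero => by
  have inner_eq := toFock.inner_map_map (1 : SymAlgC V) 1
  rw [eq_zero, inner_zero_left, inner_one_one] at inner_eq
  exact zero_ne_one inner_eq

theorem adjoint_apply_apply {T : Fock V →L[ℂ] Fock V} (hT : T ∈ unitary (Fock V →L[ℂ] Fock V))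
    (Φ : Fock V) : ContinuousLinearMap.adjoint T (T Φ) = Φ :=
  DFunLike.congr_fun (Unitary.star_mul_self_of_mem hT) Φ

theorem isUnitaryMetaplectic_iff (g : SpGroup V) (T : Fock V →L[ℂ] Fock V) :
    IsUnitaryMetaplectic g T ↔ T ∈ unitary (Fock V →L[ℂ] Fock V) ∧ Intertwines g (restr T) := by
  refine and_congr_right fun hT => ⟨fun h => h.2, fun h => ⟨fun eq_zero => ?_, h⟩⟩
  have T_one : T (toFock 1) = 0 :=
    fockToDual_injective ((LinearMap.congr_fun eq_zero 1).trans (map_zero fockToDual).symm)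
  refine toFock_one_ne_zero (V := V) ?_
  rw [← adjoint_apply_apply hT (toFock 1), T_one, map_zero]

theorem isUnitaryImplementer_iff (g : SpGroup V) (T : Fock V →L[ℂ] Fock V) :
    IsUnitaryImplementer g T ↔ IsUnitaryMetaplectic g T := by
  rw [isUnitaryMetaplectic_iff]
  refine and_congr_right fun hT => ⟨fun h v φ => (h v _ _).1 (isFieldValue_toFock v φ),
    fun h v Φ Ψ => ⟨fun hΦ => h.map_isFieldValue hΦ, fun hΦ => ?_⟩⟩
  simpa only [spGroup_inv_apply_apply, adjoint_apply_apply hT] using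
    h.adjoint.map_isFieldValue hΦ

end FieldSymm

/-! ### Necessity of the Hilbert–Schmidt condition -/

section Necessity

variable {V : Type*} [NormedAddCommGroup V] [InnerProductSpace ℂ V]

theorem field_add (v w : V) (θ : SymAlgC V) : field (v + w) θ = field v θ + field w θ := by
  rw [field_apply, field_apply, field_apply, gen_add, annihilator_add, LinearMap.add_apply, add_mul]
  module

theorem gen_neg (v : V) : (gen (-v) : SymAlgC V) = -gen v := map_neg _ _

theorem field_neg (v : V) (θ : SymAlgC V) : field (-v) θ = -field v θ := by
  rw [field_apply, field_apply, annihilator_neg, LinearMap.neg_apply, gen_neg, neg_mul, ← neg_add,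
    smul_neg]

theorem spGroup_apply_I_smul (g : SpGroup V) (v : V) :
    (g : V ≃ₗ[ℝ] V) (Complex.I • v) = Complex.I • Cg g v + -(Complex.I • Ag g v) := by
  rw [← Cg_add_Ag, map_smul, map_smulₛₗ, Complex.conj_I, neg_smul]

theorem field_one_eq_neg_I_smul (v : V) :
    field v (1 : SymAlgC V) = -(Complex.I • field (Complex.I • v) 1) := by
  have annihilator_eq := annihilator_eq_field v (1 : SymAlgC V)
  rw [annihilator_one] at annihilator_eq
  exact eq_neg_of_add_eq_zero_left ((smul_eq_zero.1 annihilator_eq.symm).resolve_left (by simp))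

theorem gen_Cg_mul_add_annihilator_Ag (g : SpGroup V) (v : V) (θ : SymAlgC V) :
    gen (Cg g v) * θ + annihilator (Ag g v) θ = ((Real.sqrt 2 : ℂ)⁻¹) •
      (field ((g : V ≃ₗ[ℝ] V) v) θ - Complex.I • field ((g : V ≃ₗ[ℝ] V) (Complex.I • v)) θ) := by
  rw [gen_mul_eq_field, annihilator_eq_field, spGroup_apply_I_smul, ← Cg_add_Ag, field_add,
    field_add, field_neg]
  module

theorem Intertwines.inner_gen_mul_one {g : SpGroup V} {U : SymAlgC V →ₗ[ℂ] Fock V}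
    (hU : Intertwines g U) (v : V) (θ : SymAlgC V) :
    ⟪toFock (gen (Cg g v) * θ + annihilator (Ag g v) θ), U 1⟫_ℂ = 0 := by
  have field_v := (isFieldValue_iff _ _ _).1 (hU v 1) θ
  have field_I_smul_v := (isFieldValue_iff _ _ _).1 (hU (Complex.I • v) 1) θ
  rw [gen_Cg_mul_add_annihilator_Ag, map_smul, inner_smul_left, map_sub, map_smul, inner_sub_left,
    inner_smul_left, ← field_v, ← field_I_smul_v, field_one_eq_neg_I_smul, map_neg, map_smul,
    inner_neg_right, inner_smul_right, Complex.conj_I]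
  ring

theorem annihilator_gen (x y : V) : annihilator x (gen y : SymAlgC V) = ⟪x, y⟫_ℂ • 1 := by
  have h := annihilator_gen_mul x y (1 : SymAlgC V)
  rwa [mul_one, annihilator_one, mul_zero, add_zero] at h

theorem inner_gen_gen (x y : V) : ⟪(gen x : SymAlgC V), gen y⟫_ℂ = ⟪x, y⟫_ℂ := by
  rw [← mul_one (gen x), inner_gen_mul_left, annihilator_gen, inner_smul_right, inner_one_one,
    mul_one]

theorem inner_gen_mul_gen (x y x' y' : V) : ⟪(gen x * gen y : SymAlgC V), gen x' * gen y'⟫_ℂ =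
    ⟪x, x'⟫_ℂ * ⟪y, y'⟫_ℂ + ⟪x, y'⟫_ℂ * ⟪y, x'⟫_ℂ := by
  rw [inner_gen_mul_left, annihilator_gen_mul, annihilator_gen, mul_smul_comm, mul_one,
    inner_add_right, inner_smul_right, inner_smul_right, inner_gen_gen, inner_gen_gen]

theorem norm_sq_sum_gen_mul_gen_le {Z : V → V} (hZ : ∀ x y, ⟪y, Z x⟫_ℂ = ⟪x, Z y⟫_ℂ)
    {ι : Type*} {e : ι → V} (he : Orthonormal ℂ e) (s : Finset ι) :
    ‖∑ i ∈ s, (gen (e i) * gen (Z (e i)) : SymAlgC V)‖ ^ 2 ≤ 2 * ∑ i ∈ s, ‖Z (e i)‖ ^ 2 := by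
  classical
  have inner_pair (i j : ι) :
      ⟪(gen (e i) * gen (Z (e i)) : SymAlgC V), gen (e j) * gen (Z (e j))⟫_ℂ =
        (((if i = j then ‖Z (e i)‖ ^ 2 else 0) + ‖⟪e i, Z (e j)⟫_ℂ‖ ^ 2 : ℝ) : ℂ) := by
    rw [inner_gen_mul_gen, orthonormal_iff_ite.1 he i j, ← inner_conj_symm (Z (e i)) (e j),
      hZ (e i) (e j), Complex.mul_conj', ite_mul, one_mul, zero_mul]
    push_cast
    congr 1
    split_ifs with hij
    · rw [hij, inner_self_eq_norm_sq_to_K, Complex.ofReal_pow]; rfl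
    · exact Complex.ofReal_zero.symm
  have norm_sq_eq : ‖∑ i ∈ s, (gen (e i) * gen (Z (e i)) : SymAlgC V)‖ ^ 2 =
      ∑ i ∈ s, ∑ j ∈ s, ((if i = j then ‖Z (e i)‖ ^ 2 else 0) + ‖⟪e i, Z (e j)⟫_ℂ‖ ^ 2) := by
    refine Complex.ofReal_injective ?_
    simp only [Complex.ofReal_sum, ← inner_pair]
    simp only [← inner_sum]
    rw [← sum_inner, inner_self_eq_norm_sq_to_K, Complex.ofReal_pow]
    rfl
  have bessel : ∑ i ∈ s, ∑ j ∈ s, ‖⟪e i, Z (e j)⟫_ℂ‖ ^ 2 ≤ ∑ i ∈ s, ‖Z (e i)‖ ^ 2 := by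
    rw [Finset.sum_comm]
    exact Finset.sum_le_sum fun j _ => he.sum_inner_products_le _
  have diagonal : ∑ i ∈ s, ∑ j ∈ s, (if i = j then ‖Z (e i)‖ ^ 2 else 0) =
      ∑ i ∈ s, ‖Z (e i)‖ ^ 2 :=
    Finset.sum_congr rfl fun i hi => by rw [Finset.sum_ite_eq, if_pos hi]
  rw [norm_sq_eq]
  simp only [Finset.sum_add_distrib]
  linarith

theorem IsGaussianWith.apply_sum_gen_mul_gen {Z : V → V} {Φ : AntiDual V}
    (hΦ : IsGaussianWith Z Φ) {ι : Type*} (e : ι → V) (s : Finset ι) :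
    Φ (∑ i ∈ s, gen (e i) * gen (Z (e i))) = (∑ i ∈ s, ‖Z (e i)‖ ^ 2 : ℝ) * Φ 1 := by
  rw [map_sum, Complex.ofReal_sum, Finset.sum_mul]
  refine Finset.sum_congr rfl fun i _ => ?_
  rw [isGaussianWith_iff.1 hΦ, annihilator_gen, map_smulₛₗ, smul_eq_mul, inner_conj_symm,
    inner_self_eq_norm_sq_to_K, Complex.ofReal_pow]
  rfl

theorem IsGaussianWith.sum_norm_sq_le {Z : V → V} (hZ : ∀ x y, ⟪y, Z x⟫_ℂ = ⟪x, Z y⟫_ℂ)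
    {Φ : Fock V} (hΦ : IsGaussianWith Z (fockToDual Φ)) {ι : Type*} {e : ι → V}
    (he : Orthonormal ℂ e) (s : Finset ι) :
    ‖fockToDual Φ 1‖ ^ 2 * ∑ i ∈ s, ‖Z (e i)‖ ^ 2 ≤ 2 * ‖Φ‖ ^ 2 := by
  set S := ∑ i ∈ s, ‖Z (e i)‖ ^ 2
  set ψ : SymAlgC V := ∑ i ∈ s, gen (e i) * gen (Z (e i))
  have S_nonneg : 0 ≤ S := Finset.sum_nonneg fun _ _ => sq_nonneg _
  have cauchy_schwarz : S * ‖fockToDual Φ 1‖ ≤ ‖ψ‖ * ‖Φ‖ := by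
    have h := norm_inner_le_norm (𝕜 := ℂ) (toFock ψ) Φ
    rwa [← fockToDual_apply, hΦ.apply_sum_gen_mul_gen, norm_mul, Complex.norm_real,
      Real.norm_of_nonneg S_nonneg, LinearIsometry.norm_map] at h
  rcases S_nonneg.eq_or_lt with hS | hS
  · rw [← hS, mul_zero]; positivity
  · refine le_of_mul_le_mul_left ?_ hS
    calc S * (‖fockToDual Φ 1‖ ^ 2 * S) = (S * ‖fockToDual Φ 1‖) ^ 2 := by ring
      _ ≤ (‖ψ‖ * ‖Φ‖) ^ 2 := by gcongr
      _ = ‖ψ‖ ^ 2 * ‖Φ‖ ^ 2 := by ring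
      _ ≤ 2 * S * ‖Φ‖ ^ 2 := by gcongr; exact norm_sq_sum_gen_mul_gen_le hZ he s
      _ = S * (2 * ‖Φ‖ ^ 2) := by ring

variable [CompleteSpace V]

theorem norm_Zg_lt (g : SpGroup V) {x : V} (hx : x ≠ 0) : ‖Zg g x‖ < ‖x‖ := by
  obtain ⟨v, rfl⟩ := (bijective_Cg g⁻¹).2 x
  have Zg_Cg := Zg_inv_Cg g⁻¹ v
  rw [inv_inv] at Zg_Cg
  have hv : v ≠ 0 := fun hv => hx (by rw [hv, map_zero])
  have norm_sq_pos : 0 < ‖v‖ ^ 2 := by positivity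
  rw [Zg_Cg, norm_neg]
  refine lt_of_pow_lt_pow_left₀ 2 (norm_nonneg _) ?_
  linarith [norm_sq_Cg g⁻¹ v]

theorem norm_Zg_le (g : SpGroup V) (x : V) : ‖Zg g x‖ ≤ ‖x‖ := by
  rcases eq_or_ne x 0 with rfl | hx
  · rw [map_zero]
  · exact (norm_Zg_lt g hx).le

theorem continuous_Zg (g : SpGroup V) : Continuous (Zg g) :=
  AddMonoidHomClass.continuous_of_bound (Zg g) 1 fun x => by
    rw [one_mul]; exact norm_Zg_le g x

theorem Intertwines.isGaussianWith_map_one {g : SpGroup V} {U : SymAlgC V →ₗ[ℂ] Fock V}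
    (hU : Intertwines g U) : IsGaussianWith (Zg g⁻¹) (fockToDual (U 1)) := by
  refine isGaussianWith_iff.2 fun w θ => ?_
  obtain ⟨v, rfl⟩ := (bijective_Cg g).2 w
  rw [Zg_inv_Cg, annihilator_neg, LinearMap.neg_apply, map_neg]
  refine eq_neg_of_add_eq_zero_left ?_
  rw [← map_add]
  exact hU.inner_gen_mul_one v θ

theorem Intertwines.isHilbertSchmidt {g : SpGroup V} {U : SymAlgC V →ₗ[ℂ] Fock V}
    (hU : Intertwines g U) (hU_one : U 1 ≠ 0) : IsHilbertSchmidt (Zg g⁻¹) := by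
  have vacuum_ne_zero : fockToDual (U 1) 1 ≠ 0 := fun h => hU_one <|
    fockToDual_injective ((hU.isGaussianWith_map_one.eq_zero h).trans (map_zero fockToDual).symm)
  refine ⟨continuous_Zg g⁻¹, ?_⟩
  obtain ⟨w, b, -⟩ := exists_hilbertBasis ℂ V
  refine ⟨w, b, summable_of_sum_le (c := 2 * ‖U 1‖ ^ 2 / ‖fockToDual (U 1) 1‖ ^ 2)
    (fun _ => sq_nonneg _) fun s => ?_⟩
  rw [le_div_iff₀ (by positivity), mul_comm]
  exact hU.isGaussianWith_map_one.sum_norm_sq_le (inner_Zg g⁻¹) b.orthonormal s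

theorem IsUnitaryMetaplectic.isHilbertSchmidt {g : SpGroup V} {T : Fock V →L[ℂ] Fock V}
    (hT : IsUnitaryMetaplectic g T) : IsHilbertSchmidt (Zg g) := by
  obtain ⟨T_unitary, T_intertwines⟩ := (isUnitaryMetaplectic_iff g T).1 hT
  rw [← inv_inv g]
  refine T_intertwines.adjoint.isHilbertSchmidt fun adjoint_one => toFock_one_ne_zero (V := V) ?_
  rw [← adjoint_apply_apply (Unitary.star_mem T_unitary) (toFock 1)]
  exact (congrArg _ adjoint_one).trans (map_zero _)

end Necessity

/-! ### Functionals with geometric decay -/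

theorem exists_sqrt_succ_mul_pow_le {r : ℝ} (hr : 0 < r) (hr_lt : r < 1) :
    ∃ K r' : ℝ, 0 ≤ K ∧ 0 < r' ∧ r' < 1 ∧ ∀ n : ℕ, Real.sqrt (n + 1) * r ^ n ≤ K * r' ^ n := by
  obtain ⟨r', hrr', hr'_lt⟩ := exists_between hr_lt
  have hr' : 0 < r' := hr.trans hrr'
  have ratio_lt : |r / r'| < 1 := by rwa [abs_of_pos (by positivity), div_lt_one hr']
  obtain ⟨K, hK⟩ := ((tendsto_self_mul_const_pow_of_abs_lt_one ratio_lt).add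
    (tendsto_pow_atTop_nhds_zero_of_abs_lt_one ratio_lt)).bddAbove_range
  have bound (n : ℕ) : (n + 1) * (r / r') ^ n ≤ K := by
    rw [add_one_mul]
    exact hK ⟨n, rfl⟩
  refine ⟨K, r', le_trans (by positivity) (bound 0), hr', hr'_lt, fun n => ?_⟩
  have one_le : (1 : ℝ) ≤ n + 1 := le_add_of_nonneg_left n.cast_nonneg
  calc Real.sqrt (n + 1) * r ^ n ≤ (n + 1) * r ^ n := by
        gcongr
        exact Real.sqrt_le_self_iff.2 (Or.inr one_le)
    _ = (n + 1) * (r / r') ^ n * r' ^ n := by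
        rw [mul_assoc, ← mul_pow, div_mul_cancel₀ _ hr'.ne']
    _ ≤ K * r' ^ n := by gcongr; exact bound n

section Decay

variable {V : Type*} [NormedAddCommGroup V] [InnerProductSpace ℂ V]

/-- Functionals on `SV` whose homogeneous parts decay geometrically. Unlike Fock space, they are
stable under the creators and annihilators. -/
def GeomDecay (Φ : AntiDual V) : Prop :=
  ∃ M r : ℝ, 0 ≤ M ∧ 0 < r ∧ r < 1 ∧ ∀ n θ, ‖Φ (degPart n θ)‖ ≤ M * r ^ n * ‖θ‖

theorem GeomDecay.add {Φ Ψ : AntiDual V} (hΦ : GeomDecay Φ) (hΨ : GeomDecay Ψ) :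
    GeomDecay (Φ + Ψ) := by
  obtain ⟨M, r, hM, hr, hr_lt, hΦ⟩ := hΦ
  obtain ⟨M', r', hM', hr', hr'_lt, hΨ⟩ := hΨ
  refine ⟨M + M', max r r', by positivity, lt_max_of_lt_left hr, max_lt hr_lt hr'_lt,
    fun n θ => ?_⟩
  rw [LinearMap.add_apply, add_mul, add_mul]
  refine (norm_add_le _ _).trans (add_le_add ((hΦ n θ).trans ?_) ((hΨ n θ).trans ?_))
  · gcongr; exact le_max_left _ _
  · gcongr; exact le_max_right _ _

theorem GeomDecay.smul {Φ : AntiDual V} (c : ℂ) (hΦ : GeomDecay Φ) : GeomDecay (c • Φ) := by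
  obtain ⟨M, r, hM, hr, hr_lt, hΦ⟩ := hΦ
  refine ⟨‖c‖ * M, r, by positivity, hr, hr_lt, fun n θ => ?_⟩
  rw [LinearMap.smul_apply, norm_smul, mul_assoc, mul_assoc, ← mul_assoc M]
  gcongr
  exact hΦ n θ

theorem geomDecay_of_norm_le_sqrt_mul {Φ : AntiDual V} {M r : ℝ} (hM : 0 ≤ M) (hr : 0 < r)
    (hr_lt : r < 1) (hΦ : ∀ n θ, ‖Φ (degPart n θ)‖ ≤ M * (Real.sqrt (n + 1) * r ^ n) * ‖θ‖) :
    GeomDecay Φ := by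
  obtain ⟨K, r', hK, hr', hr'_lt, bound⟩ := exists_sqrt_succ_mul_pow_le hr hr_lt
  refine ⟨M * K, r', by positivity, hr', hr'_lt, fun n θ => (hΦ n θ).trans ?_⟩
  rw [mul_assoc M K]
  gcongr ?_ * ‖θ‖
  exact mul_le_mul_of_nonneg_left (bound n) hM

theorem GeomDecay.comp_annihilator {Φ : AntiDual V} (hΦ : GeomDecay Φ) (v : V) :
    GeomDecay (Φ.comp (annihilator v)) := by
  obtain ⟨M, r, hM, hr, hr_lt, hΦ⟩ := hΦ
  refine geomDecay_of_norm_le_sqrt_mul (M := M * ‖v‖ / r) (by positivity) hr hr_lt fun n θ => ?_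
  rw [LinearMap.comp_apply]
  rcases n with _ | n
  · rw [annihilator_degPart_zero, map_zero, norm_zero]; positivity
  · have homogeneous : degPart n (annihilator v (degPart (n + 1) θ)) =
        annihilator v (degPart (n + 1) θ) := by
      rw [annihilator_degPart_succ, degPart_degPart, if_pos rfl]
    calc ‖Φ (annihilator v (degPart (n + 1) θ))‖
        ≤ M * r ^ n * ‖annihilator v (degPart (n + 1) θ)‖ := by
          simpa only [homogeneous] using hΦ n (annihilator v (degPart (n + 1) θ))
      _ ≤ M * r ^ n * (Real.sqrt (n + 1 : ℕ) * ‖v‖ * ‖θ‖) := by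
        gcongr
        refine (norm_annihilator_degPart_le (n + 1) v θ).trans ?_
        gcongr
        exact norm_degPart_le _ θ
      _ = M * ‖v‖ / r * (Real.sqrt (n + 1 : ℕ) * r ^ (n + 1)) * ‖θ‖ := by
        rw [pow_succ]
        field_simp
      _ ≤ M * ‖v‖ / r * (Real.sqrt ((n + 1 : ℕ) + 1) * r ^ (n + 1)) * ‖θ‖ := by
        gcongr
        exact le_add_of_nonneg_right zero_le_one

theorem GeomDecay.comp_gen_mul {Φ : AntiDual V} (hΦ : GeomDecay Φ) (v : V) :
    GeomDecay (antiShift (gen v) Φ) := by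
  obtain ⟨M, r, hM, hr, hr_lt, hΦ⟩ := hΦ
  refine geomDecay_of_norm_le_sqrt_mul (M := M * r * ‖v‖) (by positivity) hr hr_lt fun n θ => ?_
  have homogeneous : degPart (n + 1) (gen v * degPart n θ) = gen v * degPart n θ := by
    rw [degPart_succ_gen_mul, degPart_degPart, if_pos rfl]
  calc ‖antiShift (gen v) Φ (degPart n θ)‖
      ≤ M * r ^ (n + 1) * ‖gen v * degPart n θ‖ := by
        simpa only [antiShift_apply, homogeneous] using hΦ (n + 1) (gen v * degPart n θ)
    _ ≤ M * r ^ (n + 1) * (Real.sqrt (n + 1) * ‖v‖ * ‖θ‖) := by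
        gcongr
        refine (norm_gen_mul_degPart_le n v θ).trans ?_
        gcongr
        exact norm_degPart_le n θ
    _ = M * r * ‖v‖ * (Real.sqrt (n + 1) * r ^ n) * ‖θ‖ := by ring

theorem exists_fockToDual_eq_of_bound {Φ : AntiDual V} {C : ℝ} (hΦ : ∀ θ, ‖Φ θ‖ ≤ C * ‖θ‖) :
    ∃ Ξ : Fock V, fockToDual Ξ = Φ := by
  let f : SymAlgC V →L[ℂ] ℂ := LinearMap.mkContinuous
    ((starLinearEquiv ℂ (A := ℂ)).toLinearMap.comp Φ) C fun θ => by simpa using hΦ θ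
  refine ⟨(InnerProductSpace.toDual ℂ (Fock V)).symm (f.extend toFock.toContinuousLinearMap),
    LinearMap.ext fun θ => ?_⟩
  have extend_toFock : f.extend toFock.toContinuousLinearMap (toFock θ) = f θ :=
    ContinuousLinearMap.extend_eq f denseRange_toFock toFock.isometry.isUniformInducing θ
  rw [fockToDual_apply, ← inner_conj_symm, InnerProductSpace.toDual_symm_apply, extend_toFock]
  exact Complex.conj_conj (Φ θ)

theorem GeomDecay.exists_fockToDual_eq {Φ : AntiDual V} (hΦ : GeomDecay Φ) :
    ∃ Ξ : Fock V, fockToDual Ξ = Φ := by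
  obtain ⟨M, r, hM, hr, hr_lt, hΦ⟩ := hΦ
  refine exists_fockToDual_eq_of_bound (C := M * (1 - r)⁻¹) fun θ => ?_
  obtain ⟨N, hN⟩ := exists_sum_degPart θ
  calc ‖Φ θ‖ = ‖∑ n ∈ Finset.range N, Φ (degPart n θ)‖ := by rw [← map_sum, hN N le_rfl]
    _ ≤ ∑ n ∈ Finset.range N, M * r ^ n * ‖θ‖ := norm_sum_le_of_le _ fun n _ => hΦ n θ
    _ = M * (∑ n ∈ Finset.range N, r ^ n) * ‖θ‖ := by rw [← Finset.sum_mul, ← Finset.mul_sum]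
    _ ≤ M * (1 - r)⁻¹ * ‖θ‖ := by
      gcongr
      rw [← tsum_geometric_of_lt_one hr.le hr_lt]
      exact (summable_geometric_of_lt_one hr.le hr_lt).sum_le_tsum _ fun _ _ => by positivity

end Decay

/-! ### Takagi factorization -/

section HilbertBasis

variable {𝕜 : Type*} [RCLike 𝕜] {E : Type*} [NormedAddCommGroup E] [InnerProductSpace 𝕜 E]

theorem hasSum_norm_inner_sq {ι : Type*} (b : HilbertBasis ι 𝕜 E) (x : E) :
    HasSum (fun i => ‖⟪b i, x⟫_𝕜‖ ^ 2) (‖x‖ ^ 2) := by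
  refine (RCLike.hasSum_ofReal 𝕜 (f := fun i => ‖⟪b i, x⟫_𝕜‖ ^ 2)).1 ?_
  simpa only [inner_self_eq_norm_sq_to_K, ← inner_conj_symm x (b _), RCLike.conj_mul,
    RCLike.ofReal_pow] using b.hasSum_inner_mul_inner x x

theorem summable_norm_sq_of_symm {Z : E → E} (hZ : ∀ x y, ⟪y, Z x⟫_𝕜 = ⟪x, Z y⟫_𝕜)
    {ι κ : Type*} (b : HilbertBasis ι 𝕜 E) (e : HilbertBasis κ 𝕜 E)
    (hb : Summable fun i => ‖Z (b i)‖ ^ 2) : Summable fun k => ‖Z (e k)‖ ^ 2 := by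
  have matrix_summable : Summable fun p : ι × κ => ‖⟪e p.2, Z (b p.1)⟫_𝕜‖ ^ 2 := by
    rw [summable_prod_of_nonneg fun _ => sq_nonneg _]
    refine ⟨fun i => (hasSum_norm_inner_sq e (Z (b i))).summable, ?_⟩
    simpa only [(hasSum_norm_inner_sq e (Z (b _))).tsum_eq] using hb
  have columns := (summable_prod_of_nonneg fun _ => sq_nonneg _).1 matrix_summable.prod_symm
  refine columns.2.congr fun k => ?_
  simp only [Prod.fst_swap, Prod.snd_swap, hZ _ (e k)]
  exact (hasSum_norm_inner_sq b (Z (e k))).tsum_eq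

variable {F : Type*} [NormedAddCommGroup F] [NormedSpace 𝕜 F] {σ : 𝕜 →+* 𝕜} [RingHomIsometric σ]

theorem norm_map_sub_sum_le {ι : Type*} (b : HilbertBasis ι 𝕜 E) (A : E →SL[σ] F) {S : ℝ}
    (hS : HasSum (fun i => ‖A (b i)‖ ^ 2) S) (t : Finset ι) (x : E) :
    ‖A x - ∑ i ∈ t, A (⟪b i, x⟫_𝕜 • b i)‖ ≤ Real.sqrt (S - ∑ i ∈ t, ‖A (b i)‖ ^ 2) * ‖x‖ := by
  classical
  have expansion : HasSum (fun i => A (⟪b i, x⟫_𝕜 • b i)) (A x) := by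
    simpa only [b.repr_apply_apply] using (b.hasSum_repr x).mapL A
  have tail := (expansion.sub_const (∑ i ∈ t, A (⟪b i, x⟫_𝕜 • b i))).norm
  refine le_of_tendsto tail ((Filter.eventually_ge_atTop t).mono fun u htu => ?_)
  rw [← Finset.sum_sdiff htu, add_sub_cancel_right]
  calc ‖∑ i ∈ u \ t, A (⟪b i, x⟫_𝕜 • b i)‖
      ≤ ∑ i ∈ u \ t, ‖A (b i)‖ * ‖⟪b i, x⟫_𝕜‖ :=
        norm_sum_le_of_le _ fun i _ => by
          rw [map_smulₛₗ, norm_smul, RingHomIsometric.norm_map, mul_comm]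
    _ ≤ Real.sqrt (∑ i ∈ u \ t, ‖A (b i)‖ ^ 2) * Real.sqrt (∑ i ∈ u \ t, ‖⟪b i, x⟫_𝕜‖ ^ 2) :=
        Real.sum_mul_le_sqrt_mul_sqrt _ _ _
    _ ≤ Real.sqrt (S - ∑ i ∈ t, ‖A (b i)‖ ^ 2) * ‖x‖ := by
        gcongr
        · rw [le_sub_iff_add_le, Finset.sum_sdiff htu]
          exact sum_le_hasSum u (fun _ _ => sq_nonneg _) hS
        · exact Real.sqrt_le_iff.2 ⟨norm_nonneg x,
            sum_le_hasSum _ (fun _ _ => sq_nonneg _) (hasSum_norm_inner_sq b x)⟩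

theorem isCompactOperator_of_summable_norm_sq [CompleteSpace F] {ι : Type*}
    (b : HilbertBasis ι 𝕜 E) (A : E →SL[σ] F) (hA : Summable fun i => ‖A (b i)‖ ^ 2) :
    IsCompactOperator A := by
  obtain ⟨S, hS⟩ := hA
  let P : Finset ι → E →L[𝕜] E := fun t =>
    ∑ i ∈ t, (ContinuousLinearMap.toSpanSingleton 𝕜 (b i)).comp (innerSL 𝕜 (b i))
  have P_apply (t : Finset ι) (x : E) : P t x = ∑ i ∈ t, ⟪b i, x⟫_𝕜 • b i := by
    simp [P]
  have P_compact (t : Finset ι) : IsCompactOperator (P t) :=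
    (sum_mem fun i _ => (isCompactOperator_of_locallyCompactSpace_rng
      (ContinuousLinearMap.toSpanSingleton 𝕜 (b i))).comp_clm (innerSL 𝕜 (b i)) :
      P t ∈ compactOperator (RingHom.id 𝕜) E E)
  have truncation_error (t : Finset ι) :
      ‖A.comp (P t) - A‖ ≤ Real.sqrt (S - ∑ i ∈ t, ‖A (b i)‖ ^ 2) :=
    ContinuousLinearMap.opNorm_le_bound _ (Real.sqrt_nonneg _) fun x => by
      simpa only [sub_apply, ContinuousLinearMap.comp_apply, P_apply, map_sum,
        norm_sub_rev] using norm_map_sub_sum_le b A hS t x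
  have tail_tendsto :
      Filter.Tendsto (fun t => Real.sqrt (S - ∑ i ∈ t, ‖A (b i)‖ ^ 2)) Filter.atTop (nhds 0) := by
    simpa using (hS.const_sub S).sqrt
  exact isCompactOperator_of_tendsto
    (tendsto_iff_norm_sub_tendsto_zero.2 <|
      squeeze_zero (fun _ => norm_nonneg _) truncation_error tail_tendsto)
    (.of_forall fun t => (P_compact t).clm_comp A)

theorem exists_mem_apply_eq_smul {T : E →L[𝕜] E} (hT : IsCompactOperator T)
    (hT_symm : T.IsSymmetric) {K : Submodule 𝕜 E} [CompleteSpace K] (hK : ∀ x ∈ K, T x ∈ K)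
    (hK_ne : K ≠ ⊥) : ∃ μ : 𝕜, ∃ y ∈ K, y ≠ 0 ∧ T y = μ • y := by
  by_contra! no_eigenvector
  have no_eigenspace (μ : 𝕜) :
      Module.End.eigenspace ((T.restrict hK : K →L[𝕜] K) : Module.End 𝕜 K) μ = ⊥ := by
    refine (Submodule.eq_bot_iff _).2 fun y hy => ?_
    by_contra hy_ne
    exact no_eigenvector μ y y.2 (mt Submodule.coe_eq_zero.1 hy_ne)
      (congrArg Subtype.val (Module.End.mem_eigenspace_iff.1 hy))
  have spectral_theorem := ContinuousLinearMap.orthogonalComplement_iSup_eigenspaces_eq_bot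
    (T := T.restrict hK) (hT.restrict' hK) (hT_symm.restrict_invariant hK)
  simp only [no_eigenspace, iSup_bot, Submodule.bot_orthogonal_eq_top] at spectral_theorem
  exact hK_ne (Submodule.subsingleton_iff_eq_bot.1
    ((Submodule.subsingleton_iff 𝕜).1 (subsingleton_of_bot_eq_top spectral_theorem.symm)))

theorem orthonormal_insert {s : Set E} (hs : Orthonormal 𝕜 (Subtype.val : s → E)) {x : E}
    (hx : ‖x‖ = 1) (hxs : ∀ y ∈ s, ⟪y, x⟫_𝕜 = 0) :
    Orthonormal 𝕜 (Subtype.val : ↥(insert x s) → E) := by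
  refine ⟨?_, ?_⟩
  · rintro ⟨y, rfl | hy⟩
    exacts [hx, hs.1 ⟨y, hy⟩]
  · rintro ⟨y, rfl | hy⟩ ⟨z, rfl | hz⟩ hyz
    · exact absurd rfl hyz
    · exact inner_eq_zero_symm.1 (hxs z hz)
    · exact hxs y hy
    · exact hs.2 (i := ⟨y, hy⟩) (j := ⟨z, hz⟩) fun h => hyz (Subtype.ext (Subtype.mk.inj h))

theorem exists_hilbertBasis_forall [CompleteSpace E] {P : E → Prop}
    (hP : ∀ s : Set E, (∀ x ∈ s, P x) → (Submodule.span 𝕜 s)ᗮ ≠ ⊥ →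
      ∃ x ∈ (Submodule.span 𝕜 s)ᗮ, ‖x‖ = 1 ∧ P x) :
    ∃ (s : Set E) (e : HilbertBasis s 𝕜 E), ∀ i, P (e i) := by
  obtain ⟨s, hs⟩ := zorn_subset
    {s : Set E | Orthonormal 𝕜 (Subtype.val : s → E) ∧ ∀ x ∈ s, P x} fun c hc hchain =>
      ⟨⋃₀ c, ⟨orthonormal_sUnion_of_directed hchain.directedOn fun a ha => (hc ha).1,
        fun x ⟨a, ha, hx⟩ => (hc ha).2 x hx⟩, fun _ => Set.subset_sUnion_of_mem⟩
  have complement_trivial : (Submodule.span 𝕜 s)ᗮ = ⊥ := by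
    by_contra hne
    obtain ⟨x, hx, hx_norm, hx_P⟩ := hP s hs.prop.2 hne
    have orthogonal : ∀ y ∈ s, ⟪y, x⟫_𝕜 = 0 := fun y hy => hx y (Submodule.subset_span hy)
    have x_mem : x ∈ s := hs.le_of_ge (y := insert x s)
      ⟨orthonormal_insert hs.prop.1 hx_norm orthogonal, Set.forall_mem_insert.2 ⟨hx_P, hs.prop.2⟩⟩
      (Set.subset_insert x s) (Set.mem_insert x s)
    rw [inner_self_eq_zero.1 (orthogonal x x_mem), norm_zero] at hx_norm
    exact zero_ne_one hx_norm
  refine ⟨s, .mkOfOrthogonalEqBot hs.prop.1 (by rwa [Subtype.range_coe]), fun i => ?_⟩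
  rw [HilbertBasis.coe_mkOfOrthogonalEqBot]
  exact hs.prop.2 i i.2

end HilbertBasis

section Takagi

variable {V : Type*} [NormedAddCommGroup V] [InnerProductSpace ℂ V]

/-- The vectors on which an antilinear map acts by a nonnegative real number: the antilinear
counterpart of eigenvectors, as a phase change of the vector makes any eigenvalue nonnegative. -/
def IsTakagi (Z : V →ₗ⋆[ℂ] V) (x : V) : Prop := ∃ l : ℝ, 0 ≤ l ∧ Z x = (l : ℂ) • x

theorem IsTakagi.smul {Z : V →ₗ⋆[ℂ] V} {x : V} (hx : IsTakagi Z x) (r : ℝ) :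
    IsTakagi Z ((r : ℂ) • x) := by
  obtain ⟨l, hl, hx⟩ := hx
  exact ⟨l, hl, by rw [map_smulₛₗ, hx, Complex.conj_ofReal, smul_comm]⟩

theorem exists_isTakagi_of_sq {Z : V →ₗ⋆[ℂ] V} {K : Submodule ℂ V} (hK : ∀ x ∈ K, Z x ∈ K)
    {x : V} (hx : x ∈ K) (hx_ne : x ≠ 0) {l : ℝ} (hl : 0 ≤ l)
    (hZx : Z (Z x) = (l : ℂ) • (l : ℂ) • x) : ∃ y ∈ K, y ≠ 0 ∧ IsTakagi Z y := by
  by_cases hsum : Z x + (l : ℂ) • x = 0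
  · refine ⟨Complex.I • x, K.smul_mem _ hx, smul_ne_zero Complex.I_ne_zero hx_ne, l, hl, ?_⟩
    rw [map_smulₛₗ, eq_neg_of_add_eq_zero_left hsum, Complex.conj_I, neg_smul_neg, smul_comm]
  · refine ⟨_, K.add_mem (hK x hx) (K.smul_mem _ hx), hsum, l, hl, ?_⟩
    rw [map_add, map_smulₛₗ, Complex.conj_ofReal, hZx, smul_add, add_comm]

theorem eigenvalue_sq_eq {Z : V →ₗ⋆[ℂ] V} (hZ : ∀ x y, ⟪y, Z x⟫_ℂ = ⟪x, Z y⟫_ℂ) {y : V}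
    (hy : y ≠ 0) {μ : ℂ} (hμ : Z (Z y) = μ • y) : μ = ((‖Z y‖ / ‖y‖ : ℝ) : ℂ) ^ 2 := by
  have norm_ne : (‖y‖ : ℂ) ≠ 0 := by simpa using hy
  have norm_sq : (‖Z y‖ : ℂ) ^ 2 = μ * (‖y‖ : ℂ) ^ 2 := by
    have symmetry := hZ (Z y) y
    rw [hμ, inner_smul_right] at symmetry
    rw [inner_self_eq_norm_sq_to_K, inner_self_eq_norm_sq_to_K] at symmetry
    exact symmetry.symm
  push_cast
  field_simp
  exact norm_sq.symm

theorem exists_norm_eq_one_isTakagi {Z : V →L⋆[ℂ] V} (hZ : ∀ x y, ⟪y, Z x⟫_ℂ = ⟪x, Z y⟫_ℂ)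
    (hZ_compact : IsCompactOperator Z) {K : Submodule ℂ V} [CompleteSpace K]
    (hK : ∀ x ∈ K, Z x ∈ K) (hK_ne : K ≠ ⊥) :
    ∃ y ∈ K, ‖y‖ = 1 ∧ IsTakagi (Z : V →ₗ⋆[ℂ] V) y := by
  have sq_symm : (Z.comp Z : V →L[ℂ] V).IsSymmetric := fun x y => by
    rw [← inner_conj_symm]
    exact (congrArg _ (hZ (Z x) y)).trans ((inner_conj_symm _ _).trans (hZ (Z y) x).symm)
  obtain ⟨μ, x, hxK, hx_ne, hx⟩ := exists_mem_apply_eq_smul (hZ_compact.clm_comp Z) sq_symm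
    (fun x hx => hK _ (hK x hx)) hK_ne
  obtain ⟨y, hyK, hy_ne, hy⟩ := exists_isTakagi_of_sq (Z := (Z : V →ₗ⋆[ℂ] V)) hK hxK hx_ne
    (div_nonneg (norm_nonneg (Z x)) (norm_nonneg x))
    (hx.trans (by
      rw [smul_smul, ← sq]
      exact congrArg (· • x) (eigenvalue_sq_eq hZ hx_ne hx)))
  refine ⟨((‖y‖⁻¹ : ℝ) : ℂ) • y, K.smul_mem _ hyK, ?_, hy.smul _⟩
  rw [norm_smul, Complex.norm_real, norm_inv, norm_norm, inv_mul_cancel₀ (norm_ne_zero_iff.2 hy_ne)]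

theorem orthogonal_span_invariant {Z : V →ₗ⋆[ℂ] V} (hZ : ∀ x y, ⟪y, Z x⟫_ℂ = ⟪x, Z y⟫_ℂ)
    {s : Set V} (hs : ∀ x ∈ s, IsTakagi Z x) {x : V} (hx : x ∈ (Submodule.span ℂ s)ᗮ) :
    Z x ∈ (Submodule.span ℂ s)ᗮ := by
  suffices span_le : Submodule.span ℂ s ≤ (ℂ ∙ Z x)ᗮ from
    fun u hu => Submodule.mem_orthogonal_singleton_iff_inner_left.1 (span_le hu)
  refine Submodule.span_le.2 fun u hu => ?_
  obtain ⟨l, -, hl⟩ := hs u hu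
  rw [SetLike.mem_coe, Submodule.mem_orthogonal_singleton_iff_inner_left, hZ, hl, inner_smul_right,
    Submodule.inner_left_of_mem_orthogonal (Submodule.subset_span hu) hx, mul_zero]

variable [CompleteSpace V]

theorem exists_takagi_basis {Z : V →ₗ⋆[ℂ] V} (hZ : ∀ x y, ⟪y, Z x⟫_ℂ = ⟪x, Z y⟫_ℂ)
    (hHS : IsHilbertSchmidt Z) : ∃ (s : Set V) (e : HilbertBasis s ℂ V) (l : s → ℝ),
      (∀ i, 0 ≤ l i) ∧ (∀ i, Z (e i) = (l i : ℂ) • e i) ∧ Summable fun i => l i ^ 2 := by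
  obtain ⟨hZ_cont, t, b, hb⟩ := hHS
  have hZ_compact := isCompactOperator_of_summable_norm_sq b (⟨Z, hZ_cont⟩ : V →L⋆[ℂ] V) hb
  obtain ⟨s, e, he⟩ := exists_hilbertBasis_forall (𝕜 := ℂ) (P := IsTakagi Z) fun s hs =>
    exists_norm_eq_one_isTakagi hZ hZ_compact fun _ => orthogonal_span_invariant hZ hs
  choose l hl he using he
  refine ⟨s, e, l, hl, he, (summable_norm_sq_of_symm hZ b e hb).congr fun i => ?_⟩
  rw [he, norm_smul, e.orthonormal.1 i, mul_one, Complex.norm_real, Real.norm_of_nonneg (hl i)]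

end Takagi

/-! ### Series and infinite products -/

section Series

theorem add_one_mul_ringChoose_succ {R : Type*} [CommRing R] [BinomialRing R] (r : R) (k : ℕ) :
    (k + 1) * Ring.choose r (k + 1) = (r - k) * Ring.choose r k := by
  have cast_smeval : (k : Polynomial ℤ).smeval r = (k : R) := by
    rw [Polynomial.smeval_natCast, pow_zero, nsmul_one]
  have := BinomialRing.toIsAddTorsionFree (R := R)
  refine nsmul_right_injective (Nat.factorial_ne_zero k) ?_
  dsimp only
  calc k.factorial • ((k + 1) * Ring.choose r (k + 1))
      = (k + 1).factorial • Ring.choose r (k + 1) := by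
        simp only [Nat.factorial_succ, nsmul_eq_mul]
        push_cast
        ring
    _ = k.factorial • ((r - k) * Ring.choose r k) := by
        rw [← Ring.descPochhammer_eq_factorial_smul_choose, descPochhammer_succ_right,
          Polynomial.smeval_mul, Ring.descPochhammer_eq_factorial_smul_choose,
          Polynomial.smeval_sub, Polynomial.smeval_X, cast_smeval, pow_one, smul_mul_assoc,
          mul_comm]

/-- The coefficients `n! [xⁿ] exp (l x² / 2)`, the values of a one-dimensional Gaussian functional
on powers of the coordinate. -/
def gaussCoeff (l : ℝ) : ℕ → ℝ
  | 0 => 1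
  | 1 => 0
  | n + 2 => (n + 1) * l * gaussCoeff l n

theorem gaussCoeff_add_two (l : ℝ) (n : ℕ) :
    gaussCoeff l (n + 2) = (n + 1) * l * gaussCoeff l n := rfl

theorem gaussCoeff_odd (l : ℝ) (k : ℕ) : gaussCoeff l (2 * k + 1) = 0 := by
  induction k with
  | zero => rfl
  | succ k ih => rw [mul_add_one, add_right_comm, gaussCoeff_add_two, ih, mul_zero]

theorem gaussCoeff_even_sq (l : ℝ) (k : ℕ) : gaussCoeff l (2 * k) ^ 2 / ((2 * k).factorial : ℝ) =
    Ring.choose (-1 / 2 : ℝ) k * (-l ^ 2) ^ k := by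
  induction k with
  | zero => simp [gaussCoeff]
  | succ k ih =>
    have choose_succ : Ring.choose (-1 / 2 : ℝ) (k + 1) =
        (-1 / 2 - k) / (k + 1) * Ring.choose (-1 / 2 : ℝ) k := by
      rw [div_mul_eq_mul_div, eq_div_iff (by positivity), mul_comm, add_one_mul_ringChoose_succ]
    have ratio : gaussCoeff l (2 * (k + 1)) ^ 2 / ((2 * (k + 1)).factorial : ℝ) =
        (2 * k + 1) / (2 * k + 2) * l ^ 2 *
          (gaussCoeff l (2 * k) ^ 2 / ((2 * k).factorial : ℝ)) := by
      rw [mul_add_one, gaussCoeff_add_two, Nat.factorial_succ, Nat.factorial_succ]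
      push_cast
      field_simp
      ring
    rw [ratio, ih, choose_succ, pow_succ]
    field_simp
    ring

theorem hasSum_gaussCoeff {l : ℝ} (hl : |l| < 1) :
    HasSum (fun n => gaussCoeff l n ^ 2 / (n.factorial : ℝ)) ((1 - l ^ 2) ^ (-1 / 2 : ℝ)) := by
  have binomial := (Real.one_add_rpow_hasFPowerSeriesOnBall_zero (a := -1 / 2)).hasSum
    (y := -l ^ 2) (by simpa [Metric.mem_eball, edist_dist] using hl)
  have even : HasSum (fun k => gaussCoeff l (2 * k) ^ 2 / ((2 * k).factorial : ℝ))
      ((1 - l ^ 2) ^ (-1 / 2 : ℝ)) := by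
    simpa only [gaussCoeff_even_sq, zero_add, sub_eq_add_neg, binomialSeries_apply,
      List.ofFn_const, List.prod_replicate, smul_eq_mul] using binomial
  have odd : HasSum (fun k => gaussCoeff l (2 * k + 1) ^ 2 / ((2 * k + 1).factorial : ℝ)) 0 := by
    simp [gaussCoeff_odd, hasSum_zero]
  simpa only [add_zero] using
    HasSum.even_add_odd (f := fun n => gaussCoeff l n ^ 2 / (n.factorial : ℝ)) even odd

end Series

section FinsuppProd

variable {ι : Type*}

theorem sum_finsupp_prod {R : Type*} [CommSemiring R] (s : Finset ι) (t : ι → Finset ℕ)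
    {f : ι → ℕ → R} (hf_zero : ∀ i, f i 0 = 1) :
    ∑ α ∈ s.finsupp t, α.prod f = ∏ i ∈ s, ∑ n ∈ t i, f i n := by
  classical
  have prod_eq : ∀ α ∈ s.finsupp t, α.prod f = ∏ i ∈ s, f i (α i) := fun α hα =>
    Finsupp.prod_of_support_subset α (Finset.mem_finsupp_iff.1 hα).1 f fun i _ => hf_zero i
  rw [Finset.sum_congr rfl prod_eq, Finset.prod_sum, Finset.finsupp, Finset.sum_map]
  refine Finset.sum_congr rfl fun p _ => ?_
  rw [← Finset.prod_attach]
  refine Finset.prod_congr rfl fun i _ => ?_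
  simp [Finsupp.indicator_apply]

theorem prod_le_of_hasProd {x : ι → ℝ} {P : ℝ} (hx : ∀ i, 1 ≤ x i) (hP : HasProd x P)
    (s : Finset ι) : ∏ i ∈ s, x i ≤ P :=
  ge_of_tendsto hP <| (Filter.eventually_ge_atTop s).mono fun _ hst =>
    Finset.prod_le_prod_of_subset_of_one_le hst (fun i _ => zero_le_one.trans (hx i))
      fun i _ _ => hx i

theorem sum_prod_le_of_hasProd {f : ι → ℕ → ℝ} (hf : ∀ i n, 0 ≤ f i n)
    (hf_zero : ∀ i, f i 0 = 1) {x : ι → ℝ} (hx : ∀ i, HasSum (f i) (x i)) {P : ℝ}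
    (hP : HasProd x P) (A : Finset (ι →₀ ℕ)) : ∑ α ∈ A, α.prod f ≤ P := by
  classical
  have one_le (i : ι) : 1 ≤ x i := hf_zero i ▸ le_hasSum (hx i) 0 fun n _ => hf i n
  let s : Finset ι := A.biUnion Finsupp.support
  let N : ℕ := A.sup fun α => s.sup α
  have subset_box : A ⊆ s.finsupp fun _ => Finset.range (N + 1) := fun α hα => by
    refine Finset.mem_finsupp_iff.2
      ⟨Finset.subset_biUnion_of_mem Finsupp.support hα, fun i hi => ?_⟩
    rw [Finset.mem_range, Nat.lt_succ_iff]
    exact (Finset.le_sup (f := α) hi).trans (Finset.le_sup (f := fun α : ι →₀ ℕ => s.sup α) hα)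
  calc ∑ α ∈ A, α.prod f
      ≤ ∑ α ∈ s.finsupp fun _ => Finset.range (N + 1), α.prod f :=
        Finset.sum_le_sum_of_subset_of_nonneg subset_box fun α _ _ =>
          Finset.prod_nonneg fun i _ => hf i _
    _ = ∏ i ∈ s, ∑ n ∈ Finset.range (N + 1), f i n := sum_finsupp_prod s _ hf_zero
    _ ≤ ∏ i ∈ s, x i := Finset.prod_le_prod (fun i _ => Finset.sum_nonneg fun n _ => hf i n)
        fun i _ => sum_le_hasSum _ (fun n _ => hf i n) (hx i)
    _ ≤ P := prod_le_of_hasProd one_le hP s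

theorem hasSum_finsupp_prod {f : ι → ℕ → ℝ} (hf : ∀ i n, 0 ≤ f i n) (hf_zero : ∀ i, f i 0 = 1)
    {x : ι → ℝ} (hx : ∀ i, HasSum (f i) (x i)) {P : ℝ} (hP : HasProd x P) :
    HasSum (fun α : ι →₀ ℕ => α.prod f) P := by
  classical
  refine hasSum_of_isLUB_of_nonneg P (fun α => Finset.prod_nonneg fun i _ => hf i _)
    ⟨Set.forall_mem_range.2 (sum_prod_le_of_hasProd hf hf_zero hx hP), fun b hb => ?_⟩
  refine le_of_tendsto hP (.of_forall fun s => ?_)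
  have partial_prod : Filter.Tendsto (fun N => ∏ i ∈ s, ∑ n ∈ Finset.range N, f i n) Filter.atTop
      (nhds (∏ i ∈ s, x i)) := tendsto_finsetProd _ fun i _ => (hx i).tendsto_sum_nat
  refine le_of_tendsto partial_prod (.of_forall fun N => ?_)
  rw [← sum_finsupp_prod s _ hf_zero]
  exact hb ⟨_, rfl⟩

theorem prod_add_single {R : Type*} [CommMonoid R] {f : ι → ℕ → R} (hf_zero : ∀ i, f i 0 = 1)
    (α : ι →₀ ℕ) (i : ι) :
    (α + Finsupp.single i 1).prod f = f i (α i + 1) * (α.erase i).prod f := by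
  classical
  rw [← Finsupp.mul_prod_erase' _ i f hf_zero]
  congr 2
  · simp
  · ext j
    by_cases hj : j = i
    · subst hj; simp
    · simp [hj]

theorem exists_hasProd_one_sub_sq {l : ι → ℝ} (hl : ∀ i, l i ^ 2 < 1)
    (hs : Summable fun i => l i ^ 2) : ∃ D : ℝ, 0 < D ∧ HasProd (fun i => 1 - l i ^ 2) D ∧
      ∀ a : ℝ, HasProd (fun i => (1 - l i ^ 2) ^ a) (D ^ a) := by
  have pos (i : ι) : 0 < 1 - l i ^ 2 := sub_pos.2 (hl i)
  have summable_log : Summable fun i => Real.log (1 - l i ^ 2) := by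
    simpa only [sub_eq_add_neg] using Real.summable_log_one_add_of_summable hs.neg
  refine ⟨Real.exp (∑' i, Real.log (1 - l i ^ 2)), Real.exp_pos _,
    Real.hasProd_of_hasSum_log pos summable_log.hasSum, fun a => ?_⟩
  rw [← Real.exp_mul]
  refine Real.hasProd_of_hasSum_log (fun i => Real.rpow_pos_of_pos (pos i) _) ?_
  simpa only [Real.log_rpow (pos _), mul_comm] using summable_log.hasSum.mul_right a

end FinsuppProd

/-! ### Monomials in an orthonormal basis -/

section MultiIndex

variable {ι : Type*}

theorem multiIndex_induction {P : (ι →₀ ℕ) → Prop} (zero : P 0)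
    (add_single : ∀ α i, P α → P (α + Finsupp.single i 1)) (α : ι →₀ ℕ) : P α := by
  suffices add : ∀ β, P β → P (β + α) from zero_add α ▸ add 0 zero
  induction α using Finsupp.induction_linear with
  | zero => exact fun β hβ => (add_zero β).symm ▸ hβ
  | add α γ hα hγ => exact fun β hβ => add_assoc β α γ ▸ hγ _ (hα β hβ)
  | single i n =>
    induction n with
    | zero => exact fun β hβ => by rwa [Finsupp.single_zero, add_zero]
    | succ n ih =>
      intro β hβ
      rw [Finsupp.single_add, ← add_assoc]
      exact add_single _ i (ih β hβ)

theorem exists_eq_add_single {α : ι →₀ ℕ} {i : ι} (hα : α i ≠ 0) :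
    ∃ β, α = β + Finsupp.single i 1 := by
  classical
  exact ⟨_, (sub_single_add hα).symm⟩

/-- The product `α!` of the factorials of the entries of a multi-index. -/
def multiFact (α : ι →₀ ℕ) : ℝ := α.prod fun _ n => (n.factorial : ℝ)

theorem multiFact_pos (α : ι →₀ ℕ) : 0 < multiFact α :=
  Finset.prod_pos fun _ _ => by positivity

theorem multiFact_add_single (α : ι →₀ ℕ) (i : ι) :
    multiFact (α + Finsupp.single i 1) = (α i + 1) * multiFact α := by
  rw [multiFact, prod_add_single (by simp), multiFact,
    ← Finsupp.mul_prod_erase' α i (fun _ n => (n.factorial : ℝ)) (by simp), Nat.factorial_succ]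
  push_cast
  ring

/-- The moment of order `α` of the Gaussian functional that is diagonal with eigenvalues `l i`. -/
def gaussMoment (l : ι → ℝ) (α : ι →₀ ℕ) : ℝ := α.prod fun i n => gaussCoeff (l i) n

theorem gaussMoment_add_single (l : ι → ℝ) (α : ι →₀ ℕ) (i : ι) :
    gaussMoment l (α + Finsupp.single i 1) =
      l i * (α i * gaussMoment l (α - Finsupp.single i 1)) := by
  classical
  have one_prod : (α + Finsupp.single i 1).prod (fun i n => gaussCoeff (l i) n) =
      gaussCoeff (l i) (α i + 1) * (α.erase i).prod fun i n => gaussCoeff (l i) n :=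
    prod_add_single (fun _ => rfl) α i
  rw [gaussMoment, one_prod]
  by_cases hα : α i = 0
  · rw [hα, zero_add, gaussCoeff, zero_mul, Nat.cast_zero, zero_mul, mul_zero]
  · obtain ⟨β, rfl⟩ := exists_eq_add_single hα
    have erase_eq : (β + Finsupp.single i 1).erase i = β.erase i := by
      ext j
      by_cases hj : j = i
      · subst hj; simp
      · simp [hj]
    rw [add_tsub_cancel_right, erase_eq, gaussMoment,
      ← Finsupp.mul_prod_erase' β i (fun i n => gaussCoeff (l i) n) fun _ => rfl,
      Finsupp.add_apply, Finsupp.single_eq_same, gaussCoeff_add_two]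
    push_cast
    ring

theorem hasSum_gaussMoment_sq {l : ι → ℝ} (hl : ∀ i, |l i| < 1) {P : ℝ}
    (hP : HasProd (fun i => (1 - l i ^ 2) ^ (-1 / 2 : ℝ)) P) :
    HasSum (fun α => gaussMoment l α ^ 2 / multiFact α) P := by
  have hasSum_prod := hasSum_finsupp_prod
    (f := fun i n => gaussCoeff (l i) n ^ 2 / (n.factorial : ℝ)) (fun i n => by positivity)
    (fun i => by simp [gaussCoeff]) (fun i => hasSum_gaussCoeff (hl i)) hP
  simpa only [gaussMoment, multiFact, Finsupp.prod, Finset.prod_div_distrib,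
    Finset.prod_pow] using hasSum_prod

end MultiIndex

section HilbertBasis

variable {𝕜 E ι : Type*} [RCLike 𝕜] [NormedAddCommGroup E] [InnerProductSpace 𝕜 E]

theorem hilbertBasis_induction (b : HilbertBasis ι 𝕜 E) {P : E → Prop}
    (isClosed : IsClosed {x | P x}) (zero : P 0) (add : ∀ x y, P x → P y → P (x + y))
    (smul : ∀ (r : 𝕜) x, P x → P (r • x)) (basis : ∀ i, P (b i)) (x : E) : P x := by
  have span_subset : (Submodule.span 𝕜 (Set.range b) : Set E) ⊆ {x | P x} := fun y hy => by
    induction hy using Submodule.span_induction with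
    | mem y hy => obtain ⟨i, rfl⟩ := hy; exact basis i
    | zero => exact zero
    | add y z _ _ hy hz => exact add y z hy hz
    | smul r y _ hy => exact smul r y hy
  exact closure_minimal span_subset isClosed
    (Submodule.dense_iff_topologicalClosure_eq_top.2 b.dense_span x)

theorem exists_forall_inner_eq (b : HilbertBasis ι 𝕜 E) {c : ι → 𝕜}
    (hc : Summable fun i => ‖c i‖ ^ 2) : ∃ x : E, ∀ i, inner 𝕜 (b i) x = c i := by
  have memℓp : Memℓp c 2 := memℓp_gen <| by
    simpa only [ENNReal.toReal_ofNat, Real.rpow_two] using hc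
  exact ⟨b.repr.symm ⟨c, memℓp⟩, fun i => by
    rw [← b.repr_apply_apply, LinearIsometryEquiv.apply_symm_apply]⟩

end HilbertBasis

section Monomials

variable {V : Type*} [NormedAddCommGroup V] [InnerProductSpace ℂ V] {ι : Type*}

/-- The monomial `e^α` in the vectors `e i`. -/
def mono (e : ι → V) (α : ι →₀ ℕ) : SymAlgC V := monom e (MvPolynomial.monomial α 1)

theorem monom_monomial (e : ι → V) (α : ι →₀ ℕ) (c : ℂ) :
    monom e (MvPolynomial.monomial α c) = c • mono e α := by
  rw [mono, ← map_smul, MvPolynomial.smul_monomial, smul_eq_mul, mul_one]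

theorem monom_X_mul (e : ι → V) (i : ι) (P : MvPolynomial ι ℂ) :
    monom e (MvPolynomial.X i * P) = gen (e i) * monom e P := by
  rw [map_mul, monom, MvPolynomial.aeval_X]

theorem mono_zero (e : ι → V) : mono e 0 = 1 := map_one (monom e)

theorem mono_add_single (e : ι → V) (α : ι →₀ ℕ) (i : ι) :
    mono e (α + Finsupp.single i 1) = gen (e i) * mono e α := monom_monomial_add e i α

theorem annihilator_mono {e : ι → V} (he : Orthonormal ℂ e) (α : ι →₀ ℕ) (i : ι) :
    annihilator (e i) (mono e α) = (α i : ℂ) • mono e (α - Finsupp.single i 1) := by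
  classical
  rw [mono, annihilator_monom he, MvPolynomial.pderiv_monomial, one_mul, monom_monomial]

theorem degPart_mono (e : ι → V) (n : ℕ) (α : ι →₀ ℕ) :
    degPart n (mono e α) = if n = α.degree then mono e α else 0 := by
  induction α using multiIndex_induction generalizing n with
  | zero => rw [mono_zero, degPart_one, map_zero]
  | add_single α i ih =>
    rw [mono_add_single, map_add, Finsupp.degree_single]
    rcases n with _ | n
    · rw [degPart_zero_gen_mul, if_neg (Nat.succ_ne_zero _).symm]
    · simp only [degPart_succ_gen_mul, ih, mul_ite, mul_zero, add_left_inj]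

theorem degPart_monom (e : ι → V) (n : ℕ) (P : MvPolynomial ι ℂ) :
    degPart n (monom e P) = monom e (MvPolynomial.homogeneousComponent n P) := by
  induction P using MvPolynomial.induction_on' with
  | monomial α c =>
    rw [monom_monomial, map_smul, degPart_mono,
      MvPolynomial.homogeneousComponent_of_mem (MvPolynomial.isHomogeneous_monomial c rfl),
      smul_ite, smul_zero, apply_ite (monom e), map_zero, monom_monomial]
  | add P Q hP hQ => simp only [map_add, hP, hQ]

theorem inner_one_mono (e : ι → V) {β : ι →₀ ℕ} (hβ : β ≠ 0) :
    ⟪(1 : SymAlgC V), mono e β⟫_ℂ = 0 := by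
  obtain ⟨i, hi⟩ := Finsupp.ne_iff.1 hβ
  obtain ⟨γ, rfl⟩ := exists_eq_add_single hi
  rw [mono_add_single, inner_gen_mul_right, annihilator_one, inner_zero_left]

theorem inner_mono_mono {e : ι → V} (he : Orthonormal ℂ e) [DecidableEq ι] (α β : ι →₀ ℕ) :
    ⟪mono e α, mono e β⟫_ℂ = if α = β then (multiFact α : ℂ) else 0 := by
  induction α using multiIndex_induction generalizing β with
  | zero =>
    rw [mono_zero]
    split_ifs with hβ
    · rw [← hβ, mono_zero, inner_one_one, multiFact, Finsupp.prod_zero_index, Complex.ofReal_one]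
    · exact inner_one_mono e (Ne.symm hβ)
  | add_single α i ih =>
    rw [mono_add_single, inner_gen_mul_left, annihilator_mono he, inner_smul_right, ih]
    by_cases hβ : β i = 0
    · have ne : α + Finsupp.single i 1 ≠ β := fun h => by simp [← h] at hβ
      rw [if_neg ne, hβ, Nat.cast_zero, zero_mul]
    · obtain ⟨γ, rfl⟩ := exists_eq_add_single hβ
      rw [add_tsub_cancel_right]
      by_cases hαγ : α = γ
      · subst hαγ
        simp [multiFact_add_single]
      · rw [if_neg hαγ, if_neg fun h => hαγ (add_right_cancel h), mul_zero]

end Monomials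

section Density

variable {V : Type*} [NormedAddCommGroup V] [InnerProductSpace ℂ V] {ι : Type*}

theorem continuous_gen_mul_degPart (w : V) (n : ℕ) :
    Continuous fun θ : SymAlgC V => gen w * degPart n θ :=
  AddMonoidHomClass.continuous_of_bound
    ((LinearMap.mulLeft ℂ (gen w)) ∘ₗ degPart n : SymAlgC V →ₗ[ℂ] SymAlgC V)
    (Real.sqrt (n + 1) * ‖w‖) fun θ =>
      (norm_gen_mul_degPart_le n w θ).trans (by gcongr; exact norm_degPart_le n θ)

theorem continuous_annihilator_degPart (w : V) (n : ℕ) :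
    Continuous fun θ : SymAlgC V => annihilator w (degPart n θ) :=
  AddMonoidHomClass.continuous_of_bound
    (annihilator w ∘ₗ degPart n : SymAlgC V →ₗ[ℂ] SymAlgC V)
    (Real.sqrt n * ‖w‖) fun θ =>
      (norm_annihilator_degPart_le n w θ).trans (by gcongr; exact norm_degPart_le n θ)

theorem continuous_gen_mul_degPart_left (n : ℕ) (θ : SymAlgC V) :
    Continuous fun w : V => gen w * degPart n θ :=
  AddMonoidHomClass.continuous_of_bound
    ((LinearMap.mulRight ℂ (degPart n θ)) ∘ₗ SymmetricAlgebra.ι ℂ V : V →ₗ[ℂ] SymAlgC V)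
    (Real.sqrt (n + 1) * ‖degPart n θ‖) fun w =>
      (norm_gen_mul_degPart_le n w θ).trans_eq (by ring)

/-- The action `v ↦ annihilator v θ` of the annihilators on a fixed element, as an antilinear
map. -/
def annihilatorMap (θ : SymAlgC V) : V →ₗ⋆[ℂ] SymAlgC V where
  toFun v := annihilator v θ
  map_add' v w := by rw [annihilator_add]; rfl
  map_smul' r v := by rw [annihilator_smul]; rfl

theorem continuous_annihilatorMap_degPart (n : ℕ) (θ : SymAlgC V) :
    Continuous (annihilatorMap (degPart n θ)) :=
  AddMonoidHomClass.continuous_of_bound (annihilatorMap (degPart n θ))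
    (Real.sqrt n * ‖degPart n θ‖) fun w =>
      (norm_annihilator_degPart_le n w θ).trans_eq (by ring)

theorem gen_zero : (gen (0 : V) : SymAlgC V) = 0 := map_zero _

theorem gen_mul_degPart_monom_mem (e : HilbertBasis ι ℂ V) (w : V) (n : ℕ)
    (P : MvPolynomial ι ℂ) : gen w * degPart n (monom e P) ∈
      (LinearMap.range (monom e).toLinearMap).topologicalClosure := by
  refine hilbertBasis_induction e (P := fun w => gen w * degPart n (monom e P) ∈
    (LinearMap.range (monom e).toLinearMap).topologicalClosure)
    ((Submodule.isClosed_topologicalClosure _).preimage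
      (continuous_gen_mul_degPart_left n _)) ?_ (fun v w hv hw => ?_) (fun r v hv => ?_)
    (fun i => ?_) w
  · rw [gen_zero, zero_mul]
    exact zero_mem _
  · rw [gen_add, add_mul]
    exact add_mem hv hw
  · rw [gen_smul, smul_mul_assoc]
    exact Submodule.smul_mem _ r hv
  · rw [degPart_monom, ← monom_X_mul]
    exact Submodule.le_topologicalClosure _ ⟨_, rfl⟩

theorem denseRange_monom (e : HilbertBasis ι ℂ V) : DenseRange (monom e) := fun θ => by
  change θ ∈ (LinearMap.range (monom e).toLinearMap).topologicalClosure
  induction θ using sym_induction with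
  | one => exact Submodule.le_topologicalClosure _ ⟨1, map_one (monom e)⟩
  | gen_mul w θ hθ =>
    obtain ⟨N, hN⟩ := exists_sum_degPart θ
    rw [← hN N le_rfl, Finset.mul_sum]
    have range_subset (n : ℕ) : Set.range (monom e) ⊆ (fun θ => gen w * degPart n θ) ⁻¹'
        (LinearMap.range (monom e).toLinearMap).topologicalClosure :=
      Set.range_subset_iff.2 (gen_mul_degPart_monom_mem e w n)
    exact Submodule.sum_mem _ fun n _ => closure_minimal (range_subset n)
      ((Submodule.isClosed_topologicalClosure _).preimage (continuous_gen_mul_degPart w n)) hθ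
  | add θ η hθ hη => exact add_mem hθ hη
  | smul r θ hθ => exact Submodule.smul_mem _ r hθ

end Density

section MonomialBasis

variable {V : Type*} [NormedAddCommGroup V] [InnerProductSpace ℂ V] {ι : Type*}

theorem orthonormal_mono {e : ι → V} (he : Orthonormal ℂ e) :
    Orthonormal ℂ fun α => (((Real.sqrt (multiFact α))⁻¹ : ℝ) : ℂ) • toFock (mono e α) := by
  classical
  rw [orthonormal_iff_ite]
  intro α β
  rw [inner_smul_left, inner_smul_right, LinearIsometry.inner_map_map, inner_mono_mono he,
    Complex.conj_ofReal]
  split_ifs with h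
  · subst h
    have sqrt_ne_zero := (Real.sqrt_pos.2 (multiFact_pos α)).ne'
    norm_cast
    nth_rw 3 [← Real.mul_self_sqrt (multiFact_pos α).le]
    field_simp
  · rw [mul_zero, mul_zero]

theorem eq_zero_of_inner_mono_eq_zero (e : HilbertBasis ι ℂ V) {Φ : Fock V}
    (hΦ : ∀ α, ⟪toFock (mono e α), Φ⟫_ℂ = 0) : Φ = 0 := by
  refine fockToDual_injective (LinearMap.ext fun θ => ?_)
  rw [map_zero, LinearMap.zero_apply, fockToDual_apply]
  refine (denseRange_monom e).induction_on (p := fun θ => ⟪toFock θ, Φ⟫_ℂ = 0) θ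
    (isClosed_eq (toFock.continuous.inner continuous_const) continuous_const) fun P => ?_
  induction P using MvPolynomial.induction_on' with
  | monomial α c => rw [monom_monomial, map_smul, inner_smul_left, hΦ, mul_zero]
  | add P Q hP hQ => rw [map_add, map_add, inner_add_left, hP, hQ, add_zero]

theorem exists_hilbertBasis_mono (e : HilbertBasis ι ℂ V) :
    ∃ b : HilbertBasis (ι →₀ ℕ) ℂ (Fock V),
      ∀ α, b α = (((Real.sqrt (multiFact α))⁻¹ : ℝ) : ℂ) • toFock (mono e α) := by
  refine ⟨HilbertBasis.mkOfOrthogonalEqBot (orthonormal_mono e.orthonormal) ?_, fun α => by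
    rw [HilbertBasis.coe_mkOfOrthogonalEqBot]⟩
  refine (Submodule.eq_bot_iff _).2 fun Φ hΦ => eq_zero_of_inner_mono_eq_zero e fun α => ?_
  have inner_eq_zero := (Submodule.mem_orthogonal _ _).1 hΦ _ (Submodule.subset_span ⟨α, rfl⟩)
  rw [inner_smul_left, Complex.conj_ofReal] at inner_eq_zero
  refine (mul_eq_zero.1 inner_eq_zero).resolve_left ?_
  exact_mod_cast (inv_pos.2 (Real.sqrt_pos.2 (multiFact_pos α))).ne'

theorem exists_fock_inner_mono_eq (e : HilbertBasis ι ℂ V) {m : (ι →₀ ℕ) → ℂ} {P : ℝ}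
    (hm : HasSum (fun α => ‖m α‖ ^ 2 / multiFact α) P) :
    ∃ Φ : Fock V, (∀ α, ⟪toFock (mono e α), Φ⟫_ℂ = m α) ∧ ‖Φ‖ ^ 2 = P := by
  obtain ⟨b, hb⟩ := exists_hilbertBasis_mono e
  have norm_sq (α : ι →₀ ℕ) : ‖(((Real.sqrt (multiFact α))⁻¹ : ℝ) : ℂ) * m α‖ ^ 2 =
      ‖m α‖ ^ 2 / multiFact α := by
    rw [norm_mul, mul_pow, Complex.norm_real, Real.norm_eq_abs, sq_abs, inv_pow,
      Real.sq_sqrt (multiFact_pos α).le, inv_mul_eq_div]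
  obtain ⟨Φ, hΦ⟩ := exists_forall_inner_eq b
    (c := fun α => (((Real.sqrt (multiFact α))⁻¹ : ℝ) : ℂ) * m α)
    (by simpa only [norm_sq] using hm.summable)
  refine ⟨Φ, fun α => ?_, ?_⟩
  · have inner_basis := hΦ α
    rw [hb, inner_smul_left, Complex.conj_ofReal] at inner_basis
    refine mul_left_cancel₀ ?_ inner_basis
    exact_mod_cast (inv_pos.2 (Real.sqrt_pos.2 (multiFact_pos α))).ne'
  · have parseval := hasSum_norm_inner_sq b Φ
    simp only [hΦ, norm_sq] at parseval
    exact parseval.unique hm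

end MonomialBasis

section GaussianVector

variable {V : Type*} [NormedAddCommGroup V] [InnerProductSpace ℂ V] {ι : Type*}
  {Z : V →ₗ⋆[ℂ] V} {Φ : Fock V}

theorem inner_gen_mul_degPart_of_mono (e : HilbertBasis ι ℂ V) {v z : V}
    (h : ∀ α, ⟪toFock (gen v * mono e α), Φ⟫_ℂ = ⟪toFock (annihilator z (mono e α)), Φ⟫_ℂ)
    (n : ℕ) (θ : SymAlgC V) : ⟪toFock (gen v * degPart n θ), Φ⟫_ℂ =
      ⟪toFock (annihilator z (degPart n θ)), Φ⟫_ℂ := by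
  have monom_case (P : MvPolynomial ι ℂ) : ⟪toFock (gen v * monom e P), Φ⟫_ℂ =
      ⟪toFock (annihilator z (monom e P)), Φ⟫_ℂ := by
    induction P using MvPolynomial.induction_on' with
    | monomial α c => simp only [monom_monomial, mul_smul_comm, map_smul, inner_smul_left, h]
    | add P Q hP hQ => simp only [map_add, mul_add, inner_add_left, hP, hQ]
  refine (denseRange_monom e).induction_on (p := fun θ => ⟪toFock (gen v * degPart n θ), Φ⟫_ℂ =
    ⟪toFock (annihilator z (degPart n θ)), Φ⟫_ℂ) θ (isClosed_eq ?_ ?_) fun P => ?_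
  · exact (toFock.continuous.comp (continuous_gen_mul_degPart v n)).inner continuous_const
  · exact (toFock.continuous.comp (continuous_annihilator_degPart z n)).inner continuous_const
  · rw [degPart_monom, monom_case]

theorem isGaussianWith_of_degPart
    (h : ∀ v n θ, ⟪toFock (gen v * degPart n θ), Φ⟫_ℂ =
      ⟪toFock (annihilator (Z v) (degPart n θ)), Φ⟫_ℂ) :
    IsGaussianWith Z (fockToDual Φ) := by
  refine isGaussianWith_iff.2 fun v θ => ?_
  obtain ⟨N, hN⟩ := exists_sum_degPart θ
  rw [← hN N le_rfl, Finset.mul_sum, map_sum (annihilator (Z v))]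
  simp only [map_sum, fockToDual_apply, h]

theorem isGaussianWith_of_mono (hZ : Continuous Z) (e : HilbertBasis ι ℂ V)
    (h : ∀ i α, ⟪toFock (gen (e i) * mono e α), Φ⟫_ℂ =
      ⟪toFock (annihilator (Z (e i)) (mono e α)), Φ⟫_ℂ) :
    IsGaussianWith Z (fockToDual Φ) := by
  refine isGaussianWith_of_degPart fun v n θ => ?_
  refine hilbertBasis_induction e (P := fun v => ⟪toFock (gen v * degPart n θ), Φ⟫_ℂ =
    ⟪toFock (annihilatorMap (degPart n θ) (Z v)), Φ⟫_ℂ) (isClosed_eq ?_ ?_) ?_ (fun v w hv hw => ?_)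
    (fun r v hv => ?_) (fun i => inner_gen_mul_degPart_of_mono e (h i) n θ) v
  · exact (toFock.continuous.comp (continuous_gen_mul_degPart_left n θ)).inner continuous_const
  · exact (toFock.continuous.comp
      ((continuous_annihilatorMap_degPart n θ).comp hZ)).inner continuous_const
  · rw [gen_zero, zero_mul, map_zero Z, map_zero (annihilatorMap _)]
  · rw [gen_add, add_mul, map_add Z, map_add (annihilatorMap _), map_add, map_add,
      inner_add_left, inner_add_left, hv, hw]
  · rw [gen_smul, smul_mul_assoc, map_smulₛₗ Z, map_smulₛₗ (annihilatorMap _), Complex.conj_conj,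
      map_smul, map_smul, inner_smul_left, inner_smul_left, hv]

theorem exists_gaussian_vector (hZ : Continuous Z) (e : HilbertBasis ι ℂ V) {l : ι → ℝ}
    (hl_lt : ∀ i, |l i| < 1) (hl : ∀ i, Z (e i) = (l i : ℂ) • e i) {P : ℝ}
    (hP : HasProd (fun i => (1 - l i ^ 2) ^ (-1 / 2 : ℝ)) P) :
    ∃ Φ : Fock V, ⟪toFock 1, Φ⟫_ℂ = 1 ∧ ‖Φ‖ ^ 2 = P ∧ IsGaussianWith Z (fockToDual Φ) := by
  obtain ⟨Φ, inner_mono, norm_sq⟩ := exists_fock_inner_mono_eq e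
    (m := fun α => (gaussMoment l α : ℂ))
    (by simpa only [Complex.norm_real, Real.norm_eq_abs, sq_abs] using
      hasSum_gaussMoment_sq hl_lt hP)
  refine ⟨Φ, ?_, norm_sq, isGaussianWith_of_mono hZ e fun i α => ?_⟩
  · rw [← mono_zero e, inner_mono, gaussMoment, Finsupp.prod_zero_index, Complex.ofReal_one]
  · rw [← mono_add_single, inner_mono, hl, annihilator_smul, Complex.conj_ofReal,
      LinearMap.smul_apply, annihilator_mono e.orthonormal, map_smul, map_smul, inner_smul_left,
      inner_smul_left, inner_mono, Complex.conj_ofReal, Complex.conj_natCast,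
      gaussMoment_add_single]
    push_cast
    rfl

end GaussianVector

/-! ### The Fredholm determinant of `1 - Z²` -/

section FredholmDet

theorem mem_span_image_of_inner_eq_zero {𝕜 E ι : Type*} [RCLike 𝕜] [NormedAddCommGroup E]
    [InnerProductSpace 𝕜 E] (e : HilbertBasis ι 𝕜 E) {s : Set ι} (hs : s.Finite) {x : E}
    (hx : ∀ i ∉ s, ⟪e i, x⟫_𝕜 = 0) : x ∈ Submodule.span 𝕜 (e '' s) := by
  have expansion : HasSum (fun i => e.repr x i • e i) (∑ i ∈ hs.toFinset, e.repr x i • e i) :=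
    hasSum_sum_of_ne_finset_zero fun i hi => by
      rw [e.repr_apply_apply, hx i (by simpa only [Set.Finite.mem_toFinset] using hi), zero_smul]
  rw [(e.hasSum_repr x).unique expansion]
  exact Submodule.sum_mem _ fun i hi => Submodule.smul_mem _ _ <|
    Submodule.subset_span (Set.mem_image_of_mem e (hs.mem_toFinset.1 hi))

theorem finite_setOf_le_of_summable {ι : Type*} {f : ι → ℝ} (hf : Summable f) {c : ℝ}
    (hc : 0 < c) : {i | c ≤ f i}.Finite := by
  simpa only [Filter.eventually_cofinite, not_lt] using
    hf.tendsto_cofinite_zero.eventually_lt_const hc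

variable {V : Type*} [NormedAddCommGroup V] [InnerProductSpace ℂ V] {ι : Type*}

theorem eigenspace_eq_span_of_hilbertBasis {T : Module.End ℂ V} (hT : T.IsSymmetric)
    (e : HilbertBasis ι ℂ V) {d : ι → ℂ} (hd : ∀ i, T (e i) = d i • e i) {ν : ℂ}
    (hfin : {i | d i = ν}.Finite) :
    T.eigenspace ν = Submodule.span ℂ (e '' {i | d i = ν}) := by
  have basis_mem (i : ι) : e i ∈ T.eigenspace (d i) := Module.End.mem_eigenspace_iff.2 (hd i)
  refine le_antisymm (fun x hx => mem_span_image_of_inner_eq_zero e hfin fun i hi => ?_)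
    (Submodule.span_le.2 ?_)
  · exact hT.orthogonalFamily_eigenspaces hi ⟨e i, basis_mem i⟩ ⟨x, hx⟩
  · rintro _ ⟨i, rfl, rfl⟩
    exact basis_mem i

theorem finrank_maxGenEigenspace_of_hilbertBasis {T : Module.End ℂ V} (hT : T.IsSymmetric)
    (e : HilbertBasis ι ℂ V) {d : ι → ℂ} (hd : ∀ i, T (e i) = d i • e i) {ν : ℂ}
    (hfin : {i | d i = ν}.Finite) :
    Module.finrank ℂ (T.maxGenEigenspace ν) = Nat.card {i // d i = ν} := by
  have : Fintype {i // d i = ν} := hfin.fintype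
  have independent : LinearIndependent ℂ fun i : {i // d i = ν} => e i :=
    e.orthonormal.linearIndependent.comp _ Subtype.val_injective
  rw [hT.isFinitelySemisimple.maxGenEigenspace_eq_eigenspace,
    eigenspace_eq_span_of_hilbertBasis hT e hd hfin, Set.image_eq_range]
  exact (finrank_span_eq_card independent).trans Nat.card_eq_fintype_card.symm

theorem fredholmDet_of_hilbertBasis {T : Module.End ℂ V} (hT : T.IsSymmetric)
    (e : HilbertBasis ι ℂ V) {d : ι → ℂ} (hd : ∀ i, T (e i) = d i • e i)
    (hfin : ∀ ν, ν ≠ 1 → {i | d i = ν}.Finite) {D : ℂ} (hD : HasProd d D) :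
    fredholmDet T = D := by
  refine (((Equiv.sigmaFiberEquiv d).hasProd_iff.2 hD).sigma fun ν => ?_).tprod_eq
  have fiber_const : (fun i : {i // d i = ν} => d (Equiv.sigmaFiberEquiv d ⟨ν, i⟩)) = fun _ => ν :=
    funext Subtype.prop
  simp only [Function.comp_apply, fiber_const]
  rcases eq_or_ne ν 1 with rfl | hν
  · simpa only [one_pow] using hasProd_one
  · have : Fintype {i // d i = ν} := (hfin ν hν).fintype
    have fiber_prod := hasProd_fintype fun _ : {i // d i = ν} => ν
    rwa [Finset.prod_const, Finset.card_univ, ← Nat.card_eq_fintype_card,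
      ← finrank_maxGenEigenspace_of_hilbertBasis hT e hd (hfin ν hν)] at fiber_prod

theorem isSymmetric_one_sub_sq {Z : V →ₗ⋆[ℂ] V} (hZ : ∀ x y, ⟪y, Z x⟫_ℂ = ⟪x, Z y⟫_ℂ) :
    (1 - Z.comp Z : Module.End ℂ V).IsSymmetric := fun x y => by
  simp only [LinearMap.sub_apply, Module.End.one_apply, LinearMap.comp_apply, inner_sub_left,
    inner_sub_right]
  rw [← inner_conj_symm (Z (Z x)) y, hZ (Z x) y, inner_conj_symm, hZ x (Z y)]

theorem one_sub_sq_apply_of_real_smul {Z : V →ₗ⋆[ℂ] V} {x : V} {l : ℝ}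
    (hx : Z x = (l : ℂ) • x) :
    (1 - Z.comp Z : Module.End ℂ V) x = ((1 - l ^ 2 : ℝ) : ℂ) • x := by
  simp only [LinearMap.sub_apply, Module.End.one_apply, LinearMap.comp_apply]
  rw [hx, map_smulₛₗ, hx, Complex.conj_ofReal, smul_smul]
  push_cast
  rw [sub_smul, one_smul, sq]

theorem finite_setOf_one_sub_sq_eq {l : ι → ℝ} (hs : Summable fun i => l i ^ 2) {ν : ℂ}
    (hν : ν ≠ 1) : {i | ((1 - l i ^ 2 : ℝ) : ℂ) = ν}.Finite := by
  rcases Set.eq_empty_or_nonempty {i | ((1 - l i ^ 2 : ℝ) : ℂ) = ν} with h_empty | ⟨i, rfl⟩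
  · rw [h_empty]
    exact Set.finite_empty
  · have sq_pos : 0 < l i ^ 2 := (sq_nonneg _).lt_of_ne' fun h => hν (by rw [h]; norm_num)
    exact (finite_setOf_le_of_summable hs sq_pos).subset fun j hj =>
      (sub_right_injective (Complex.ofReal_injective hj)).ge

theorem fredholmDet_one_sub_sq {Z : V →ₗ⋆[ℂ] V} (hZ : ∀ x y, ⟪y, Z x⟫_ℂ = ⟪x, Z y⟫_ℂ)
    (e : HilbertBasis ι ℂ V) {l : ι → ℝ} (hl : ∀ i, Z (e i) = (l i : ℂ) • e i)
    (hs : Summable fun i => l i ^ 2) {D : ℝ} (hD : HasProd (fun i => 1 - l i ^ 2) D) :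
    fredholmDet (1 - Z.comp Z) = D :=
  fredholmDet_of_hilbertBasis (isSymmetric_one_sub_sq hZ) e
    (fun i => one_sub_sq_apply_of_real_smul (hl i)) (fun _ hν => finite_setOf_one_sub_sq_eq hs hν)
    (hD.map Complex.ofRealHom Complex.continuous_ofReal)

end FredholmDet

/-! ### Fock space Gaussians -/

section GaussianDecay

theorem exists_lt_forall_le_of_tendsto_cofinite {ι : Type*} {f : ι → ℝ} {a c : ℝ}
    (hf : Filter.Tendsto f Filter.cofinite (nhds a)) (hac : a < c) (hfc : ∀ i, f i < c) :
    ∃ m < c, ∀ i, f i ≤ m := by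
  obtain ⟨b, hab, hbc⟩ := exists_between hac
  have finite_ge : {i | b ≤ f i}.Finite := by
    simpa only [Filter.eventually_cofinite, not_lt] using hf.eventually_lt_const hab
  have eventually_ge {x : ℝ} (hx : x < c) : ∀ᶠ m in nhdsWithin c (Set.Iio c), x ≤ m :=
    nhdsWithin_le_nhds (eventually_ge_nhds hx)
  obtain ⟨m, hbm, hfm, hmc⟩ := ((eventually_ge hbc).and
    (((Filter.eventually_all_finite finite_ge).2 fun i _ => eventually_ge (hfc i)).and
      eventually_mem_nhdsWithin)).exists
  exact ⟨m, hmc, fun i => (le_total b (f i)).elim (hfm i) fun hi => hi.trans hbm⟩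

theorem exists_one_lt_forall_abs_sq_mul_lt_one {ι : Type*} {l : ι → ℝ}
    (hl : Filter.Tendsto l Filter.cofinite (nhds 0)) (hl_lt : ∀ i, |l i| < 1) :
    ∃ t : ℝ, 1 < t ∧ ∀ i, |t ^ 2 * l i| < 1 := by
  obtain ⟨m, hm, hlm⟩ := exists_lt_forall_le_of_tendsto_cofinite
    ((tendsto_zero_iff_abs_tendsto_zero l).1 hl) one_pos hl_lt
  have eventually_lt : ∀ᶠ t : ℝ in nhdsWithin 1 (Set.Ioi 1), t ^ 2 * m < 1 :=
    nhdsWithin_le_nhds <| ContinuousAt.eventually_lt (by fun_prop) continuousAt_const (by simpa)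
  obtain ⟨t, htm, ht⟩ := (eventually_lt.and eventually_mem_nhdsWithin).exists
  refine ⟨t, ht, fun i => ?_⟩
  rw [abs_mul, abs_sq]
  exact (mul_le_mul_of_nonneg_left (hlm i) (sq_nonneg t)).trans_lt htm

theorem tendsto_cofinite_zero_of_summable_sq {ι : Type*} {l : ι → ℝ}
    (hs : Summable fun i => l i ^ 2) : Filter.Tendsto l Filter.cofinite (nhds 0) := by
  rw [tendsto_zero_iff_abs_tendsto_zero, Function.comp_def]
  simpa only [Real.sqrt_sq_eq_abs, Real.sqrt_zero] using hs.tendsto_cofinite_zero.sqrt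

variable {V : Type*} [NormedAddCommGroup V] [InnerProductSpace ℂ V]

theorem IsGaussianWith.apply_degPart_of_scale {Z : V → V} {Φ Ψ : AntiDual V} {t : ℂ}
    (hΦ : IsGaussianWith Z Φ) (hΨ : IsGaussianWith (fun v => t ^ 2 • Z v) Ψ) (h : Ψ 1 = Φ 1)
    (n : ℕ) (θ : SymAlgC V) : Ψ (degPart n θ) = t ^ n * Φ (degPart n θ) := by
  have apply_gen_mul (v : V) (θ : SymAlgC V) :
      Ψ (gen v * θ) = t ^ 2 * Ψ (annihilator (Z v) θ) := by
    rw [isGaussianWith_iff.1 hΨ, annihilator_smul, LinearMap.smul_apply, map_smulₛₗ,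
      Complex.conj_conj, smul_eq_mul]
  induction n using Nat.strong_induction_on generalizing θ with
  | _ n ih =>
    induction θ using sym_induction with
    | one =>
      rw [degPart_one]
      split_ifs with hn
      · rw [hn, h, pow_zero, one_mul]
      · rw [map_zero, map_zero, mul_zero]
    | gen_mul w θ _ =>
      match n, ih with
      | 0, _ => rw [degPart_zero_gen_mul, map_zero, map_zero, mul_zero]
      | 1, _ =>
        rw [degPart_succ_gen_mul, apply_gen_mul, isGaussianWith_iff.1 hΦ,
          annihilator_degPart_zero, map_zero, map_zero, mul_zero, mul_zero]
      | n + 2, ih =>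
        rw [degPart_succ_gen_mul, apply_gen_mul, isGaussianWith_iff.1 hΦ,
          annihilator_degPart_succ, ih n (by omega)]
        ring
    | add θ η hθ hη => simp only [map_add, hθ, hη, mul_add]
    | smul r θ hθ =>
      simp only [map_smul, map_smulₛₗ, hθ, smul_eq_mul]
      ring

theorem norm_fockToDual_degPart_le (Φ : Fock V) (n : ℕ) (θ : SymAlgC V) :
    ‖fockToDual Φ (degPart n θ)‖ ≤ ‖Φ‖ * ‖θ‖ := by
  refine (norm_inner_le_norm (𝕜 := ℂ) (toFock (degPart n θ)) Φ).trans ?_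
  rw [LinearIsometry.norm_map, mul_comm]
  exact mul_le_mul_of_nonneg_left (norm_degPart_le n θ) (norm_nonneg Φ)

/-- The factor `t ^ n` gained in degree `n` by scaling `Z` is where the decay comes from. -/
theorem IsGaussianWith.geomDecay_of_scale {Z : V → V} {Φ : AntiDual V} {Ψ : Fock V} {t : ℝ}
    (ht : 1 < t) (hΦ : IsGaussianWith Z Φ)
    (hΨ : IsGaussianWith (fun v => (t : ℂ) ^ 2 • Z v) (fockToDual Ψ))
    (h : fockToDual Ψ 1 = Φ 1) : GeomDecay Φ := by
  have t_pos : 0 < t := one_pos.trans ht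
  refine ⟨‖Ψ‖, t⁻¹, norm_nonneg _, inv_pos.2 t_pos, inv_lt_one_of_one_lt₀ ht, fun n θ => ?_⟩
  have bound := norm_fockToDual_degPart_le Ψ n θ
  rw [hΦ.apply_degPart_of_scale hΨ h, norm_mul, norm_pow, Complex.norm_real,
    Real.norm_of_nonneg t_pos.le] at bound
  rw [inv_pow, mul_right_comm, ← div_eq_mul_inv, le_div_iff₀' (by positivity)]
  exact bound

theorem IsGaussianWith.geomDecay_of_diagonal {ι : Type*} {Z : V →ₗ⋆[ℂ] V} (hZ : Continuous Z)
    (e : HilbertBasis ι ℂ V) {l : ι → ℝ} (hl_lt : ∀ i, |l i| < 1)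
    (hl : ∀ i, Z (e i) = (l i : ℂ) • e i) (hs : Summable fun i => l i ^ 2) {Φ : AntiDual V}
    (hΦ : IsGaussianWith Z Φ) (hΦ_one : Φ 1 = 1) : GeomDecay Φ := by
  obtain ⟨t, ht, htl⟩ := exists_one_lt_forall_abs_sq_mul_lt_one
    (tendsto_cofinite_zero_of_summable_sq hs) hl_lt
  have summable_scaled : Summable fun i => (t ^ 2 * l i) ^ 2 := by
    simpa only [mul_pow] using hs.mul_left _
  obtain ⟨D, -, -, hD⟩ :=
    exists_hasProd_one_sub_sq (fun i => (sq_lt_one_iff_abs_lt_one _).2 (htl i)) summable_scaled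
  obtain ⟨Ψ, hΨ_one, -, hΨ⟩ := exists_gaussian_vector (Z := (t : ℂ) ^ 2 • Z)
    (hZ.const_smul _) e htl (fun i => by
      rw [LinearMap.smul_apply, hl, smul_smul, Complex.ofReal_mul, Complex.ofReal_pow])
    (hD (-1 / 2))
  exact hΦ.geomDecay_of_scale ht hΨ (hΨ_one.trans hΦ_one.symm)

theorem abs_lt_one_of_apply_eq_smul {Z : V → V} (hZ : ∀ x ≠ 0, ‖Z x‖ < ‖x‖) {x : V} (hx : x ≠ 0)
    {l : ℝ} (h : Z x = (l : ℂ) • x) : |l| < 1 := by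
  have norm_lt := hZ x hx
  rwa [h, norm_smul, mul_lt_iff_lt_one_left (norm_pos_iff.2 hx), Complex.norm_real] at norm_lt

theorem IsGaussianWith.geomDecay_and_norm_sq_eq_det [CompleteSpace V] {Z : V →ₗ⋆[ℂ] V}
    (hZ : ∀ x y, ⟪y, Z x⟫_ℂ = ⟪x, Z y⟫_ℂ) (hZ_lt : ∀ x ≠ 0, ‖Z x‖ < ‖x‖)
    (hHS : IsHilbertSchmidt Z) {Φ : AntiDual V} (hΦ : IsGaussianWith Z Φ) (hΦ_one : Φ 1 = 1) :
    GeomDecay Φ ∧ ∃ D : ℝ, 0 < D ∧ fredholmDet (1 - Z.comp Z) = D ∧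
      ∃ Ξ : Fock V, fockToDual Ξ = Φ ∧ ‖Ξ‖ ^ 2 = D ^ (-1 / 2 : ℝ) := by
  obtain ⟨s, e, l, -, hl, hs⟩ := exists_takagi_basis hZ hHS
  have hl_lt (i : s) : |l i| < 1 :=
    abs_lt_one_of_apply_eq_smul hZ_lt (e.orthonormal.ne_zero i) (hl i)
  obtain ⟨D, D_pos, hD, hD_rpow⟩ :=
    exists_hasProd_one_sub_sq (fun i => (sq_lt_one_iff_abs_lt_one _).2 (hl_lt i)) hs
  obtain ⟨Ξ, hΞ_one, norm_sq, hΞ⟩ := exists_gaussian_vector hHS.1 e hl_lt hl (hD_rpow (-1 / 2))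
  exact ⟨hΦ.geomDecay_of_diagonal hHS.1 e hl_lt hl hs hΦ_one, D, D_pos,
    fredholmDet_one_sub_sq hZ e hl hs hD, Ξ, hΞ.ext hΦ (hΞ_one.trans hΦ_one.symm), norm_sq⟩

end GaussianDecay

section Sufficiency

variable {V : Type*} [NormedAddCommGroup V] [InnerProductSpace ℂ V] {g : SpGroup V}
  {T : Fock V →L[ℂ] Fock V}

theorem norm_toFock_one : ‖toFock (1 : SymAlgC V)‖ = 1 := by
  rw [LinearIsometry.norm_map, @norm_eq_sqrt_re_inner ℂ, inner_one_one, RCLike.one_re,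
    Real.sqrt_one]

theorem Intertwines.norm_apply (hT : Intertwines g (restr T)) (Φ : Fock V) :
    ‖T Φ‖ = ‖T (toFock 1)‖ * ‖Φ‖ :=
  fock_induction (P := fun Φ => ‖T Φ‖ = ‖T (toFock 1)‖ * ‖Φ‖)
    (isClosed_eq (by fun_prop) (by fun_prop))
    (fun θ => by rw [LinearIsometry.norm_map]; exact hT.norm_map θ) Φ

theorem Intertwines.smul (hT : Intertwines g (restr T)) (c : ℂ) :
    Intertwines g (restr (c • T)) := fun v φ => (isFieldValue_iff _ _ _).2 fun θ => by
  have field_T := (isFieldValue_iff _ _ _).1 (hT v φ) θ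
  simp only [restr_apply, smul_apply, inner_smul_right] at field_T ⊢
  rw [field_T]

theorem Intertwines.opNorm_eq (hT : Intertwines g (restr T)) : ‖T‖ = ‖T (toFock 1)‖ :=
  le_antisymm (T.opNorm_le_bound (norm_nonneg _) fun Φ => (hT.norm_apply Φ).le) <|
    (T.le_opNorm (toFock 1)).trans_eq (by rw [norm_toFock_one, mul_one])

theorem Intertwines.norm_adjoint_apply_one (hT : Intertwines g (restr T)) :
    ‖ContinuousLinearMap.adjoint T (toFock 1)‖ = ‖T (toFock 1)‖ := by
  rw [← hT.opNorm_eq, ← hT.adjoint.opNorm_eq, LinearIsometryEquiv.norm_map]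

theorem Intertwines.adjoint_comp_self (hT : Intertwines g (restr T))
    (hT_one : ‖T (toFock 1)‖ = 1) : ContinuousLinearMap.adjoint T ∘L T = 1 :=
  T.norm_map_iff_adjoint_comp_self.1 fun Φ => by rw [hT.norm_apply, hT_one, one_mul]

theorem Intertwines.mem_unitary (hT : Intertwines g (restr T)) (hT_one : ‖T (toFock 1)‖ = 1) :
    T ∈ unitary (Fock V →L[ℂ] Fock V) := by
  have self_comp_adjoint :=
    hT.adjoint.adjoint_comp_self (hT.norm_adjoint_apply_one.trans hT_one)
  rw [ContinuousLinearMap.adjoint_adjoint] at self_comp_adjoint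
  exact Unitary.mem_iff.2 ⟨hT.adjoint_comp_self hT_one, self_comp_adjoint⟩

variable [CompleteSpace V]

theorem geomDecay_weakOp (h : GeomDecay (weakOp g 1)) (φ : SymAlgC V) :
    GeomDecay (weakOp g φ) := by
  induction φ using sym_induction with
  | one => exact h
  | gen_mul v φ ih =>
    have creator_eq : weakOp g (gen v * φ) =
        (weakOp g φ).comp (annihilator (Cg g v)) + antiShift (gen (Ag g v)) (weakOp g φ) :=
      LinearMap.ext fun ψ => weakOp_creator g v φ ψ
    rw [creator_eq]
    exact (ih.comp_annihilator _).add (ih.comp_gen_mul _)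
  | add φ ψ hφ hψ => rw [map_add]; exact hφ.add hψ
  | smul r φ hφ => rw [map_smul]; exact hφ.smul r

theorem intertwines_of_fockToDual_eq_weakOp {U : SymAlgC V →ₗ[ℂ] Fock V}
    (hU : ∀ φ, fockToDual (U φ) = weakOp g φ) : Intertwines g U := fun v φ => by
  rw [IsFieldValue, hU, hU]
  exact (isWeakMetaplectic_weakOp g).2 v φ

theorem exists_linearMap_fockToDual_eq_weakOp (h : GeomDecay (weakOp g 1)) :
    ∃ U : SymAlgC V →ₗ[ℂ] Fock V, ∀ φ, fockToDual (U φ) = weakOp g φ := by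
  choose U hU using fun φ => (geomDecay_weakOp h φ).exists_fockToDual_eq
  exact ⟨
    { toFun := U
      map_add' := fun φ ψ => fockToDual_injective (by rw [map_add, hU, hU, hU, map_add])
      map_smul' := fun r φ => fockToDual_injective (by
        rw [RingHom.id_apply, map_smul, hU, hU, map_smul]) }, hU⟩

theorem exists_extension_weakOp (h : GeomDecay (weakOp g 1)) :
    ∃ T : Fock V →L[ℂ] Fock V, ∀ φ, fockToDual (T (toFock φ)) = weakOp g φ := by
  obtain ⟨U, hU⟩ := exists_linearMap_fockToDual_eq_weakOp h
  let U_cont : SymAlgC V →L[ℂ] Fock V := U.mkContinuous ‖U 1‖ fun φ =>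
    ((intertwines_of_fockToDual_eq_weakOp hU).norm_map φ).le
  refine ⟨U_cont.extend toFock.toContinuousLinearMap, fun φ => ?_⟩
  rw [← hU]
  exact congrArg fockToDual (U_cont.extend_eq (e := toFock.toContinuousLinearMap)
    denseRange_toFock toFock.isometry.isUniformInducing φ)

theorem fockToDual_adjoint_eq_weakOp (hT : ∀ φ, fockToDual (T (toFock φ)) = weakOp g⁻¹ φ)
    (φ : SymAlgC V) :
    fockToDual (ContinuousLinearMap.adjoint T (toFock φ)) = weakOp g φ :=
  LinearMap.ext fun ψ => by
    rw [fockToDual_apply, ContinuousLinearMap.adjoint_inner_right, ← conj_weakOp_inv, ← hT,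
      fockToDual_apply, inner_conj_symm]

theorem rpow_quarter_mul_eq_one {D x : ℝ} (hD : 0 < D) (hx : 0 ≤ x)
    (h : x ^ 2 = D ^ (-1 / 2 : ℝ)) : D ^ (1 / 4 : ℝ) * x = 1 := by
  rw [← sq_eq_sq₀ (by positivity) zero_le_one, mul_pow, h, ← Real.rpow_natCast,
    ← Real.rpow_mul hD.le, ← Real.rpow_add hD]
  norm_num

/-- The vacuum image is computed for `g⁻¹`, whose Gaussian has covariance `Z_g`; the operator for
`g` is then the adjoint. -/
theorem exists_isUnitaryMetaplectic (hHS : IsHilbertSchmidt (Zg g)) :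
    ∃ U : Fock V →L[ℂ] Fock V, (∀ φ, fockToDual (U (toFock φ)) = weakOp g φ) ∧
      IsUnitaryMetaplectic g ((fredholmDet (1 - (Zg g).comp (Zg g)) ^ (1 / 4 : ℂ)) • U) := by
  have gaussian_inv : IsGaussianWith (Zg g) (weakOp g⁻¹ 1) := by
    simpa only [inv_inv] using isGaussianWith_weakOp_one g⁻¹
  obtain ⟨decay, D, D_pos, det_eq, Ξ, hΞ, norm_sq⟩ := gaussian_inv.geomDecay_and_norm_sq_eq_det
    (inner_Zg g) (fun _ => norm_Zg_lt g) hHS (weakOp_one_one _)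
  obtain ⟨T, hT⟩ := exists_extension_weakOp decay
  have T_intertwines : Intertwines g⁻¹ (restr T) := intertwines_of_fockToDual_eq_weakOp hT
  have T_one : T (toFock 1) = Ξ := fockToDual_injective ((hT 1).trans hΞ.symm)
  have quarter_power : (D : ℂ) ^ (1 / 4 : ℂ) = ((D ^ (1 / 4 : ℝ) : ℝ) : ℂ) := by
    rw [Complex.ofReal_cpow D_pos.le]; norm_num
  have adjoint_intertwines : Intertwines g (restr (((D ^ (1 / 4 : ℝ) : ℝ) : ℂ) •
      ContinuousLinearMap.adjoint T)) := by
    simpa only [inv_inv] using T_intertwines.adjoint.smul ((D ^ (1 / 4 : ℝ) : ℝ) : ℂ)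
  refine ⟨ContinuousLinearMap.adjoint T, fockToDual_adjoint_eq_weakOp hT, ?_⟩
  rw [det_eq, quarter_power, isUnitaryMetaplectic_iff]
  refine ⟨adjoint_intertwines.mem_unitary ?_, adjoint_intertwines⟩
  rw [smul_apply, norm_smul, T_intertwines.norm_adjoint_apply_one, T_one,
    Complex.norm_real, Real.norm_of_nonneg (by positivity)]
  exact rpow_quarter_mul_eq_one D_pos (norm_nonneg Ξ) norm_sq

end Sufficiency

end BosonicFock

end

theorem mainTheorem1 {V : Type*} [NormedAddCommGroup V] [InnerProductSpace ℂ V] [CompleteSpace V]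
    (g : BosonicFock.SpGroup V) :
    ((∃ T : BosonicFock.Fock V →L[ℂ] BosonicFock.Fock V, BosonicFock.IsUnitaryMetaplectic g T) ↔
        BosonicFock.IsHilbertSchmidt (BosonicFock.Zg g)) ∧
      ((∃ T : BosonicFock.Fock V →L[ℂ] BosonicFock.Fock V, BosonicFock.IsUnitaryImplementer g T) ↔
        BosonicFock.IsHilbertSchmidt (BosonicFock.Zg g)) ∧
      (BosonicFock.IsHilbertSchmidt (BosonicFock.Zg g) →
        ∃ U : BosonicFock.Fock V →L[ℂ] BosonicFock.Fock V,
          (∀ φ : BosonicFock.SymAlgC V,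
            BosonicFock.fockToDual (U (BosonicFock.toFock φ)) = BosonicFock.weakOp g φ) ∧
          BosonicFock.IsUnitaryMetaplectic g
            ((BosonicFock.fredholmDet (1 - (BosonicFock.Zg g).comp (BosonicFock.Zg g)) ^
              (1 / 4 : ℂ)) • U) ∧
          BosonicFock.IsUnitaryImplementer g
            ((BosonicFock.fredholmDet (1 - (BosonicFock.Zg g).comp (BosonicFock.Zg g)) ^
              (1 / 4 : ℂ)) • U)) := by
  simp only [BosonicFock.isUnitaryImplementer_iff, and_self]
  have exists_iff_isHilbertSchmidt :
      (∃ T : BosonicFock.Fock V →L[ℂ] BosonicFock.Fock V, BosonicFock.IsUnitaryMetaplectic g T) ↔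
        BosonicFock.IsHilbertSchmidt (BosonicFock.Zg g) :=
    ⟨fun ⟨_, hT⟩ => hT.isHilbertSchmidt, fun hHS =>
      let ⟨_, _, hU⟩ := BosonicFock.exists_isUnitaryMetaplectic hHS
      ⟨_, hU⟩⟩
  exact ⟨exists_iff_isHilbertSchmidt, exists_iff_isHilbertSchmidt,
    BosonicFock.exists_isUnitaryMetaplectic⟩
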